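/- Let $\alpha\in(\tfrac12,1]$, $\gamma>1$, $a>0$, $0<\epsilon<\tfrac14$, $0<T_0<\infty$, and set $\beta=\tfrac12+\epsilon$. Let $\rho_-,\rho_+>0$ and let $\bar\rho\colon\mathbb R\to\mathbb R$ be a smooth monotone function with $\bar\rho=\rho_-$ on $(-\infty,-1]$ and $\bar\rho=\rho_+$ on $[1,\infty)$. Let $(\rho_0,u_0)$ satisfy $0<\alpha_0\le\rho_0\le\beta_0<\infty$ for some constants $\alpha_0,\beta_0$, $\rho_0-\bar\rho\in H^1(\mathbb R)$, $u_0\in H^1(\mathbb R)$ and $\partial_x\rho_0\in L^\infty(\mathbb R)$. Let $(\rho,u)$ be a strong solution on $[0,T_0)\times\mathbb R$, with $(\rho,u)|_{t=0}=(\rho_0,u_0)$, of $$\partial_t\rho+\partial_x(\rho u)=0,\qquad \partial_t(\rho u)+\partial_x(\rho u^2)-\partial_x(\rho^\alpha\partial_x u)+\partial_x(a\rho^\gamma)=0,$$ that is: $\rho,u$ are continuous on $[0,T_0)\times\mathbb R$, the equations hold in the sense of distributions on $(0,T_0)\times\mathbb R$, and for every $T_1\in(0,T_0)$ $$\rho-\bar\rho,\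 u\in L^\infty(0,T_1;H^1(\mathbb R)),\quad u\in L^2(0,T_1;H^2(\mathbb R)),\quad \partial_t\rho,\ \partial_t u\in L^2((0,T_1)\times\mathbb R),$$ and there are constants $0<c\le C<\infty$ (depending on $T_1$) with $c\le\rho\le C$ on $(0,T_1)\times\mathbb R$. (No bound uniform as $T_1\to T_0$ is assumed.) Then $$\rho^{\beta}u\in L^2([0,T_0];L^\infty(\mathbb R)).$$ -/

import Mathlib

open MeasureTheory Set
open scoped ENNReal NNReal ContDiff

noncomputable section

namespace CNS

/-! ### Sobolev regularity on the real line -/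

/-- `g` is the weak derivative of `f` on `ℝ`. -/
def HasWeakDeriv (f g : ℝ → ℝ) : Prop :=
  LocallyIntegrable f volume ∧ LocallyIntegrable g volume ∧
    ∀ φ : ℝ → ℝ, ContDiff ℝ ∞ φ → HasCompactSupport φ →
      ∫ x, f x * deriv φ x = -∫ x, g x * φ x

/-- `f ∈ H¹(ℝ)`. -/
def MemH1 (f : ℝ → ℝ) : Prop :=
  MemLp f 2 volume ∧ ∃ g, HasWeakDeriv f g ∧ MemLp g 2 volume

/-! ### Functions of `(t, x)` on the strip `(0, T) × ℝ` -/

/-- The open strip `(0, T) × ℝ`, with points `(t, x)`. -/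
def strip (T : ℝ) : Set (ℝ × ℝ) := Ioo 0 T ×ˢ univ

/-- `ψ ∈ C_c^∞((0, T) × ℝ)`. -/
structure IsTest (T : ℝ) (ψ : ℝ × ℝ → ℝ) : Prop where
  smooth : ContDiff ℝ ∞ ψ
  compact : HasCompactSupport ψ
  support : tsupport ψ ⊆ strip T

/-- Classical `∂_t ψ`. -/
def dt (ψ : ℝ × ℝ → ℝ) (z : ℝ × ℝ) : ℝ := fderiv ℝ ψ z (1, 0)

/-- Classical `∂_x ψ`. -/
def dx (ψ : ℝ × ℝ → ℝ) (z : ℝ × ℝ) : ℝ := fderiv ℝ ψ z (0, 1)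

/-- `g = ∂_t f` weakly on `(0, T) × ℝ`. -/
def HasWeakDt (T : ℝ) (f g : ℝ → ℝ → ℝ) : Prop :=
  LocallyIntegrableOn (fun z : ℝ × ℝ => f z.1 z.2) (strip T) volume ∧
  LocallyIntegrableOn (fun z : ℝ × ℝ => g z.1 z.2) (strip T) volume ∧
    ∀ ψ, IsTest T ψ →
      ∫ z in strip T, f z.1 z.2 * dt ψ z = -∫ z in strip T, g z.1 z.2 * ψ z

/-- `g = ∂_x f` weakly on `(0, T) × ℝ`. -/
def HasWeakDx (T : ℝ) (f g : ℝ → ℝ → ℝ) : Prop :=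
  LocallyIntegrableOn (fun z : ℝ × ℝ => f z.1 z.2) (strip T) volume ∧
  LocallyIntegrableOn (fun z : ℝ × ℝ => g z.1 z.2) (strip T) volume ∧
    ∀ ψ, IsTest T ψ →
      ∫ z in strip T, f z.1 z.2 * dx ψ z = -∫ z in strip T, g z.1 z.2 * ψ z

/-- `f ∈ L²((0, T) × ℝ)`. -/
def MemL2L2 (T : ℝ) (f : ℝ → ℝ → ℝ) : Prop :=
  MemLp (fun z : ℝ × ℝ => f z.1 z.2) 2 (volume.restrict (strip T))

/-- `f ∈ L^∞(0, T; L²(ℝ))`. -/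
def MemLinftyL2 (T : ℝ) (f : ℝ → ℝ → ℝ) : Prop :=
  AEStronglyMeasurable (fun z : ℝ × ℝ => f z.1 z.2) (volume.restrict (strip T)) ∧
    ∃ C : ℝ≥0, ∀ᵐ t ∂(volume.restrict (Ioo 0 T)), eLpNorm (f t) 2 volume ≤ C

/-- `f ∈ L^∞(0, T; H¹(ℝ))`. -/
def MemLinftyH1 (T : ℝ) (f : ℝ → ℝ → ℝ) : Prop :=
  MemLinftyL2 T f ∧ ∃ fx, HasWeakDx T f fx ∧ MemLinftyL2 T fx

/-- `f ∈ L²(0, T; H²(ℝ))`. -/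
def MemL2H2 (T : ℝ) (f : ℝ → ℝ → ℝ) : Prop :=
  MemL2L2 T f ∧ ∃ fx fxx, HasWeakDx T f fx ∧ HasWeakDx T fx fxx ∧
    MemL2L2 T fx ∧ MemL2L2 T fxx

/-- The weak derivative `∂_t f` exists and lies in `L²((0, T) × ℝ)`. -/
def DtMemL2L2 (T : ℝ) (f : ℝ → ℝ → ℝ) : Prop :=
  ∃ ft, HasWeakDt T f ft ∧ MemL2L2 T ft

/-- `f ∈ L²([0, T]; L^∞(ℝ))`, as a Bochner space: `t ↦ f(t, ·)` is (a.e. equal to) a strongly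
measurable, square integrable map into the Banach space `L^∞(ℝ)`. -/
def MemL2Linfty (T : ℝ) (f : ℝ → ℝ → ℝ) : Prop :=
  ∃ F : ℝ → Lp ℝ ∞ (volume : Measure ℝ),
    MemLp F 2 (volume.restrict (Icc 0 T)) ∧
      ∀ᵐ t ∂(volume.restrict (Icc 0 T)), (F t : ℝ → ℝ) =ᵐ[volume] f t

/-! ### The compressible Navier-Stokes system -/

/-- The reference density: smooth, monotone, equal to the positive constants `ρm` for `x ≤ -1`
and `ρp` for `x ≥ 1`. -/
structure IsReferenceDensity (ρm ρp : ℝ) (ρbar : ℝ → ℝ) : Prop where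
  left_pos : 0 < ρm
  right_pos : 0 < ρp
  smooth : ContDiff ℝ ∞ ρbar
  mono : Monotone ρbar ∨ Antitone ρbar
  left_eq : ∀ x, x ≤ -1 → ρbar x = ρm
  right_eq : ∀ x, 1 ≤ x → ρbar x = ρp

/-- Admissible initial data `(ρ₀, u₀)`: `ρ₀` is bounded and bounded away from vacuum,
`ρ₀ - ρbar ∈ H¹`, `u₀ ∈ H¹`, `∂_x ρ₀ ∈ L^∞`. -/
structure IsInitialData (ρbar ρ0 u0 : ℝ → ℝ) : Prop where
  bounds : ∃ c C : ℝ, 0 < c ∧ ∀ x, c ≤ ρ0 x ∧ ρ0 x ≤ C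
  density : MemH1 fun x => ρ0 x - ρbar x
  velocity : MemH1 u0
  density_deriv : ∃ g, HasWeakDeriv ρ0 g ∧ MemLp g ∞ volume

/-- `(ρ, u)` is a strong solution on `[0, T₀) × ℝ`, with initial data `(ρ₀, u₀)`, of
`∂_t ρ + ∂_x (ρ u) = 0`,
`∂_t (ρ u) + ∂_x (ρ u²) - ∂_x (ρ^α ∂_x u) + ∂_x (a ρ^γ) = 0`.
The functions `ρ`, `u` are the continuous representatives. All the bounds are local in time:
they are required on `(0, T₁)` for each `T₁ < T₀`, and may degenerate as `T₁ → T₀`. -/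
structure IsStrongSolution (α γ a T₀ : ℝ) (ρbar ρ0 u0 : ℝ → ℝ) (ρ u : ℝ → ℝ → ℝ) : Prop where
  density_cont : ContinuousOn (fun z : ℝ × ℝ => ρ z.1 z.2) (Ico 0 T₀ ×ˢ univ)
  velocity_cont : ContinuousOn (fun z : ℝ × ℝ => u z.1 z.2) (Ico 0 T₀ ×ˢ univ)
  density_init : ∀ x, ρ 0 x = ρ0 x
  velocity_init : ∀ x, u 0 x = u0 x
  density_bounds : ∀ T₁ ∈ Ioo 0 T₀, ∃ c C : ℝ, 0 < c ∧
    ∀ t ∈ Ioo 0 T₁, ∀ x, c ≤ ρ t x ∧ ρ t x ≤ C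
  density_H1 : ∀ T₁ ∈ Ioo 0 T₀, MemLinftyH1 T₁ fun t x => ρ t x - ρbar x
  density_dt : ∀ T₁ ∈ Ioo 0 T₀, DtMemL2L2 T₁ ρ
  velocity_H1 : ∀ T₁ ∈ Ioo 0 T₀, MemLinftyH1 T₁ u
  velocity_H2 : ∀ T₁ ∈ Ioo 0 T₀, MemL2H2 T₁ u
  velocity_dt : ∀ T₁ ∈ Ioo 0 T₀, DtMemL2L2 T₁ u
  mass : ∀ ψ, IsTest T₀ ψ →
    ∫ z in strip T₀, (ρ z.1 z.2 * dt ψ z + ρ z.1 z.2 * u z.1 z.2 * dx ψ z) = 0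
  momentum : ∃ ux, HasWeakDx T₀ u ux ∧ ∀ ψ, IsTest T₀ ψ →
    ∫ z in strip T₀, (ρ z.1 z.2 * u z.1 z.2 * dt ψ z +
      (ρ z.1 z.2 * u z.1 z.2 ^ 2 - ρ z.1 z.2 ^ α * ux z.1 z.2 + a * ρ z.1 z.2 ^ γ) * dx ψ z) = 0

end CNS

end

/-! The solution may degenerate as `T → T₀`, so the proof rests on a priori bounds on `(0, T)`, `T <
T₀`, whose constants are fixed before `T` and depend only on `T₀`, the data and the parameters. No
lower bound on the density that is uniform in time enters.

Energy (`Sol.energy_bound`). Testing the momentum equation with `u` controls `∫ ρ u²`, the potential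
energy relative to `ρbar`, and the dissipation `∫∫ ρ^α u_x²`. Since `ρbar` need not be constant, a
work term supported in `[-1, 1]` remains and is absorbed by Gronwall.

Entropy (`Sol.entropy_bound`). The effective velocity `V = u + ρ^(α-2) ρ_x` satisfies `ρ (V_t + u
V_x) = -(a ρ^γ)_x`, because the viscous term cancels. Hence `∫ ρ V²`, and with it `∫ ρ (ρ^(α-2)
ρ_x)²`, is bounded. There is not enough regularity to differentiate `V`, so `ρ^(α-2) ρ_x` is
replaced by a difference quotient of step `δ`, and `δ ↓ 0` in the integrated balance.

Density (`Sol.exists_density_bound`). The entropy is a multiple of the squared `L²` norm of the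
derivative of `ρ^(α-1/2)`. As `α > 1/2`, this bounds `ρ` from above.

Moments (`Sol.moment_bound`). Testing with higher odd powers of `u` bounds all even moments `∫ ρ
u^(2m)`; the pressure is absorbed by the dissipation, using the density bound.

Supremum (`Sol.exists_sup_bound`). With `β = 1/2 + ε`, the value of `ρ^β u` at `x` is bounded by the
integral over `[x, x+1]` of its modulus and that of its derivative `β ρ^(β-1) ρ_x u + ρ^β u_x`. The
first term is the product of `ρ^(1/2) ρ^(α-2) ρ_x`, controlled by the entropy, and `ρ^(1+ε-α) u`,
controlled by a moment with `1/m ≤ 2(1+ε-α)`; the second is controlled by the square root of the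
dissipation. So the squared supremum is at most `C (1 + D(t))`, where `D` has integral bounded
uniformly up to `T₀`.

The Bochner space also requires strong measurability into the nonseparable space `L^∞`. This follows
from norm continuity in time (`Reg.sq_sub_le_sqrt`, `memL2Linfty_of_continuous`), for which
constants may blow up at `T₀`.

To make the calculations legitimate, weak derivatives are converted into absolute continuity on
almost every line (`ae_slice_eq_primitive`), the equations into almost everywhere identities
(`Sol`), and conservation laws into integral identities (`integral_balance`). -/

noncomputable section

namespace CNS

open Filter Topology

/-! ### Primitives of integrable functions -/

/-- `f` is a primitive of the locally integrable function `g` on `s`. -/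
def Prim (s : Set ℝ) (f g : ℝ → ℝ) : Prop :=
  ∀ a ∈ s, ∀ b ∈ s, IntervalIntegrable g volume a b ∧ ∫ x in a..b, g x = f b - f a

lemma absolutelyContinuousOnInterval_congr {f g : ℝ → ℝ} {a b : ℝ}
    (hf : AbsolutelyContinuousOnInterval f a b) (h : EqOn f g (uIcc a b)) :
    AbsolutelyContinuousOnInterval g a b := by
  rw [absolutelyContinuousOnInterval_iff] at hf ⊢
  intro e he
  obtain ⟨d, hd, H⟩ := hf e he
  refine ⟨d, hd, fun E hE hlt => ?_⟩
  have := H E hE hlt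
  refine lt_of_eq_of_lt (Finset.sum_congr rfl fun i hi => ?_) this
  have h1 := hE.1 i hi
  rw [h h1.1, h h1.2]

lemma absolutelyContinuousOnInterval_comp {f G : ℝ → ℝ} {a b : ℝ} {K : ℝ≥0}
    (hf : AbsolutelyContinuousOnInterval f a b) (hG : LipschitzOnWith K G (f '' uIcc a b)) :
    AbsolutelyContinuousOnInterval (fun x => G (f x)) a b := by
  rw [absolutelyContinuousOnInterval_iff] at hf ⊢
  intro e he
  -- Dividing by `K + 1` rather than `K` keeps the tolerance meaningful when `K = 0`.
  obtain ⟨d, hd, H⟩ := hf (e / (K + 1)) (by positivity)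
  refine ⟨d, hd, fun E hE hlt => ?_⟩
  have h0 := H E hE hlt
  calc _ ≤ ∑ i ∈ Finset.range E.1, K * dist (f (E.2 i).1) (f (E.2 i).2) := by
        refine Finset.sum_le_sum fun i hi => ?_
        have h1 := hE.1 i hi
        exact hG.dist_le_mul _ (mem_image_of_mem f h1.1) _ (mem_image_of_mem f h1.2)
    _ = K * ∑ i ∈ Finset.range E.1, dist (f (E.2 i).1) (f (E.2 i).2) := by
        rw [Finset.mul_sum]
    _ ≤ K * (e / (K + 1)) := by gcongr
    _ < (K + 1) * (e / (K + 1)) := by gcongr; linarith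
    _ = e := by field_simp

lemma intervalIntegral_eq_sub_of_ae_hasDerivAt {f g : ℝ → ℝ} {a b : ℝ}
    (hf : AbsolutelyContinuousOnInterval f a b)
    (hg : ∀ᵐ x, x ∈ uIcc a b → HasDerivAt f (g x) x) :
    IntervalIntegrable g volume a b ∧ ∫ x in a..b, g x = f b - f a := by
  have h1 : ∀ᵐ x, x ∈ uIoc a b → deriv f x = g x := by
    filter_upwards [hg] with x hx hx' using (hx (uIoc_subset_uIcc hx')).deriv
  constructor
  · refine hf.intervalIntegrable_deriv.congr_ae ?_
    rw [EventuallyEq, ae_restrict_iff' measurableSet_uIoc]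
    exact h1
  · rw [← hf.integral_deriv_eq_sub]
    refine (intervalIntegral.integral_congr_ae ?_).symm
    exact h1

namespace Prim

variable {s : Set ℝ} {f g f₁ g₁ f₂ g₂ : ℝ → ℝ} {a b : ℝ}

lemma absolutelyContinuous (h : Prim s f g) [hs : OrdConnected s] (ha : a ∈ s) (hb : b ∈ s) :
    AbsolutelyContinuousOnInterval f a b := by
  have h1 := (h a ha b hb).1.absolutelyContinuousOnInterval_intervalIntegral
    (c := a) left_mem_uIcc
  have h2 : AbsolutelyContinuousOnInterval (fun _ : ℝ => f a) a b :=
    (LipschitzWith.const (f a)).lipschitzOnWith.absolutelyContinuousOnInterval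
  refine absolutelyContinuousOnInterval_congr (h2.add h1) fun x hx => ?_
  have := (h a ha x (hs.uIcc_subset ha hb hx)).2
  simp only [Pi.add_apply]
  linarith

lemma ae_hasDerivAt (h : Prim s f g) [hs : OrdConnected s] (ha : a ∈ s) (hb : b ∈ s) :
    ∀ᵐ x, x ∈ uIcc a b → HasDerivAt f (g x) x := by
  have h1 := (h a ha b hb).1.ae_hasDerivAt_integral
  -- The endpoints are discarded so that `f` agrees with its integral formula on a full
  -- neighbourhood of `x`.
  have h2 : ∀ᵐ x : ℝ, x ≠ a := by simp [ae_iff, measure_singleton]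
  have h3 : ∀ᵐ x : ℝ, x ≠ b := by simp [ae_iff, measure_singleton]
  filter_upwards [h1, h2, h3] with x hx hxa hxb hxab
  have h4 := (hx hxab a left_mem_uIcc).const_add (f a)
  refine h4.congr_of_eventuallyEq ?_
  have h5 : uIcc a b ∈ 𝓝 x := by
    have : x ∈ Ioo (min a b) (max a b) := by
      rcases le_total a b with hab | hab
      · simp only [uIcc_of_le hab, mem_Icc] at hxab
        simp only [min_eq_left hab, max_eq_right hab]
        exact ⟨lt_of_le_of_ne hxab.1 (Ne.symm hxa), lt_of_le_of_ne hxab.2 hxb⟩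
      · simp only [uIcc_of_ge hab, mem_Icc] at hxab
        simp only [min_eq_right hab, max_eq_left hab]
        exact ⟨lt_of_le_of_ne hxab.1 (Ne.symm hxb), lt_of_le_of_ne hxab.2 hxa⟩
    exact mem_of_superset (Ioo_mem_nhds this.1 this.2) Ioo_subset_Icc_self
  filter_upwards [h5] with y hy
  have := (h a ha y (hs.uIcc_subset ha hb hy)).2
  linarith

/-- Together with `absolutelyContinuous` and `ae_hasDerivAt`, this identifies `Prim` on intervals
with absolute continuity plus an almost everywhere derivative. The product and chain rules then
reduce to the classical pointwise ones. -/
lemma of_ae_hasDerivAt (hac : ∀ a ∈ s, ∀ b ∈ s, AbsolutelyContinuousOnInterval f a b)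
    (h : ∀ a ∈ s, ∀ b ∈ s, ∀ᵐ x, x ∈ uIcc a b → HasDerivAt f (g x) x) : Prim s f g :=
  fun a ha b hb => intervalIntegral_eq_sub_of_ae_hasDerivAt (hac a ha b hb) (h a ha b hb)

lemma mono {t : Set ℝ} (h : Prim s f g) (hts : t ⊆ s) : Prim t f g :=
  fun a ha b hb => h a (hts ha) b (hts hb)

lemma add (h₁ : Prim s f₁ g₁) (h₂ : Prim s f₂ g₂) :
    Prim s (fun x => f₁ x + f₂ x) (fun x => g₁ x + g₂ x) := fun a ha b hb =>
  ⟨(h₁ a ha b hb).1.add (h₂ a ha b hb).1, by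
    rw [intervalIntegral.integral_add (h₁ a ha b hb).1 (h₂ a ha b hb).1, (h₁ a ha b hb).2,
      (h₂ a ha b hb).2]; ring⟩

lemma const_mul (c : ℝ) (h₁ : Prim s f₁ g₁) :
    Prim s (fun x => c * f₁ x) (fun x => c * g₁ x) := fun a ha b hb =>
  ⟨(h₁ a ha b hb).1.const_mul c, by
    rw [intervalIntegral.integral_const_mul, (h₁ a ha b hb).2]; ring⟩

lemma const (s : Set ℝ) (c : ℝ) : Prim s (fun _ => c) (fun _ => 0) := fun a _ b _ => by
  simp

lemma mul [OrdConnected s] (h₁ : Prim s f₁ g₁) (h₂ : Prim s f₂ g₂) :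
    Prim s (fun x => f₁ x * f₂ x) (fun x => g₁ x * f₂ x + f₁ x * g₂ x) := by
  refine of_ae_hasDerivAt
    (fun a ha b hb => (h₁.absolutelyContinuous ha hb).fun_mul (h₂.absolutelyContinuous ha hb))
    fun a ha b hb => ?_
  filter_upwards [h₁.ae_hasDerivAt ha hb, h₂.ae_hasDerivAt ha hb] with x h3 h4 hx
  exact (h3 hx).mul (h4 hx)

/-- The image under `f` of a compact interval is a compact interval inside `J`, and `G` is Lipschitz
there. Thus powers and logarithms can be composed with densities that stay away from zero. -/
lemma comp [hs : OrdConnected s] {G G' : ℝ → ℝ} {J : Set ℝ}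
    (h : Prim s f g) (hG : ∀ y ∈ J, HasDerivAt G (G' y) y) (hG' : ContinuousOn G' J)
    (hf : MapsTo f s J) : Prim s (fun x => G (f x)) (fun x => G' (f x) * g x) := by
  refine of_ae_hasDerivAt (fun a ha b hb => ?_) fun a ha b hb => ?_
  · have hac := h.absolutelyContinuous ha hb
    have hcomp : IsCompact (f '' uIcc a b) := isCompact_uIcc.image_of_continuousOn hac.continuousOn
    have hsub : f '' uIcc a b ⊆ J := by
      rintro _ ⟨x, hx, rfl⟩
      exact hf (hs.uIcc_subset ha hb hx)
    have hconv : Convex ℝ (f '' uIcc a b) := by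
      have : IsPreconnected (f '' uIcc a b) := isPreconnected_uIcc.image _ hac.continuousOn
      exact this.ordConnected.convex
    obtain ⟨K, hK⟩ := hcomp.exists_bound_of_continuousOn (hG'.mono hsub)
    refine absolutelyContinuousOnInterval_comp (K := K.toNNReal) hac
      (hconv.lipschitzOnWith_of_nnnorm_hasDerivWithin_le
        (fun y hy => (hG y (hsub hy)).hasDerivWithinAt) fun y hy => ?_)
    have := hK y hy
    rw [← NNReal.coe_le_coe, coe_nnnorm]
    exact this.trans (Real.le_coe_toNNReal K)
  · filter_upwards [h.ae_hasDerivAt ha hb] with x h3 hx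
    exact (hG _ (hf (hs.uIcc_subset ha hb hx))).comp x (h3 hx)

lemma of_hasDerivAt (h : ∀ x ∈ s, HasDerivAt f (g x) x) [hs : OrdConnected s]
    (hg : ContinuousOn g s) : Prim s f g := fun a ha b hb => by
  have hsub := hs.uIcc_subset ha hb
  have hi : IntervalIntegrable g volume a b := (hg.mono hsub).intervalIntegrable
  exact ⟨hi, intervalIntegral.integral_eq_sub_of_hasDerivAt (fun x hx => h x (hsub hx)) hi⟩

lemma continuousOn [OrdConnected s] (hs : IsOpen s) (h : Prim s f g) : ContinuousOn f s := by
  intro x hx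
  obtain ⟨l, u, hlu, hsub⟩ := mem_nhds_iff_exists_Ioo_subset.1 (hs.mem_nhds hx)
  obtain ⟨l', hl'⟩ := exists_between hlu.1
  obtain ⟨u', hu'⟩ := exists_between hlu.2
  have hac := h.absolutelyContinuous (a := l') (b := u') (hsub ⟨hl'.1, hl'.2.trans hlu.2⟩)
    (hsub ⟨hlu.1.trans hu'.1, hu'.2⟩)
  have := hac.continuousOn
  rw [uIcc_of_le (hl'.2.trans hu'.1).le] at this
  exact (this.continuousAt (Icc_mem_nhds hl'.2 hu'.1)).continuousWithinAt

lemma continuous (h : Prim univ f g) : Continuous f :=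
  continuousOn_univ.1 (h.continuousOn isOpen_univ)

lemma locallyIntegrable (h : Prim univ f g) : LocallyIntegrable g volume := by
  intro x
  have := (h (x - 1) trivial (x + 1) trivial).1
  rw [intervalIntegrable_iff_integrableOn_Ioo_of_le (by linarith)] at this
  exact ⟨_, Ioo_mem_nhds (by linarith) (by linarith), this⟩

lemma congr_right (h : Prim s f g) (hg : g =ᵐ[volume] g₁) : Prim s f g₁ := fun a ha b hb =>
  ⟨(h a ha b hb).1.congr_ae (ae_restrict_of_ae hg), by
    rw [← (h a ha b hb).2]
    exact (intervalIntegral.integral_congr_ae (hg.mono fun x hx _ => hx)).symm⟩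

lemma congr_left (h : Prim s f g) (hf : EqOn f f₁ s) : Prim s f₁ g := fun a ha b hb =>
  ⟨(h a ha b hb).1, by rw [(h a ha b hb).2, hf ha, hf hb]⟩

lemma ae_eq_of_prim (h₁ : Prim univ f g) (h₂ : Prim univ f g₁) : g =ᵐ[volume] g₁ := by
  have key : ∀ n : ℕ, ∀ᵐ x, x ∈ uIcc (-(n : ℝ)) n → g x = g₁ x := fun n => by
    filter_upwards [h₁.ae_hasDerivAt (a := -(n : ℝ)) (b := n) trivial trivial,
      h₂.ae_hasDerivAt (a := -(n : ℝ)) (b := n) trivial trivial] with x h3 h4 hx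
    exact (h3 hx).unique (h4 hx)
  filter_upwards [ae_all_iff.2 key] with x hx
  obtain ⟨n, hn⟩ := exists_nat_ge |x|
  refine hx n ?_
  rw [uIcc_of_le (by linarith [abs_nonneg x])]
  exact abs_le.1 hn

lemma shift (h : Prim univ f g) (c : ℝ) : Prim univ (fun x => f (x + c)) (fun x => g (x + c)) :=
  fun a _ b _ => ⟨by
    have := (h (a + c) trivial (b + c) trivial).1.comp_add_right c
    simpa using this, by
    rw [intervalIntegral.integral_comp_add_right]
    exact (h (a + c) trivial (b + c) trivial).2⟩

end Prim

lemma Prim.of_locallyIntegrable {g : ℝ → ℝ} (hg : LocallyIntegrable g volume) (c : ℝ) :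
    Prim univ (fun x => c + ∫ y in (0 : ℝ)..x, g y) g := fun a _ b _ => by
  have h : ∀ a b : ℝ, IntervalIntegrable g volume a b := fun a b =>
    (hg.integrableOn_isCompact isCompact_uIcc).intervalIntegrable
  refine ⟨h a b, ?_⟩
  have := intervalIntegral.integral_interval_sub_left (h 0 b) (h 0 a)
  linarith

lemma Prim.integral_eq_zero_of_hasCompactSupport {f g : ℝ → ℝ} (h : Prim univ f g)
    (hf : HasCompactSupport f) (hg : HasCompactSupport g) : ∫ x, g x = 0 := by
  obtain ⟨R, hR⟩ := (hf.isCompact.union hg.isCompact).isBounded.subset_closedBall 0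
  have hz : ∀ x, R + 1 ≤ |x| → f x = 0 ∧ g x = 0 := fun x hx => by
    have hx' : x ∉ tsupport f ∪ tsupport g := fun hmem => by
      have := hR hmem
      rw [Metric.mem_closedBall, dist_zero_right, Real.norm_eq_abs] at this
      linarith
    simp only [mem_union, not_or] at hx'
    exact ⟨image_eq_zero_of_notMem_tsupport hx'.1, image_eq_zero_of_notMem_tsupport hx'.2⟩
  set S := |R| + 2
  have hS : R + 1 ≤ S := by have := le_abs_self R; simp only [S]; linarith
  have hS0 : 0 < S := by positivity
  have h1 : ∫ x in (-S)..S, g x = ∫ x, g x := by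
    refine intervalIntegral.integral_eq_integral_of_support_subset fun x hx => ?_
    by_contra hcon
    apply hx
    refine (hz x ?_).2
    by_contra! hlt
    have := abs_lt.1 (lt_of_lt_of_le hlt hS)
    exact hcon ⟨this.1, this.2.le⟩
  rw [← h1, (h (-S) trivial S trivial).2, (hz S (hS.trans (le_abs_self S))).1,
    (hz (-S) (by rw [abs_neg]; exact hS.trans (le_abs_self S))).1, sub_zero]

lemma Prim.integral_mul_deriv {f g φ : ℝ → ℝ} (h : Prim univ f g) (hφ : ContDiff ℝ ∞ φ)
    (hc : HasCompactSupport φ) : ∫ x, f x * deriv φ x = -∫ x, g x * φ x := by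
  have hφd : Continuous (deriv φ) := hφ.continuous_deriv (by norm_cast)
  have hp : Prim univ φ (deriv φ) := Prim.of_hasDerivAt
    (fun x _ => (hφ.differentiable (by norm_num) x).hasDerivAt)
    hφd.continuousOn
  have h2 := (h.mul hp).integral_eq_zero_of_hasCompactSupport hc.mul_left
    (hc.mul_left.add hc.deriv.mul_left)
  rw [integral_add] at h2
  · linarith
  · have := h.locallyIntegrable.integrable_smul_left_of_hasCompactSupport hφ.continuous hc
    simpa [mul_comm] using this
  · exact (h.continuous.mul hφd).integrable_of_hasCompactSupport hc.deriv.mul_left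

/-! ### A countable family of test functions -/

/-- Bumps around the origin of radius `1 / (n + 1)`. -/
def bump (n : ℕ) : ContDiffBump (0 : ℝ) where
  rIn := 1 / (2 * (n + 1))
  rOut := 1 / (n + 1)
  rIn_pos := by positivity
  rIn_lt_rOut := by
    rw [div_lt_div_iff_of_pos_left one_pos (by positivity) (by positivity)]
    linarith [(n.cast_nonneg : (0 : ℝ) ≤ n)]

/-- The mollifier of radius `1 / (n + 1)`. -/
def mollifier (n : ℕ) : ℝ → ℝ := (bump n).normed volume

/-- The primitive of `mollifier n` that vanishes near `-∞`. -/
def step (n : ℕ) (x : ℝ) : ℝ := ∫ y in (-2 : ℝ)..x, mollifier n y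

/-- A smooth approximation of the signed indicator function of the interval between `p`
and `q`. -/
def plateau (n : ℕ) (p q x : ℝ) : ℝ := step n (x - p) - step n (x - q)

lemma mollifier_contDiff (n : ℕ) : ContDiff ℝ ∞ (mollifier n) := (bump n).contDiff_normed

lemma step_hasDerivAt (n : ℕ) (x : ℝ) : HasDerivAt (step n) (mollifier n x) x :=
  intervalIntegral.integral_hasDerivAt_right
    ((mollifier_contDiff n).continuous.intervalIntegrable _ _)
    ((mollifier_contDiff n).continuous.stronglyMeasurableAtFilter _ _)
    (mollifier_contDiff n).continuous.continuousAt

lemma step_contDiff (n : ℕ) : ContDiff ℝ ∞ (step n) := by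
  rw [contDiff_infty_iff_deriv]
  refine ⟨fun x => (step_hasDerivAt n x).differentiableAt, ?_⟩
  have : deriv (step n) = mollifier n := funext fun x => (step_hasDerivAt n x).deriv
  rw [this]
  exact mollifier_contDiff n

lemma mollifier_eq_zero (n : ℕ) {x : ℝ} (hx : 1 / ((n : ℝ) + 1) ≤ |x|) : mollifier n x = 0 := by
  have : x ∉ Function.support (mollifier n) := by
    rw [mollifier, ContDiffBump.support_normed_eq, Metric.mem_ball, dist_zero_right,
      Real.norm_eq_abs, not_lt]
    exact hx
  simpa using this

lemma radius_le_one (n : ℕ) : 1 / ((n : ℝ) + 1) ≤ 1 := by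
  rw [div_le_one (by positivity)]; linarith [(n.cast_nonneg : (0 : ℝ) ≤ n)]

lemma step_eq_zero (n : ℕ) {x : ℝ} (hx : x ≤ -(1 / ((n : ℝ) + 1))) : step n x = 0 := by
  have h1 := radius_le_one n
  have h0 : 0 < 1 / ((n : ℝ) + 1) := by positivity
  rw [step, intervalIntegral.integral_congr (g := fun _ => (0 : ℝ))]
  · simp
  · intro y hy
    have : y ≤ -(1 / ((n : ℝ) + 1)) := by
      rcases le_total (-2) x with h | h
      · rw [uIcc_of_le h] at hy; exact hy.2.trans hx
      · rw [uIcc_of_ge h] at hy; linarith [hy.2]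
    refine mollifier_eq_zero n ?_
    rw [abs_of_nonpos (by linarith)]
    linarith

lemma step_eq_one (n : ℕ) {x : ℝ} (hx : 1 / ((n : ℝ) + 1) ≤ x) : step n x = 1 := by
  have h1 := radius_le_one n
  have h0 : 0 < 1 / ((n : ℝ) + 1) := by positivity
  rw [step, intervalIntegral.integral_eq_integral_of_support_subset]
  · exact (bump n).integral_normed
  · intro y hy
    have hy' : |y| < 1 / ((n : ℝ) + 1) := by
      by_contra! h
      exact hy (mollifier_eq_zero n h)
    rw [abs_lt] at hy'
    exact ⟨by linarith [hy'.1], by linarith [hy'.2]⟩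

lemma plateau_contDiff (n : ℕ) (p q : ℝ) : ContDiff ℝ ∞ (plateau n p q) :=
  ((step_contDiff n).comp (contDiff_id.sub contDiff_const)).sub
    ((step_contDiff n).comp (contDiff_id.sub contDiff_const))

lemma plateau_deriv (n : ℕ) (p q x : ℝ) :
    deriv (plateau n p q) x = mollifier n (x - p) - mollifier n (x - q) := by
  have h : ∀ c : ℝ, HasDerivAt (fun x => step n (x - c)) (mollifier n (x - c)) x := fun c =>
    (step_hasDerivAt n (x - c)).comp_sub_const x c
  exact ((h p).sub (h q)).deriv

lemma plateau_tsupport (n : ℕ) (p q : ℝ) :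
    tsupport (plateau n p q) ⊆
      Icc (min p q - 1 / ((n : ℝ) + 1)) (max p q + 1 / ((n : ℝ) + 1)) := by
  refine closure_minimal (fun x hx => ?_) isClosed_Icc
  by_contra hcon
  apply hx
  rw [mem_Icc, not_and_or, not_le, not_le] at hcon
  rcases hcon with h | h
  · rw [plateau, step_eq_zero n (by linarith [min_le_left p q]),
      step_eq_zero n (by linarith [min_le_right p q]), sub_zero]
  · rw [plateau, step_eq_one n (by linarith [le_max_left p q]),
      step_eq_one n (by linarith [le_max_right p q]), sub_self]

lemma plateau_hasCompactSupport (n : ℕ) (p q : ℝ) : HasCompactSupport (plateau n p q) :=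
  isCompact_Icc.of_isClosed_subset (isClosed_tsupport _) (plateau_tsupport n p q)

open scoped Convolution in
/-- The lemma of du Bois-Reymond on an open interval, for a countable family of test functions. -/
lemma ae_eq_primitive_of_integral_plateau {f g : ℝ → ℝ} {I : Set ℝ} (hI : IsOpen I)
    [hIc : OrdConnected I] (hf : LocallyIntegrable f volume) (hg : LocallyIntegrable g volume)
    (h : ∀ (n : ℕ) (p q : ℚ), tsupport (plateau n p q) ⊆ I →
      ∫ x, f x * deriv (plateau n p q) x = -∫ x, g x * plateau n p q x) :
    ∃ c, ∀ᵐ x, x ∈ I → f x = c + ∫ y in (0 : ℝ)..x, g y := by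
  set G : ℝ → ℝ := fun x => ∫ y in (0 : ℝ)..x, g y with hGdef
  have hG : Prim univ G g := by simpa using Prim.of_locallyIntegrable hg 0
  set k : ℝ → ℝ := fun x => f x - G x with hkdef
  have hk : LocallyIntegrable k volume := hf.sub hG.continuous.locallyIntegrable
  -- The mollifications of `k = f - G`, which is to be shown constant on `I`.
  set M : ℕ → ℝ → ℝ := fun n => mollifier n ⋆[ContinuousLinearMap.lsmul ℝ ℝ, volume] k with hMdef
  have hmolc : ∀ n, HasCompactSupport (mollifier n) := fun n => (bump n).hasCompactSupport_normed
  have hMc : ∀ n, Continuous (M n) := fun n =>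
    (hmolc n).continuous_convolution_left _ (mollifier_contDiff n).continuous hk
  have hMe : ∀ n x, M n x = ∫ y, k y * mollifier n (y - x) := fun n x => by
    rw [hMdef]
    simp only [convolution_eq_swap, ContinuousLinearMap.lsmul_apply, smul_eq_mul]
    refine integral_congr_ae (.of_forall fun y => ?_)
    simp only
    rw [mul_comm, ← neg_sub y x, mollifier, ContDiffBump.normed_neg]
  have hInt : ∀ n (x : ℝ), Integrable (fun y => k y * mollifier n (y - x)) := fun n x => by
    have h1 : HasCompactSupport fun y => mollifier n (y - x) := by
      have := (hmolc n).comp_homeomorph (Homeomorph.subRight x)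
      exact this
    have := hk.integrable_smul_left_of_hasCompactSupport
      ((mollifier_contDiff n).continuous.comp (continuous_id.sub continuous_const)) h1
    simpa [mul_comm] using this
  -- The derivative of a plateau is a difference of two translated mollifiers, so testing `k`
  -- against it compares the mollifications at the rational points `p` and `q`.
  have hMpq : ∀ n (p q : ℚ), tsupport (plateau n p q) ⊆ I → M n p = M n q := fun n p q hpq => by
    have h1 := h n p q hpq
    have h2 := hG.integral_mul_deriv (plateau_contDiff n p q) (plateau_hasCompactSupport n p q)
    have hdc : Continuous (deriv (plateau n (p : ℝ) q)) :=
      (plateau_contDiff n p q).continuous_deriv (by norm_cast)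
    have h3 : ∫ x, k x * deriv (plateau n p q) x = 0 := by
      simp only [hkdef, sub_mul]
      rw [integral_sub, h1, h2, sub_self]
      · have := hf.integrable_smul_left_of_hasCompactSupport hdc
          (plateau_hasCompactSupport n p q).deriv
        simpa [mul_comm] using this
      · exact (hG.continuous.mul hdc).integrable_of_hasCompactSupport
          (plateau_hasCompactSupport n p q).deriv.mul_left
    simp only [plateau_deriv, mul_sub] at h3
    rw [integral_sub (hInt n p) (hInt n q), ← hMe, ← hMe] at h3
    linarith
  have hlim : ∀ᵐ x, Tendsto (fun n => M n x) atTop (𝓝 (k x)) := by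
    refine ContDiffBump.ae_convolution_tendsto_right_of_locallyIntegrable (φ := bump) (K := 2)
      tendsto_one_div_add_atTop_nhds_zero_nat (.of_forall fun n => ?_) hk
    simp only [bump]
    apply le_of_eq
    field_simp
  rcases I.eq_empty_or_nonempty with rfl | hne
  · exact ⟨0, by simp⟩
  -- A nonempty open set has positive measure, hence contains a point where the mollifications
  -- converge; the value there is the constant.
  obtain ⟨x₀, hx₀I, hx₀⟩ : ∃ x₀ ∈ I, Tendsto (fun n => M n x₀) atTop (𝓝 (k x₀)) := by
    by_contra! hcon
    have h0 : volume I = 0 := by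
      refine measure_mono_null (fun x hx => ?_) (ae_iff.1 hlim)
      exact hcon x hx
    exact (hI.measure_pos volume hne).ne' h0
  refine ⟨k x₀, ?_⟩
  filter_upwards [hlim] with x hx hxI
  suffices hs : k x = k x₀ by simp only [hkdef] at hs ⊢; linarith
  obtain ⟨δ, hδ, hδx⟩ := Metric.isOpen_iff.1 hI x hxI
  obtain ⟨δ', hδ', hδx'⟩ := Metric.isOpen_iff.1 hI x₀ hx₀I
  -- A mollification radius below half the distance to the complement keeps the plateau with
  -- endpoints near `x` and `x₀` supported in `I`.
  have hev : ∀ᶠ n : ℕ in atTop, 1 / ((n : ℝ) + 1) < min δ δ' / 2 :=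
    (tendsto_one_div_add_atTop_nhds_zero_nat (𝕜 := ℝ)).eventually_lt_const
      (half_pos (lt_min hδ hδ'))
  refine tendsto_nhds_unique (hx.congr' ?_) hx₀
  filter_upwards [hev] with n hn
  set r := 1 / ((n : ℝ) + 1) with hr
  have hmem : ∀ (z e : ℝ), Metric.ball z e ⊆ I → r < e / 2 → ∀ p ∈ Metric.ball z (e / 2),
      p - r ∈ I ∧ p + r ∈ I := by
    intro z e hz hre p hp
    have hr0 : 0 < r := by positivity
    rw [Real.ball_eq_Ioo] at hz hp
    exact ⟨hz ⟨by linarith [hp.1], by linarith [hp.2]⟩,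
      hz ⟨by linarith [hp.1], by linarith [hp.2]⟩⟩
  have hn1 : r < δ / 2 := lt_of_lt_of_le hn (by gcongr; exact min_le_left _ _)
  have hn2 : r < δ' / 2 := lt_of_lt_of_le hn (by gcongr; exact min_le_right _ _)
  have hpq : ∀ p q : ℚ, (p : ℝ) ∈ Metric.ball x (δ / 2) → (q : ℝ) ∈ Metric.ball x₀ (δ' / 2) →
      M n p = M n q := fun p q hp hq => by
    refine hMpq n p q ((plateau_tsupport n p q).trans (hIc.out ?_ ?_))
    · rcases min_choice (p : ℝ) q with h' | h' <;> rw [h']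
      · exact (hmem x δ hδx hn1 p hp).1
      · exact (hmem x₀ δ' hδx' hn2 q hq).1
    · rcases max_choice (p : ℝ) q with h' | h' <;> rw [h']
      · exact (hmem x δ hδx hn1 p hp).2
      · exact (hmem x₀ δ' hδx' hn2 q hq).2
  -- Continuity of `M n` passes from rational to real points.
  have hdense : ∀ (z e : ℝ), 0 < e → ∀ c : ℝ,
      (∀ p : ℚ, (p : ℝ) ∈ Metric.ball z e → M n p = c) → M n z = c := by
    intro z e he c hc
    by_contra hne
    have hopen : IsOpen (Metric.ball z e ∩ {y | M n y ≠ c}) :=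
      Metric.isOpen_ball.inter (isOpen_ne_fun (hMc n) continuous_const)
    obtain ⟨_, ⟨hy1, hy2⟩, p, rfl⟩ := Dense.inter_open_nonempty Rat.denseRange_cast _ hopen
      ⟨z, Metric.mem_ball_self he, hne⟩
    exact hy2 (hc p hy1)
  refine hdense x (δ / 2) (half_pos hδ) _ fun p hp => ?_
  exact (hdense x₀ (δ' / 2) (half_pos hδ') _ fun q hq => (hpq p q hp hq).symm).symm

/-! ### Weak derivatives and absolute continuity on lines -/

/-- `F` is integrable on bounded boxes. -/
def LocInt (F : ℝ × ℝ → ℝ) : Prop :=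
  ∀ R : ℝ, IntegrableOn F (Icc (-R) R ×ˢ Icc (-R) R) volume

lemma LocInt.swap {F : ℝ × ℝ → ℝ} (h : LocInt F) : LocInt (fun z => F (z.2, z.1)) := fun R => by
  have h1 := h R
  rw [IntegrableOn, Measure.volume_eq_prod, ← Measure.prod_restrict] at h1 ⊢
  exact h1.swap

lemma LocInt.locallyIntegrable {F : ℝ × ℝ → ℝ} (h : LocInt F) : LocallyIntegrable F volume := by
  intro z
  refine ⟨_, ?_, h (|z.1| + |z.2| + 1)⟩
  have h1 := abs_nonneg z.1
  have h2 := abs_nonneg z.2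
  refine prod_mem_nhds (Icc_mem_nhds ?_ ?_) (Icc_mem_nhds ?_ ?_)
  · linarith [neg_abs_le z.1]
  · linarith [le_abs_self z.1]
  · linarith [neg_abs_le z.2]
  · linarith [le_abs_self z.2]

lemma LocInt.slice {F : ℝ × ℝ → ℝ} (h : LocInt F) :
    ∀ᵐ t, LocallyIntegrable (fun x => F (t, x)) volume := by
  have key : ∀ n : ℕ, ∀ᵐ t, t ∈ Icc (-(n : ℝ)) n →
      IntegrableOn (fun x => F (t, x)) (Icc (-(n : ℝ)) n) volume := fun n => by
    have h1 := h n
    rw [IntegrableOn, Measure.volume_eq_prod, ← Measure.prod_restrict] at h1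
    exact (ae_restrict_iff' measurableSet_Icc).1 h1.prod_right_ae
  filter_upwards [ae_all_iff.2 key] with t ht x
  obtain ⟨n, hn⟩ := exists_nat_ge (|t| + |x| + 1)
  have h1 := abs_nonneg t
  have h2 := abs_nonneg x
  refine ⟨_, Icc_mem_nhds ?_ ?_, ht n ⟨?_, ?_⟩⟩
  · linarith [neg_abs_le x]
  · linarith [le_abs_self x]
  · linarith [neg_abs_le t]
  · linarith [le_abs_self t]

lemma hasCompactSupport_tensor {a b : ℝ → ℝ} (ha : HasCompactSupport a)
    (hb : HasCompactSupport b) : HasCompactSupport fun z : ℝ × ℝ => a z.1 * b z.2 := by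
  refine HasCompactSupport.intro (ha.isCompact.prod hb.isCompact) fun z hz => ?_
  rw [mem_prod, not_and_or] at hz
  rcases hz with h | h
  · rw [image_eq_zero_of_notMem_tsupport h, zero_mul]
  · rw [image_eq_zero_of_notMem_tsupport h, mul_zero]

lemma tsupport_tensor_subset (a b : ℝ → ℝ) :
    (tsupport fun z : ℝ × ℝ => a z.1 * b z.2) ⊆ tsupport a ×ˢ tsupport b := by
  refine closure_minimal (fun z hz => ?_) ((isClosed_tsupport a).prod (isClosed_tsupport b))
  rw [Function.mem_support] at hz
  exact ⟨subset_tsupport _ (left_ne_zero_of_mul hz), subset_tsupport _ (right_ne_zero_of_mul hz)⟩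

lemma LocInt.integrable_mul_tensor {F : ℝ × ℝ → ℝ} (h : LocInt F) {a b : ℝ → ℝ}
    (ha : HasCompactSupport a) (hb : HasCompactSupport b) (hac : Continuous a)
    (hbc : Continuous b) : Integrable (fun z : ℝ × ℝ => F z * (a z.1 * b z.2)) := by
  have := h.locallyIntegrable.integrable_smul_left_of_hasCompactSupport
    (g := fun z : ℝ × ℝ => a z.1 * b z.2) (by fun_prop) (hasCompactSupport_tensor ha hb)
  simpa [mul_comm] using this

lemma LocInt.locallyIntegrable_integral {F : ℝ × ℝ → ℝ} (h : LocInt F) {b : ℝ → ℝ}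
    (hb : HasCompactSupport b) (hbc : Continuous b) :
    LocallyIntegrable (fun t => ∫ x, F (t, x) * b x) volume := by
  intro t₀
  -- A cutoff equal to `1` near `t₀` turns local integrability into integrability on the plane,
  -- where Fubini applies.
  let c : ContDiffBump t₀ := ⟨1, 2, one_pos, one_lt_two⟩
  have h1 := h.integrable_mul_tensor c.hasCompactSupport hb c.continuous hbc
  have h2 := h1.integral_prod_left
  refine ⟨Metric.closedBall t₀ 1, Metric.closedBall_mem_nhds t₀ one_pos, ?_⟩
  refine (h2.integrableOn (s := Metric.closedBall t₀ 1)).congr_fun (fun t ht => ?_)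
    measurableSet_closedBall
  simp only
  rw [c.one_of_mem_closedBall ht]
  simp

/-- For a fixed test function in `x`, Fubini and the fundamental lemma in `t` give the weak identity
on almost every slice, with a null set depending on that function. The plateaus form a countable
family, so one null set serves them all, and they suffice for du Bois-Reymond on the slice. -/
lemma ae_slice_eq_primitive {F G : ℝ × ℝ → ℝ} {I J : Set ℝ} (hI : IsOpen I) (hJ : IsOpen J)
    [OrdConnected J] (hF : LocInt F) (hG : LocInt G)
    (h : ∀ a b : ℝ → ℝ, ContDiff ℝ ∞ a → ContDiff ℝ ∞ b → HasCompactSupport a →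
      HasCompactSupport b → tsupport a ⊆ I → tsupport b ⊆ J →
      ∫ z : ℝ × ℝ, F z * (a z.1 * deriv b z.2) = -∫ z : ℝ × ℝ, G z * (a z.1 * b z.2)) :
    ∀ᵐ t, t ∈ I → LocallyIntegrable (fun x => G (t, x)) volume ∧
      ∃ c, ∀ᵐ x, x ∈ J → F (t, x) = c + ∫ y in (0 : ℝ)..x, G (t, y) := by
  have key : ∀ (n : ℕ) (p q : ℚ), ∀ᵐ t, t ∈ I → tsupport (plateau n p q) ⊆ J →
      ∫ x, F (t, x) * deriv (plateau n p q) x = -∫ x, G (t, x) * plateau n p q x := by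
    intro n p q
    by_cases hpq : tsupport (plateau n p q) ⊆ J
    swap
    · exact .of_forall fun t _ h' => (hpq h').elim
    have hbs := plateau_contDiff n p q
    have hbc := plateau_hasCompactSupport n p q
    have hbd : Continuous (deriv (plateau n (p : ℝ) q)) := hbs.continuous_deriv (by norm_cast)
    have hl1 := hF.locallyIntegrable_integral hbc.deriv hbd
    have hl2 := hG.locallyIntegrable_integral hbc hbs.continuous
    have := hI.ae_eq_zero_of_integral_contDiff_smul_eq_zero (μ := volume)
      ((hl1.add hl2).locallyIntegrableOn I) fun a ha hac haI => by
        have h0 := h a _ ha hbs hac hbc haI hpq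
        have hi1 := hF.integrable_mul_tensor hac hbc.deriv ha.continuous hbd
        have hi2 := hG.integrable_mul_tensor hac hbc ha.continuous hbs.continuous
        rw [Measure.volume_eq_prod] at h0 hi1 hi2
        rw [integral_prod _ hi1, integral_prod _ hi2] at h0
        have e : ∀ (F : ℝ × ℝ → ℝ) (b : ℝ → ℝ) (t : ℝ), ∫ x, F (t, x) * (a t * b x) =
            a t * ∫ x, F (t, x) * b x := fun F b t => by
          rw [← integral_const_mul]
          exact integral_congr_ae (.of_forall fun x => by ring)
        have hj1 := hi1.integral_prod_left
        have hj2 := hi2.integral_prod_left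
        simp only [e] at h0 hj1 hj2
        simp only [Pi.add_apply, smul_eq_mul, mul_add]
        rw [integral_add hj1 hj2, h0]
        ring
    filter_upwards [this] with t ht htI _
    have := ht htI
    simp only [Pi.add_apply] at this
    linarith
  filter_upwards [ae_all_iff.2 fun n => ae_all_iff.2 fun p => ae_all_iff.2 fun q => key n p q,
    hF.slice, hG.slice] with t ht hFt hGt htI
  exact ⟨hGt, ae_eq_primitive_of_integral_plateau hJ hFt hGt fun n p q hpq => ht n p q htI hpq⟩

/-- `f` is integrable on `(0, T) × [-R, R]` for all `R`. -/
def LocL1 (T : ℝ) (f : ℝ → ℝ → ℝ) : Prop :=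
  ∀ R : ℝ, IntegrableOn (fun z : ℝ × ℝ => f z.1 z.2) (Ioo 0 T ×ˢ Icc (-R) R) volume

lemma measurableSet_strip (T : ℝ) : MeasurableSet (strip T) := measurableSet_Ioo.prod .univ

lemma LocL1.locInt {T : ℝ} {f : ℝ → ℝ → ℝ} (h : LocL1 T f) :
    LocInt ((strip T).indicator fun z => f z.1 z.2) := fun R => by
  rw [IntegrableOn, integrable_indicator_iff (measurableSet_strip T), IntegrableOn,
    Measure.restrict_restrict (measurableSet_strip T)]
  refine (h R).mono_set fun z hz => ?_
  exact ⟨hz.1.1, hz.2.2⟩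

lemma dx_tensor {a b : ℝ → ℝ} (ha : ContDiff ℝ ∞ a) (hb : ContDiff ℝ ∞ b) (z : ℝ × ℝ) :
    dx (fun z => a z.1 * b z.2) z = a z.1 * deriv b z.2 := by
  have h1 : HasFDerivAt (fun z : ℝ × ℝ => a z.1) _ z :=
    (ha.differentiable (by norm_num) z.1).hasDerivAt.comp_hasFDerivAt z
      (hasFDerivAt_fst (𝕜 := ℝ) (E := ℝ) (F := ℝ) (p := z))
  have h2 : HasFDerivAt (fun z : ℝ × ℝ => b z.2) _ z :=
    (hb.differentiable (by norm_num) z.2).hasDerivAt.comp_hasFDerivAt z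
      (hasFDerivAt_snd (𝕜 := ℝ) (E := ℝ) (F := ℝ) (p := z))
  rw [dx, (h1.fun_mul h2).fderiv]
  simp

lemma dt_tensor {a b : ℝ → ℝ} (ha : ContDiff ℝ ∞ a) (hb : ContDiff ℝ ∞ b) (z : ℝ × ℝ) :
    dt (fun z => a z.1 * b z.2) z = deriv a z.1 * b z.2 := by
  have h1 : HasFDerivAt (fun z : ℝ × ℝ => a z.1) _ z :=
    (ha.differentiable (by norm_num) z.1).hasDerivAt.comp_hasFDerivAt z
      (hasFDerivAt_fst (𝕜 := ℝ) (E := ℝ) (F := ℝ) (p := z))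
  have h2 : HasFDerivAt (fun z : ℝ × ℝ => b z.2) _ z :=
    (hb.differentiable (by norm_num) z.2).hasDerivAt.comp_hasFDerivAt z
      (hasFDerivAt_snd (𝕜 := ℝ) (E := ℝ) (F := ℝ) (p := z))
  rw [dt, (h1.fun_mul h2).fderiv]
  simp [mul_comm]

lemma isTest_tensor {T : ℝ} {a b : ℝ → ℝ} (ha : ContDiff ℝ ∞ a) (hb : ContDiff ℝ ∞ b)
    (hac : HasCompactSupport a) (hbc : HasCompactSupport b) (h : tsupport a ⊆ Ioo 0 T) :
    IsTest T (fun z => a z.1 * b z.2) where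
  smooth := (ha.comp contDiff_fst).mul (hb.comp contDiff_snd)
  compact := hasCompactSupport_tensor hac hbc
  support := fun _ hz => ⟨h (tsupport_tensor_subset a b hz).1, trivial⟩

lemma setIntegral_strip_eq {T : ℝ} (F k : ℝ × ℝ → ℝ) :
    ∫ z in strip T, F z * k z = ∫ z, (strip T).indicator F z * k z := by
  rw [← integral_indicator (measurableSet_strip T)]
  exact integral_congr_ae (.of_forall fun z => by simp [indicator_mul_left])

lemma HasWeakDx.ae_prim {T : ℝ} {f g : ℝ → ℝ → ℝ} (h : HasWeakDx T f g) (hf : LocL1 T f)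
    (hg : LocL1 T g) : ∀ᵐ t, t ∈ Ioo 0 T → ∃ w, f t =ᵐ[volume] w ∧ Prim univ w (g t) := by
  have := ae_slice_eq_primitive (I := Ioo 0 T) (J := univ) isOpen_Ioo isOpen_univ hf.locInt
    hg.locInt fun a b ha hb hac hbc haI _ => by
      have := h.2.2 _ (isTest_tensor ha hb hac hbc haI)
      simp only [dx_tensor ha hb] at this
      rwa [setIntegral_strip_eq, setIntegral_strip_eq] at this
  filter_upwards [this] with t ht htI
  obtain ⟨h1, c, h2⟩ := ht htI
  have e : ∀ (f : ℝ → ℝ → ℝ) (x : ℝ),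
      (strip T).indicator (fun z : ℝ × ℝ => f z.1 z.2) (t, x) = f t x := fun f x =>
    indicator_of_mem (show (t, x) ∈ strip T from ⟨htI, trivial⟩) _
  simp only [e] at h1 h2
  exact ⟨_, by filter_upwards [h2] with x hx using hx trivial, Prim.of_locallyIntegrable h1 c⟩

/-- The two variables are exchanged before slicing. Continuity of `f` up to `t = 0` and `t = T`
extends the primitive from the open to the closed interval, which makes the initial data accessible
to the balance laws. -/
lemma HasWeakDt.ae_prim {T : ℝ} {f g : ℝ → ℝ → ℝ} (hT : 0 < T) (h : HasWeakDt T f g)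
    (hfc : ContinuousOn (fun z : ℝ × ℝ => f z.1 z.2) (Icc 0 T ×ˢ univ)) (hf : LocL1 T f)
    (hg : LocL1 T g) : ∀ᵐ x, Prim (Icc 0 T) (fun t => f t x) (fun t => g t x) := by
  have := ae_slice_eq_primitive (I := univ) (J := Ioo 0 T) isOpen_univ isOpen_Ioo hf.locInt.swap
    hg.locInt.swap fun b a hb ha hbc hac _ haI => by
      have := h.2.2 _ (isTest_tensor ha hb hac hbc haI)
      simp only [dt_tensor ha hb] at this
      rw [setIntegral_strip_eq, setIntegral_strip_eq] at this
      simp only [Measure.volume_eq_prod] at this ⊢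
      rw [← integral_prod_swap (fun z : ℝ × ℝ => (strip T).indicator (fun z => f z.1 z.2) z *
          (deriv a z.1 * b z.2)), ← integral_prod_swap (fun z : ℝ × ℝ =>
          (strip T).indicator (fun z => g z.1 z.2) z * (a z.1 * b z.2))] at this
      simpa only [Prod.fst_swap, Prod.snd_swap, Prod.swap, mul_comm (b _)] using this
  filter_upwards [this] with x hx
  obtain ⟨h1, c, h2⟩ := hx trivial
  have e : ∀ (f : ℝ → ℝ → ℝ) (t : ℝ), t ∈ Ioo 0 T →
      (strip T).indicator (fun z : ℝ × ℝ => f z.1 z.2) (t, x) = f t x := fun f t ht =>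
    indicator_of_mem (show (t, x) ∈ strip T from ⟨ht, trivial⟩) _
  set G : ℝ → ℝ := fun t => (strip T).indicator (fun z : ℝ × ℝ => g z.1 z.2) (t, x) with hG
  have hGp := Prim.of_locallyIntegrable h1 c
  have hcont : ContinuousOn (fun t => f t x) (Icc 0 T) :=
    hfc.comp (f := fun t : ℝ => (t, x)) (by fun_prop) fun t ht => ⟨ht, trivial⟩
  have heq : EqOn (fun t => c + ∫ s in (0 : ℝ)..t, G s) (fun t => f t x) (Icc 0 T) := by
    have h3 : EqOn (fun t => c + ∫ s in (0 : ℝ)..t, G s) (fun t => f t x) (Ioo 0 T) := by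
      refine Measure.eqOn_open_of_ae_eq (μ := volume) ?_ isOpen_Ioo hGp.continuous.continuousOn
        (hcont.mono Ioo_subset_Icc_self)
      rw [EventuallyEq, ae_restrict_iff' measurableSet_Ioo]
      filter_upwards [h2] with t ht ht'
      rw [← ht ht', e f t ht']
    have := h3.of_subset_closure (t := Icc 0 T) hGp.continuous.continuousOn hcont
      Ioo_subset_Icc_self (by rw [closure_Ioo hT.ne])
    exact this
  have hp := (hGp.mono (subset_univ (Icc 0 T))).congr_left heq
  have hgG : ∀ a ∈ Icc 0 T, ∀ b ∈ Icc 0 T, ∀ᵐ s, s ∈ uIoc a b → G s = g s x := by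
    intro a ha b hb
    have hne : ∀ᵐ s : ℝ, s ≠ T := by simp [ae_iff, measure_singleton]
    filter_upwards [hne] with s hs hsab
    refine e g s ⟨lt_of_le_of_lt (le_min ha.1 hb.1) hsab.1,
      lt_of_le_of_ne (hsab.2.trans (max_le ha.2 hb.2)) hs⟩
  intro a ha b hb
  refine ⟨(hp a ha b hb).1.congr_ae ?_, ?_⟩
  · rw [EventuallyEq, ae_restrict_iff' measurableSet_uIoc]
    exact hgG a ha b hb
  · rw [← (hp a ha b hb).2]
    exact (intervalIntegral.integral_congr_ae (hgG a ha b hb)).symm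

/-- This reconciles the derivatives of `u` supplied separately by the regularity clauses and by the
momentum equation. -/
lemma HasWeakDx.ae_unique {T : ℝ} {f g₁ g₂ : ℝ → ℝ → ℝ} (h₁ : HasWeakDx T f g₁)
    (h₂ : HasWeakDx T f g₂) : ∀ᵐ z : ℝ × ℝ, z ∈ strip T → g₁ z.1 z.2 = g₂ z.1 z.2 := by
  have hop : IsOpen (strip T) := isOpen_Ioo.prod isOpen_univ
  have := hop.ae_eq_zero_of_integral_contDiff_smul_eq_zero (μ := volume) (h₁.2.1.sub h₂.2.1)
    fun ψ hψ hc hs => by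
      have e1 := h₁.2.2 ψ ⟨hψ, hc, hs⟩
      have e2 := h₂.2.2 ψ ⟨hψ, hc, hs⟩
      have hz : ∀ z, z ∉ strip T → ψ z = 0 := fun z hz =>
        image_eq_zero_of_notMem_tsupport fun h => hz (hs h)
      have hi : ∀ g : ℝ → ℝ → ℝ, LocallyIntegrableOn (fun z : ℝ × ℝ => g z.1 z.2) (strip T) volume →
          IntegrableOn (fun z : ℝ × ℝ => g z.1 z.2 * ψ z) (strip T) := fun g hg => by
        have h3 : IntegrableOn (fun z : ℝ × ℝ => g z.1 z.2 * ψ z) (tsupport ψ) :=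
          (hg.integrableOn_compact_subset hs hc).mul_continuousOn hψ.continuous.continuousOn hc
        have h4 : Integrable (fun z : ℝ × ℝ => g z.1 z.2 * ψ z) :=
          (integrableOn_iff_integrable_of_support_subset fun z hz' => by
            rw [Function.mem_support] at hz'
            exact subset_tsupport _ (right_ne_zero_of_mul hz')).1 h3
        exact h4.integrableOn
      have e3 : ∫ z in strip T, (g₁ z.1 z.2 * ψ z - g₂ z.1 z.2 * ψ z) = 0 := by
        rw [integral_sub (hi _ h₁.2.1) (hi _ h₂.2.1)]
        linarith
      rw [setIntegral_eq_integral_of_forall_compl_eq_zero fun z hz' => by rw [hz z hz']; ring] at e3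
      rw [← e3]
      refine integral_congr_ae (.of_forall fun z => ?_)
      simp only [Pi.sub_apply, smul_eq_mul]
      ring
  filter_upwards [this] with z hz hzT
  have := hz hzT
  simp only [Pi.sub_apply] at this
  linarith

lemma HasWeakDeriv.exists_prim {f g : ℝ → ℝ} (h : HasWeakDeriv f g) :
    ∃ w, f =ᵐ[volume] w ∧ Prim univ w g := by
  obtain ⟨c, hc⟩ := ae_eq_primitive_of_integral_plateau isOpen_univ h.1 h.2.1 fun n p q _ =>
    h.2.2 _ (plateau_contDiff n p q) (plateau_hasCompactSupport n p q)
  exact ⟨_, by filter_upwards [hc] with x hx using hx trivial, Prim.of_locallyIntegrable h.2.1 c⟩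

/-! ### Bounded functions with locally square integrable derivatives -/

/-- `f` is square integrable on `(0, T) × [-R, R]` for all `R`. -/
def LocL2 (T : ℝ) (f : ℝ → ℝ → ℝ) : Prop :=
  ∀ R : ℝ, MemLp (fun z : ℝ × ℝ => f z.1 z.2) 2 (volume.restrict (Ioo 0 T ×ˢ Icc (-R) R))

lemma restrict_strip (T : ℝ) : (volume : Measure (ℝ × ℝ)).restrict (strip T) =
    ((volume : Measure ℝ).restrict (Ioo 0 T)).prod volume := by
  rw [strip, Measure.volume_eq_prod, ← Measure.prod_restrict, Measure.restrict_univ]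

lemma restrict_box (T R : ℝ) :
    (volume : Measure (ℝ × ℝ)).restrict (Ioo 0 T ×ˢ Icc (-R) R) =
    ((volume : Measure ℝ).restrict (Ioo 0 T)).prod (volume.restrict (Icc (-R) R)) := by
  rw [Measure.volume_eq_prod, ← Measure.prod_restrict]

lemma LocL2.locL1 {T : ℝ} {f : ℝ → ℝ → ℝ} (h : LocL2 T f) : LocL1 T f := fun R => by
  have : IsFiniteMeasure (volume.restrict (Ioo 0 T ×ˢ Icc (-R) R)) := by
    rw [restrict_box]; infer_instance
  exact (h R).integrable one_le_two

lemma LocL2.add {T : ℝ} {f g : ℝ → ℝ → ℝ} (hf : LocL2 T f) (hg : LocL2 T g) :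
    LocL2 T (fun t x => f t x + g t x) := fun R => (hf R).add (hg R)

lemma LocL2.const_mul {T : ℝ} {f : ℝ → ℝ → ℝ} (c : ℝ) (hf : LocL2 T f) :
    LocL2 T (fun t x => c * f t x) := fun R => (hf R).const_mul c

lemma ContinuousOn.aestronglyMeasurable_box {T : ℝ} {b : ℝ → ℝ → ℝ}
    (hb : ContinuousOn (fun z : ℝ × ℝ => b z.1 z.2) (Icc 0 T ×ˢ univ)) (s : Set ℝ)
    (hs : MeasurableSet s) : AEStronglyMeasurable (fun z : ℝ × ℝ => b z.1 z.2)
      (volume.restrict (Ioo 0 T ×ˢ s)) :=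
  (hb.mono (prod_mono Ioo_subset_Icc_self (subset_univ s))).aestronglyMeasurable
    (measurableSet_Ioo.prod hs)

lemma LocL2.bdd_mul {T : ℝ} {b f : ℝ → ℝ → ℝ} (hf : LocL2 T f)
    (hb : ContinuousOn (fun z : ℝ × ℝ => b z.1 z.2) (Icc 0 T ×ˢ univ))
    {M : ℝ} (hM : ∀ t ∈ Icc 0 T, ∀ x, |b t x| ≤ M) : LocL2 T (fun t x => b t x * f t x) :=
  fun R => by
  refine (hf R).of_le_mul (c := M)
    ((ContinuousOn.aestronglyMeasurable_box hb _ measurableSet_Icc).mul (hf R).1) ?_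
  filter_upwards [ae_restrict_mem (measurableSet_Ioo.prod measurableSet_Icc)] with z hz
  rw [norm_mul]
  gcongr
  exact hM _ (Ioo_subset_Icc_self hz.1) _

/-- A bounded continuous function on `[0, T] × ℝ`, absolutely continuous on almost all lines,
with locally square integrable derivatives `ft` and `fx`. -/
structure Reg (T : ℝ) (f ft fx : ℝ → ℝ → ℝ) : Prop where
  cont : ContinuousOn (fun z : ℝ × ℝ => f z.1 z.2) (Icc 0 T ×ˢ univ)
  bdd : ∃ M, ∀ t ∈ Icc 0 T, ∀ x, |f t x| ≤ M
  dt_locL2 : LocL2 T ft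
  dx_locL2 : LocL2 T fx
  prim_t : ∀ᵐ x, Prim (Icc 0 T) (fun t => f t x) (fun t => ft t x)
  prim_x : ∀ᵐ t ∂volume.restrict (Ioo 0 T), Prim univ (f t) (fx t)

namespace Reg

variable {T : ℝ} {f ft fx g gt gx : ℝ → ℝ → ℝ}

lemma meas (hf : Reg T f ft fx) : AEStronglyMeasurable (fun z : ℝ × ℝ => f z.1 z.2)
    (volume.restrict (strip T)) :=
  ContinuousOn.aestronglyMeasurable_box hf.cont univ .univ

lemma add (hf : Reg T f ft fx) (hg : Reg T g gt gx) :
    Reg T (fun t x => f t x + g t x) (fun t x => ft t x + gt t x)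
      (fun t x => fx t x + gx t x) where
  cont := hf.cont.add hg.cont
  bdd := by
    obtain ⟨M, hM⟩ := hf.bdd
    obtain ⟨N, hN⟩ := hg.bdd
    exact ⟨M + N, fun t ht x => (abs_add_le _ _).trans (add_le_add (hM t ht x) (hN t ht x))⟩
  dt_locL2 := hf.dt_locL2.add hg.dt_locL2
  dx_locL2 := hf.dx_locL2.add hg.dx_locL2
  prim_t := by
    filter_upwards [hf.prim_t, hg.prim_t] with x h1 h2 using h1.add h2
  prim_x := by
    filter_upwards [hf.prim_x, hg.prim_x] with t h1 h2 using h1.add h2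

lemma const_mul (c : ℝ) (hf : Reg T f ft fx) :
    Reg T (fun t x => c * f t x) (fun t x => c * ft t x) (fun t x => c * fx t x) where
  cont := continuousOn_const.mul hf.cont
  bdd := by
    obtain ⟨M, hM⟩ := hf.bdd
    exact ⟨|c| * M, fun t ht x => by rw [abs_mul]; gcongr; exact hM t ht x⟩
  dt_locL2 := hf.dt_locL2.const_mul c
  dx_locL2 := hf.dx_locL2.const_mul c
  prim_t := by
    filter_upwards [hf.prim_t] with x h1 using h1.const_mul c
  prim_x := by
    filter_upwards [hf.prim_x] with t h1 using h1.const_mul c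

lemma mul (hf : Reg T f ft fx) (hg : Reg T g gt gx) :
    Reg T (fun t x => f t x * g t x) (fun t x => ft t x * g t x + f t x * gt t x)
      (fun t x => fx t x * g t x + f t x * gx t x) where
  cont := hf.cont.mul hg.cont
  bdd := by
    obtain ⟨M, hM⟩ := hf.bdd
    obtain ⟨N, hN⟩ := hg.bdd
    exact ⟨M * N, fun t ht x => by
      rw [abs_mul]
      exact mul_le_mul (hM t ht x) (hN t ht x) (abs_nonneg _) ((abs_nonneg _).trans (hM t ht x))⟩
  dt_locL2 := by
    obtain ⟨M, hM⟩ := hf.bdd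
    obtain ⟨N, hN⟩ := hg.bdd
    have h1 := hf.dt_locL2.bdd_mul hg.cont hN
    simp only [mul_comm (g _ _)] at h1
    exact h1.add (hg.dt_locL2.bdd_mul hf.cont hM)
  dx_locL2 := by
    obtain ⟨M, hM⟩ := hf.bdd
    obtain ⟨N, hN⟩ := hg.bdd
    have h1 := hf.dx_locL2.bdd_mul hg.cont hN
    simp only [mul_comm (g _ _)] at h1
    exact h1.add (hg.dx_locL2.bdd_mul hf.cont hM)
  prim_t := by
    filter_upwards [hf.prim_t, hg.prim_t] with x h1 h2 using h1.mul h2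
  prim_x := by
    filter_upwards [hf.prim_x, hg.prim_x] with t h1 h2 using h1.mul h2

lemma comp {G G' : ℝ → ℝ} {K : Set ℝ} (hf : Reg T f ft fx) (hK : IsCompact K)
    (hfK : ∀ t ∈ Icc 0 T, ∀ x, f t x ∈ K) (hG : ∀ y ∈ K, HasDerivAt G (G' y) y)
    (hG' : ContinuousOn G' K) :
    Reg T (fun t x => G (f t x)) (fun t x => G' (f t x) * ft t x)
      (fun t x => G' (f t x) * fx t x) := by
  have hGc : ContinuousOn G K := fun y hy => (hG y hy).continuousAt.continuousWithinAt
  have hmaps : MapsTo (fun z : ℝ × ℝ => f z.1 z.2) (Icc 0 T ×ˢ univ) K :=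
    fun z hz => hfK z.1 hz.1 z.2
  obtain ⟨M, hM⟩ := hK.exists_bound_of_continuousOn hGc
  obtain ⟨N, hN⟩ := hK.exists_bound_of_continuousOn hG'
  have hc' : ContinuousOn (fun z : ℝ × ℝ => G' (f z.1 z.2)) (Icc 0 T ×ˢ univ) :=
    hG'.comp hf.cont hmaps
  exact {
    cont := hGc.comp hf.cont hmaps
    bdd := ⟨M, fun t ht x => hM _ (hfK t ht x)⟩
    dt_locL2 := hf.dt_locL2.bdd_mul hc' fun t ht x => hN _ (hfK t ht x)
    dx_locL2 := hf.dx_locL2.bdd_mul hc' fun t ht x => hN _ (hfK t ht x)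
    prim_t := by
      filter_upwards [hf.prim_t] with x h1
      exact h1.comp hG hG' fun t ht => hfK t ht x
    prim_x := by
      filter_upwards [hf.prim_x, ae_restrict_mem measurableSet_Ioo] with t h1 ht
      exact h1.comp hG hG' fun x _ => hfK t (Ioo_subset_Icc_self ht) x }

lemma of_space {b : ℝ → ℝ} (hb : ContDiff ℝ ∞ b) {M : ℝ} (hM : ∀ x, |b x| ≤ M) (T : ℝ) :
    Reg T (fun _ x => b x) (fun _ _ => 0) (fun _ x => deriv b x) := by
  have hd : Continuous (deriv b) := hb.continuous_deriv (by norm_cast)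
  exact {
    cont := (hb.continuous.comp continuous_snd).continuousOn
    bdd := ⟨M, fun _ _ x => hM x⟩
    dt_locL2 := fun R => MemLp.zero
    dx_locL2 := fun R => by
      have : IsFiniteMeasure (volume.restrict (Ioo 0 T ×ˢ Icc (-R) R)) := by
        rw [restrict_box]; infer_instance
      obtain ⟨N, hN⟩ := isCompact_Icc.exists_bound_of_continuousOn (s := Icc (-R) R)
        hd.continuousOn
      refine MemLp.of_bound (hd.comp continuous_snd).aestronglyMeasurable N ?_
      filter_upwards [ae_restrict_mem (measurableSet_Ioo.prod measurableSet_Icc)] with z hz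
      exact hN _ hz.2
    prim_t := .of_forall fun x => Prim.const _ _
    prim_x := .of_forall fun t => Prim.of_hasDerivAt
      (fun x _ => (hb.differentiable (by norm_num) x).hasDerivAt) hd.continuousOn }

lemma shift (hf : Reg T f ft fx) (c : ℝ) :
    Reg T (fun t x => f t (x + c)) (fun t x => ft t (x + c)) (fun t x => fx t (x + c)) := by
  have hL : ∀ {g : ℝ → ℝ → ℝ}, LocL2 T g → LocL2 T (fun t x => g t (x + c)) := by
    intro g hg R
    have h1 := hg (|R| + |c|)
    have hmp : MeasurePreserving (fun z : ℝ × ℝ => (z.1, z.2 + c)) volume volume := by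
      rw [Measure.volume_eq_prod]
      exact (MeasurePreserving.id volume).prod (measurePreserving_add_right volume c)
    have h2 : MeasurePreserving (fun z : ℝ × ℝ => (z.1, z.2 + c))
        (volume.restrict ((fun z : ℝ × ℝ => (z.1, z.2 + c)) ⁻¹'
          (Ioo 0 T ×ˢ Icc (-(|R| + |c|)) (|R| + |c|))))
        (volume.restrict (Ioo 0 T ×ˢ Icc (-(|R| + |c|)) (|R| + |c|))) :=
      hmp.restrict_preimage (measurableSet_Ioo.prod measurableSet_Icc)
    refine (h1.comp_measurePreserving h2).mono_measure (Measure.restrict_mono ?_ le_rfl)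
    rintro ⟨t, x⟩ ⟨ht, hx⟩
    refine ⟨ht, ?_, ?_⟩ <;> simp only
    · linarith [hx.1, le_abs_self R, neg_abs_le c]
    · linarith [hx.2, le_abs_self R, le_abs_self c]
  exact {
    cont := hf.cont.comp (f := fun z : ℝ × ℝ => (z.1, z.2 + c)) (by fun_prop)
      fun z hz => ⟨hz.1, trivial⟩
    bdd := by
      obtain ⟨M, hM⟩ := hf.bdd
      exact ⟨M, fun t ht x => hM t ht _⟩
    dt_locL2 := hL hf.dt_locL2
    dx_locL2 := hL hf.dx_locL2
    prim_t := (measurePreserving_add_right volume c).quasiMeasurePreserving.ae hf.prim_t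
    prim_x := by
      filter_upwards [hf.prim_x] with t h1 using h1.shift c }

end Reg

lemma strip_mono {t T : ℝ} (h : t ≤ T) : strip t ⊆ strip T :=
  prod_mono (Ioo_subset_Ioo_right h) le_rfl

/-- Integration over the strip of a balance law `∂_t A + ∂_x B = S`. -/
lemma integral_balance {T : ℝ} {A At Ax B Bt Bx S : ℝ → ℝ → ℝ} (hA : Reg T A At Ax)
    (hB : Reg T B Bt Bx) (hBi : IntegrableOn (fun z : ℝ × ℝ => B z.1 z.2) (strip T))
    (hS : IntegrableOn (fun z : ℝ × ℝ => S z.1 z.2) (strip T))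
    (heq : ∀ᵐ z ∂volume.restrict (strip T), At z.1 z.2 + Bx z.1 z.2 = S z.1 z.2)
    (h0 : Integrable (A 0)) {t : ℝ} (ht : t ∈ Icc 0 T) (hAt : Integrable (A t)) :
    (∫ x, A t x) - ∫ x, A 0 x = ∫ z in strip t, S z.1 z.2 := by
  have hBt : IntegrableOn (fun z : ℝ × ℝ => B z.1 z.2) (strip t) := hBi.mono_set (strip_mono ht.2)
  have hSt : IntegrableOn (fun z : ℝ × ℝ => S z.1 z.2) (strip t) := hS.mono_set (strip_mono ht.2)
  -- `b R` is the net flux through the lateral sides of the box `(0, t) × [-R, R]`.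
  set b : ℝ → ℝ := fun R => ∫ s in Ioo 0 t, (B s R - B s (-R)) with hb
  have hbox : ∀ R : ℝ, Ioo 0 t ×ˢ Icc (-R) R ⊆ Ioo 0 T ×ˢ Icc (-R) R := fun R =>
    prod_mono (Ioo_subset_Ioo_right ht.2) le_rfl
  have key : ∀ R : ℝ, 0 ≤ R → ∫ x in Icc (-R) R, (A t x - A 0 x) =
      (∫ z in Ioo 0 t ×ˢ Icc (-R) R, S z.1 z.2) - b R := by
    intro R hR
    have hAi : IntegrableOn (fun z : ℝ × ℝ => At z.1 z.2) (Ioo 0 t ×ˢ Icc (-R) R) :=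
      (hA.dt_locL2.locL1 R).mono_set (hbox R)
    have hBxi : IntegrableOn (fun z : ℝ × ℝ => Bx z.1 z.2) (Ioo 0 t ×ˢ Icc (-R) R) :=
      (hB.dx_locL2.locL1 R).mono_set (hbox R)
    have hSi : IntegrableOn (fun z : ℝ × ℝ => S z.1 z.2) (Ioo 0 t ×ˢ Icc (-R) R) :=
      hSt.mono_set (prod_mono le_rfl (subset_univ _))
    have e1 : ∫ x in Icc (-R) R, (A t x - A 0 x) =
        ∫ z in Ioo 0 t ×ˢ Icc (-R) R, At z.1 z.2 := by
      rw [restrict_box, integral_prod_symm]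
      · refine integral_congr_ae (ae_restrict_of_ae ?_)
        filter_upwards [hA.prim_t] with x hx
        rw [← (hx 0 ⟨le_rfl, ht.1.trans ht.2⟩ t ht).2, intervalIntegral.integral_of_le ht.1,
          integral_Ioc_eq_integral_Ioo]
      · rw [IntegrableOn, restrict_box] at hAi
        exact hAi
    have e2 : b R = ∫ z in Ioo 0 t ×ˢ Icc (-R) R, Bx z.1 z.2 := by
      rw [restrict_box, integral_prod]
      · refine integral_congr_ae ?_
        filter_upwards [ae_restrict_of_ae_restrict_of_subset (Ioo_subset_Ioo_right ht.2) hB.prim_x]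
          with s hs
        rw [← (hs (-R) trivial R trivial).2, intervalIntegral.integral_of_le (by linarith),
          integral_Icc_eq_integral_Ioc]
      · rw [IntegrableOn, restrict_box] at hBxi
        exact hBxi
    rw [e1, e2, ← integral_sub hSi hBxi]
    refine integral_congr_ae ?_
    have hsub : Ioo 0 t ×ˢ Icc (-R) R ⊆ strip T :=
      (hbox R).trans (prod_mono le_rfl (subset_univ _))
    filter_upwards [ae_restrict_of_ae_restrict_of_subset hsub heq] with z hz
    linarith
  -- Integrability of `B` on the strip makes its time integrals at `R` and at `-R` integrable
  -- functions of `R`.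
  have hbint : Integrable b := by
    have h1 : Integrable (fun z : ℝ × ℝ => B z.1 z.2)
        (((volume : Measure ℝ).restrict (Ioo 0 t)).prod volume) := by
      rw [← restrict_strip]; exact hBt
    have h2 : Integrable (fun R => ∫ s in Ioo 0 t, B s R) := h1.integral_prod_right
    refine (h2.sub h2.comp_neg).congr ?_
    have h3 := h1.prod_left_ae
    have h4 := (Measure.measurePreserving_neg (volume : Measure ℝ)).quasiMeasurePreserving.ae h3
    filter_upwards [h3, h4] with R h5 h6
    rw [hb]
    simp only [Pi.sub_apply]
    rw [integral_sub h5 h6]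
  have hIcc : ∀ {k : ℝ → ℝ}, Integrable k → Tendsto (fun R : ℝ => ∫ x in Icc (-R) R, k x) atTop
      (𝓝 (∫ x, k x)) := by
    intro k hk
    have h1 := intervalIntegral_tendsto_integral hk tendsto_neg_atTop_atBot tendsto_id
    refine h1.congr' ?_
    filter_upwards [eventually_ge_atTop 0] with R hR
    simp only [id]
    rw [intervalIntegral.integral_of_le (by linarith), integral_Icc_eq_integral_Ioc]
  have hlimA := hIcc (hAt.sub h0)
  have hlimS : Tendsto (fun R : ℝ => ∫ z in Ioo 0 t ×ˢ Icc (-R) R, S z.1 z.2) atTop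
      (𝓝 (∫ z in strip t, S z.1 z.2)) := by
    have hS1 : Integrable (fun z : ℝ × ℝ => S z.1 z.2)
        (((volume : Measure ℝ).restrict (Ioo 0 t)).prod volume) := by
      rw [← restrict_strip]; exact hSt
    have h2 := hIcc (k := fun x => ∫ s in Ioo 0 t, S s x) hS1.integral_prod_right
    rw [restrict_strip, integral_prod_symm _ hS1]
    refine h2.congr fun R => ?_
    rw [restrict_box, integral_prod_symm]
    have h3 : IntegrableOn (fun z : ℝ × ℝ => S z.1 z.2) (Ioo 0 t ×ˢ Icc (-R) R) :=
      hSt.mono_set (prod_mono le_rfl (subset_univ _))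
    rw [IntegrableOn, restrict_box] at h3
    exact h3
  have hlimb : Tendsto b atTop (𝓝 ((∫ z in strip t, S z.1 z.2) - ∫ x, (A t x - A 0 x))) := by
    refine (hlimS.sub hlimA).congr' ?_
    filter_upwards [eventually_ge_atTop 0] with R hR
    have := key R hR
    simp only [Pi.sub_apply]
    linarith
  -- The flux `b` has a limit at infinity and is integrable, so the limit is zero; no pointwise
  -- decay of `B` is needed.
  have hz := IntegrableAtFilter.eq_zero_of_tendsto (hbint.integrableAtFilter atTop)
    (fun s hs => by
      obtain ⟨c, hc⟩ := mem_atTop_sets.1 hs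
      exact measure_mono_top (fun x (hx : c ≤ x) => hc x hx) Real.volume_Ici) hlimb
  rw [integral_sub hAt h0] at hz
  linarith

/-! ### Pointwise bounds by `L²` norms on the line -/

/-- Cauchy–Schwarz on an interval of length one, obtained by integrating `(|g| - m)² ≥ 0` with `m`
the mean of `|g|`. -/
lemma sq_intervalIntegral_abs_le {g : ℝ → ℝ} {x : ℝ}
    (hg : IntegrableOn (fun y => g y ^ 2) (Ioc x (x + 1)))
    (hg1 : IntervalIntegrable g volume x (x + 1)) :
    (∫ y in x..(x + 1), |g y|) ^ 2 ≤ ∫ y in Ioc x (x + 1), g y ^ 2 := by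
  have hx : x ≤ x + 1 := by linarith
  set m := ∫ y in x..(x + 1), |g y| with hm
  have hi2 : IntervalIntegrable (fun y => g y ^ 2) volume x (x + 1) :=
    (intervalIntegrable_iff_integrableOn_Ioc_of_le hx).2 hg
  have h0 : 0 ≤ ∫ y in x..(x + 1), (g y ^ 2 - 2 * m * |g y| + m ^ 2) :=
    intervalIntegral.integral_nonneg hx fun y _ => by
      nlinarith [sq_nonneg (|g y| - m), sq_abs (g y)]
  rw [intervalIntegral.integral_add (hi2.sub (hg1.abs.const_mul _)) (by simp),
    intervalIntegral.integral_sub hi2 (hg1.abs.const_mul _),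
    intervalIntegral.integral_const_mul, ← hm] at h0
  simp only [intervalIntegral.integral_const, smul_eq_mul] at h0
  rw [← intervalIntegral.integral_of_le hx]
  nlinarith

/-- Average `|f x| ≤ |f y| + ∫ |g|` over `y` in the unit interval. Only local integrals occur, so it
serves quantities such as powers of the density that are not integrable on the line. -/
lemma Prim.abs_le {f g : ℝ → ℝ} (h : Prim univ f g) (x : ℝ) :
    |f x| ≤ (∫ y in x..(x + 1), |f y|) + ∫ y in x..(x + 1), |g y| := by
  have hx : x ≤ x + 1 := by linarith
  have hg := (h x trivial (x + 1) trivial).1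
  have hf : IntervalIntegrable f volume x (x + 1) := h.continuous.intervalIntegrable _ _
  have key : ∀ y ∈ Icc x (x + 1), |f x| ≤ |f y| + ∫ y in x..(x + 1), |g y| := fun y hy => by
    have h1 := (h x trivial y trivial).2
    have h2 : |∫ z in x..y, g z| ≤ ∫ z in x..(x + 1), |g z| := by
      refine (intervalIntegral.abs_integral_le_integral_abs hy.1).trans ?_
      exact intervalIntegral.integral_mono_interval le_rfl hy.1 hy.2
        (.of_forall fun z => abs_nonneg _) hg.abs
    rw [h1] at h2
    calc |f x| = |f y - (f y - f x)| := by ring_nf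
      _ ≤ |f y| + |f y - f x| := abs_sub _ _
      _ ≤ _ := by gcongr
  have h3 := intervalIntegral.integral_mono_on hx (by simp) (hf.abs.add (by simp)) key
  rw [intervalIntegral.integral_add hf.abs (by simp)] at h3
  simpa using h3

lemma sq_intervalIntegral_abs_le_integral {g : ℝ → ℝ} (hg : MemLp g 2 volume) (x : ℝ) :
    (∫ y in x..(x + 1), |g y|) ^ 2 ≤ ∫ y, g y ^ 2 :=
  (sq_intervalIntegral_abs_le hg.integrable_sq.integrableOn
    ((hg.locallyIntegrable one_le_two).integrableOn_isCompact
      isCompact_uIcc).intervalIntegrable).trans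
    (setIntegral_le_integral hg.integrable_sq (.of_forall fun _ => sq_nonneg _))

lemma Prim.sq_le {f g : ℝ → ℝ} (h : Prim univ f g) (hf : MemLp f 2 volume)
    (hg : MemLp g 2 volume) (x : ℝ) :
    f x ^ 2 ≤ 2 * (∫ y, f y ^ 2) + 2 * ∫ y, g y ^ 2 := by
  have h1 := h.abs_le x
  have h2 := sq_intervalIntegral_abs_le_integral hf x
  have h3 := sq_intervalIntegral_abs_le_integral hg x
  have h4 : f x ^ 2 ≤ ((∫ y in x..(x + 1), |f y|) + ∫ y in x..(x + 1), |g y|) ^ 2 := by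
    rw [← sq_abs]; gcongr
  nlinarith [sq_nonneg ((∫ y in x..(x + 1), |f y|) - ∫ y in x..(x + 1), |g y|)]

/-- The integral over the line of the derivative of an integrable function vanishes. -/
lemma Prim.integral_eq_zero {f g : ℝ → ℝ} (h : Prim univ f g) (hf : Integrable f)
    (hg : Integrable g) : ∫ x, g x = 0 := by
  have h1 := intervalIntegral_tendsto_integral hg tendsto_neg_atTop_atBot tendsto_id
  have h2 : Tendsto (fun R : ℝ => f R - f (-R)) atTop (𝓝 (∫ x, g x)) :=
    h1.congr fun R => (h (-R) trivial R trivial).2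
  exact IntegrableAtFilter.eq_zero_of_tendsto ((hf.sub hf.comp_neg).integrableAtFilter atTop)
    (fun s hs => by
      obtain ⟨c, hc⟩ := mem_atTop_sets.1 hs
      exact measure_mono_top (fun x (hx : c ≤ x) => hc x hx) Real.volume_Ici) h2

/-! ### Slices of functions on the strip -/

/-- Joint measurability allows Tonelli to compute the integral of `|f - g|` slice by slice, and that
integral vanishes. -/
lemma ae_strip_of_ae_ae {T : ℝ} {f g : ℝ → ℝ → ℝ}
    (hf : AEStronglyMeasurable (fun z : ℝ × ℝ => f z.1 z.2) (volume.restrict (strip T)))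
    (hg : AEStronglyMeasurable (fun z : ℝ × ℝ => g z.1 z.2) (volume.restrict (strip T)))
    (h : ∀ᵐ t ∂volume.restrict (Ioo 0 T), f t =ᵐ[volume] g t) :
    ∀ᵐ z ∂volume.restrict (strip T), f z.1 z.2 = g z.1 z.2 := by
  rw [restrict_strip] at hf hg ⊢
  have hm : AEMeasurable (fun z : ℝ × ℝ => ‖f z.1 z.2 - g z.1 z.2‖ₑ)
      ((volume.restrict (Ioo 0 T)).prod (volume : Measure ℝ)) := (hf.sub hg).enorm
  have h0 : ∫⁻ z, ‖f z.1 z.2 - g z.1 z.2‖ₑ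
      ∂((volume.restrict (Ioo 0 T)).prod (volume : Measure ℝ)) = 0 := by
    rw [lintegral_prod _ hm]
    rw [lintegral_eq_zero_iff' hm.lintegral_prod_right']
    filter_upwards [h] with t ht
    simp only [Pi.zero_apply]
    rw [lintegral_congr_ae (g := fun _ => 0)]
    · simp
    · filter_upwards [ht] with x hx
      simp [hx]
  rw [lintegral_eq_zero_iff' hm] at h0
  filter_upwards [h0] with z hz
  simpa [sub_eq_zero] using hz

lemma ae_ae_of_ae_strip {T : ℝ} {p : ℝ × ℝ → Prop} (h : ∀ᵐ z ∂volume.restrict (strip T), p z) :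
    ∀ᵐ t ∂volume.restrict (Ioo 0 T), ∀ᵐ x, p (t, x) := by
  rw [restrict_strip] at h
  exact Measure.ae_ae_of_ae_prod h

/-- `f ∈ L^∞(0, T; L²(ℝ))`, with the norm expressed by integrals. -/
structure LinfL2 (T : ℝ) (f : ℝ → ℝ → ℝ) : Prop where
  meas : AEStronglyMeasurable (fun z : ℝ × ℝ => f z.1 z.2) (volume.restrict (strip T))
  bound : ∃ K : ℝ, ∀ᵐ t ∂volume.restrict (Ioo 0 T), MemLp (f t) 2 volume ∧ ∫ x, f t x ^ 2 ≤ K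

lemma integral_sq_eq_toReal {f : ℝ → ℝ} (hf : MemLp f 2 volume) :
    ∫ x, f x ^ 2 = (eLpNorm f 2 volume).toReal ^ 2 := by
  have h1 := hf.eLpNorm_eq_integral_rpow_norm (by norm_num) (by norm_num)
  have h0 : 0 ≤ ∫ x, f x ^ 2 := integral_nonneg fun x => sq_nonneg _
  rw [h1]
  simp only [ENNReal.toReal_ofNat, Real.rpow_ofNat, Real.norm_eq_abs, sq_abs]
  rw [ENNReal.toReal_ofReal (by positivity), ← Real.rpow_natCast, ← Real.rpow_mul h0]
  norm_num

lemma MemLinftyL2.linfL2 {T : ℝ} {f : ℝ → ℝ → ℝ} (h : MemLinftyL2 T f) : LinfL2 T f := by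
  refine ⟨h.1, ?_⟩
  obtain ⟨C, hC⟩ := h.2
  have hm := h.1
  rw [restrict_strip] at hm
  refine ⟨(C : ℝ) ^ 2, ?_⟩
  filter_upwards [hC, hm.prodMk_left] with t ht hmt
  have hL : MemLp (f t) 2 volume := ⟨hmt, lt_of_le_of_lt ht ENNReal.coe_lt_top⟩
  refine ⟨hL, ?_⟩
  rw [integral_sq_eq_toReal hL]
  gcongr
  exact ENNReal.toReal_le_coe_of_le_coe ht

lemma LinfL2.memL2L2 {T : ℝ} {f : ℝ → ℝ → ℝ} (h : LinfL2 T f) : MemL2L2 T f := by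
  obtain ⟨hm, K, hK⟩ := h
  rw [MemL2L2, memLp_two_iff_integrable_sq hm]
  rw [restrict_strip] at hm ⊢
  have hm2 : AEStronglyMeasurable (fun z : ℝ × ℝ => f z.1 z.2 ^ 2)
      ((volume.restrict (Ioo 0 T)).prod (volume : Measure ℝ)) := hm.pow 2
  rw [integrable_prod_iff hm2]
  refine ⟨by filter_upwards [hK] with t ht using ht.1.integrable_sq, ?_⟩
  refine Integrable.of_bound hm2.norm.integral_prod_right' K ?_
  filter_upwards [hK] with t ht
  rw [Real.norm_eq_abs, abs_of_nonneg (integral_nonneg fun x => norm_nonneg _)]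
  simpa using ht.2

lemma LinfL2.congr {T : ℝ} {f g : ℝ → ℝ → ℝ} (h : LinfL2 T f)
    (hfg : ∀ᵐ z ∂volume.restrict (strip T), f z.1 z.2 = g z.1 z.2) : LinfL2 T g := by
  refine ⟨h.meas.congr hfg, ?_⟩
  obtain ⟨K, hK⟩ := h.bound
  refine ⟨K, ?_⟩
  filter_upwards [hK, ae_ae_of_ae_strip hfg] with t ht h1
  refine ⟨ht.1.ae_eq h1, le_of_eq_of_le (integral_congr_ae ?_) ht.2⟩
  filter_upwards [h1] with x hx
  rw [hx]

lemma LinfL2.add {T : ℝ} {f g : ℝ → ℝ → ℝ} (hf : LinfL2 T f) (hg : LinfL2 T g) :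
    LinfL2 T (fun t x => f t x + g t x) := by
  refine ⟨hf.meas.add hg.meas, ?_⟩
  obtain ⟨K, hK⟩ := hf.bound
  obtain ⟨L, hL⟩ := hg.bound
  refine ⟨2 * K + 2 * L, ?_⟩
  filter_upwards [hK, hL] with t h1 h2
  refine ⟨h1.1.add h2.1, ?_⟩
  calc ∫ x, (f t x + g t x) ^ 2 ≤ ∫ x, (2 * f t x ^ 2 + 2 * g t x ^ 2) := by
        refine integral_mono (h1.1.add h2.1).integrable_sq
          ((h1.1.integrable_sq.const_mul 2).add (h2.1.integrable_sq.const_mul 2)) fun x => ?_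
        simp only
        nlinarith [sq_nonneg (f t x - g t x)]
    _ = 2 * (∫ x, f t x ^ 2) + 2 * ∫ x, g t x ^ 2 := by
        rw [integral_add (h1.1.integrable_sq.const_mul 2) (h2.1.integrable_sq.const_mul 2),
          integral_const_mul, integral_const_mul]
    _ ≤ _ := by linarith [h1.2, h2.2]

lemma MemL2L2.locL2 {T : ℝ} {f : ℝ → ℝ → ℝ} (h : MemL2L2 T f) : LocL2 T f := fun _ =>
  h.mono_measure (Measure.restrict_mono (prod_mono le_rfl (subset_univ _)) le_rfl)

lemma LocL2.of_bdd {T : ℝ} {f : ℝ → ℝ → ℝ}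
    (hf : ContinuousOn (fun z : ℝ × ℝ => f z.1 z.2) (Icc 0 T ×ˢ univ))
    {M : ℝ} (hM : ∀ t ∈ Icc 0 T, ∀ x, |f t x| ≤ M) : LocL2 T f := fun R => by
  have : IsFiniteMeasure (volume.restrict (Ioo 0 T ×ˢ Icc (-R) R)) := by
    rw [restrict_box]; infer_instance
  refine MemLp.of_bound (ContinuousOn.aestronglyMeasurable_box hf _ measurableSet_Icc) M ?_
  filter_upwards [ae_restrict_mem (measurableSet_Ioo.prod measurableSet_Icc)] with z hz
  exact hM _ (Ioo_subset_Icc_self hz.1) _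

lemma LocL1.locallyIntegrableOn {T : ℝ} {f : ℝ → ℝ → ℝ} (h : LocL1 T f) :
    LocallyIntegrableOn (fun z : ℝ × ℝ => f z.1 z.2) (strip T) volume := by
  intro z hz
  obtain ⟨U, hU, hi⟩ := h.locInt.locallyIntegrable z
  refine ⟨strip T ∩ U, inter_mem self_mem_nhdsWithin (mem_nhdsWithin_of_mem_nhds hU), ?_⟩
  rw [IntegrableOn, integrable_indicator_iff (measurableSet_strip T), IntegrableOn,
    Measure.restrict_restrict (measurableSet_strip T)] at hi
  exact hi

/-- The continuous functions `min f M` and `f` agree almost everywhere, hence everywhere on the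
closed interval. -/
lemma le_of_ae_le {T M : ℝ} (hT : 0 < T) {f : ℝ → ℝ} (hf : ContinuousOn f (Icc 0 T))
    (h : ∀ᵐ t ∂volume.restrict (Ioo 0 T), f t ≤ M) : ∀ t ∈ Icc 0 T, f t ≤ M := by
  have hmin : ContinuousOn (fun t => min (f t) M) (Icc 0 T) := ContinuousOn.inf hf continuousOn_const
  have h1 : EqOn (fun t => min (f t) M) f (Ioo 0 T) :=
    Measure.eqOn_open_of_ae_eq (μ := volume) (by filter_upwards [h] with t ht using min_eq_left ht)
      isOpen_Ioo (hmin.mono Ioo_subset_Icc_self) (hf.mono Ioo_subset_Icc_self)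
  have h2 := h1.of_subset_closure (t := Icc 0 T) hmin hf Ioo_subset_Icc_self
    (by rw [closure_Ioo hT.ne])
  intro t ht
  rw [← h2 ht]
  exact min_le_right _ _

lemma LocL1.integrable_mul {T : ℝ} {g : ℝ → ℝ → ℝ} (hg : LocL1 T g) {k : ℝ × ℝ → ℝ}
    (hk : Continuous k) (hkc : HasCompactSupport k) :
    Integrable (fun z : ℝ × ℝ => g z.1 z.2 * k z) (volume.restrict (strip T)) := by
  have h1 := hg.locInt.locallyIntegrable.integrable_smul_left_of_hasCompactSupport hk hkc
  rw [← IntegrableOn, ← integrable_indicator_iff (measurableSet_strip T)]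
  refine h1.congr (.of_forall fun z => ?_)
  by_cases hz : z ∈ strip T <;> simp [hz, mul_comm]

lemma continuous_dt {ψ : ℝ × ℝ → ℝ} (hψ : ContDiff ℝ ∞ ψ) : Continuous (dt ψ) :=
  (hψ.continuous_fderiv (by norm_num)).clm_apply continuous_const

lemma continuous_dx {ψ : ℝ × ℝ → ℝ} (hψ : ContDiff ℝ ∞ ψ) : Continuous (dx ψ) :=
  (hψ.continuous_fderiv (by norm_num)).clm_apply continuous_const

lemma hasCompactSupport_dt {ψ : ℝ × ℝ → ℝ} (hψ : HasCompactSupport ψ) :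
    HasCompactSupport (dt ψ) :=
  (hψ.fderiv (𝕜 := ℝ)).comp_left (g := fun L : ℝ × ℝ →L[ℝ] ℝ => L (1, 0)) rfl

lemma hasCompactSupport_dx {ψ : ℝ × ℝ → ℝ} (hψ : HasCompactSupport ψ) :
    HasCompactSupport (dx ψ) :=
  (hψ.fderiv (𝕜 := ℝ)).comp_left (g := fun L : ℝ × ℝ →L[ℝ] ℝ => L (0, 1)) rfl

/-- A function with classical derivatives on lines has them as weak derivatives. -/
lemma Reg.integral_mul_dt {T : ℝ} {f ft fx : ℝ → ℝ → ℝ} (hT : 0 < T) (h : Reg T f ft fx)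
    {ψ : ℝ × ℝ → ℝ} (hψ : IsTest T ψ) :
    ∫ z in strip T, f z.1 z.2 * dt ψ z = -∫ z in strip T, ft z.1 z.2 * ψ z := by
  obtain ⟨M, hM⟩ := h.bdd
  have i1 := (LocL2.of_bdd h.cont hM).locL1.integrable_mul (continuous_dt hψ.smooth)
    (hasCompactSupport_dt hψ.compact)
  have i2 := h.dt_locL2.locL1.integrable_mul hψ.smooth.continuous hψ.compact
  suffices hs : ∫ z in strip T, (ft z.1 z.2 * ψ z + f z.1 z.2 * dt ψ z) = 0 by
    rw [integral_add i2 i1] at hs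
    linarith
  rw [restrict_strip] at i1 i2 ⊢
  have i3 : Integrable (fun z : ℝ × ℝ => ft z.1 z.2 * ψ z + f z.1 z.2 * dt ψ z)
      ((volume.restrict (Ioo 0 T)).prod (volume : Measure ℝ)) := i2.add i1
  rw [integral_prod_symm _ i3]
  refine integral_eq_zero_of_ae ?_
  filter_upwards [h.prim_t] with x hx
  have hp : Prim (Icc 0 T) (fun t => ψ (t, x)) (fun t => dt ψ (t, x)) := by
    refine Prim.of_hasDerivAt (fun t _ => ?_)
      ((continuous_dt hψ.smooth).comp (by fun_prop)).continuousOn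
    have h1 := (hψ.smooth.differentiable (by norm_num) (t, x)).hasFDerivAt
    have h2 : HasDerivAt (fun t : ℝ => (t, x)) ((1 : ℝ), (0 : ℝ)) t :=
      (hasDerivAt_id t).prodMk (hasDerivAt_const t x)
    exact h1.comp_hasDerivAt t h2
  have hz : ∀ t, t ∉ Ioo 0 T → ψ (t, x) = 0 := fun t ht =>
    image_eq_zero_of_notMem_tsupport fun hmem => ht (hψ.support hmem).1
  have := ((hx.mul hp) 0 ⟨le_rfl, hT.le⟩ T ⟨hT.le, le_rfl⟩).2
  simp only at this
  rw [hz 0 (by simp), hz T (by simp), intervalIntegral.integral_of_le hT.le,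
    integral_Ioc_eq_integral_Ioo] at this
  simpa using this

lemma IsTest.mono {t T : ℝ} {ψ : ℝ × ℝ → ℝ} (h : IsTest t ψ) (hT : t ≤ T) : IsTest T ψ :=
  ⟨h.smooth, h.compact, h.support.trans (strip_mono hT)⟩

lemma dx_eq_zero {T : ℝ} {ψ : ℝ × ℝ → ℝ} (h : IsTest T ψ) {z : ℝ × ℝ} (hz : z ∉ strip T) :
    dx ψ z = 0 := by
  have : z ∉ tsupport (fderiv ℝ ψ) := fun h' => hz (h.support (tsupport_fderiv_subset ℝ h'))
  rw [dx, image_eq_zero_of_notMem_tsupport this]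
  rfl

lemma dt_eq_zero {T : ℝ} {ψ : ℝ × ℝ → ℝ} (h : IsTest T ψ) {z : ℝ × ℝ} (hz : z ∉ strip T) :
    dt ψ z = 0 := by
  have : z ∉ tsupport (fderiv ℝ ψ) := fun h' => hz (h.support (tsupport_fderiv_subset ℝ h'))
  rw [dt, image_eq_zero_of_notMem_tsupport this]
  rfl

lemma setIntegral_strip_eq_of_le {t T : ℝ} (hT : t ≤ T) {F : ℝ × ℝ → ℝ}
    (h : ∀ z, z ∉ strip t → F z = 0) : ∫ z in strip T, F z = ∫ z in strip t, F z :=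
  setIntegral_eq_of_subset_of_forall_sdiff_eq_zero (measurableSet_strip T) (strip_mono hT)
    fun z hz => h z hz.2

lemma HasWeakDx.mono {t T : ℝ} {f g : ℝ → ℝ → ℝ} (h : HasWeakDx T f g) (hT : t ≤ T) :
    HasWeakDx t f g := by
  refine ⟨h.1.mono_set (strip_mono hT), h.2.1.mono_set (strip_mono hT), fun ψ hψ => ?_⟩
  have := h.2.2 ψ (hψ.mono hT)
  rwa [setIntegral_strip_eq_of_le hT fun z hz => by rw [dx_eq_zero hψ hz, mul_zero],
    setIntegral_strip_eq_of_le hT fun z hz => by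
      rw [image_eq_zero_of_notMem_tsupport fun h => hz (hψ.support h), mul_zero]] at this

/-! ### Strong solutions in pointwise form -/

/-- A solution on `[0, T]` of the compressible Navier-Stokes system, with its derivatives and
with the equations holding almost everywhere. -/
structure Sol (α γ a T : ℝ) (ρbar : ℝ → ℝ) (ρ u ρt ρx ut ux uxx : ℝ → ℝ → ℝ) : Prop where
  T_pos : 0 < T
  rho_reg : Reg T ρ ρt ρx
  u_reg : Reg T u ut ux
  rho_bounds : ∃ c C : ℝ, 0 < c ∧ ∀ t ∈ Icc 0 T, ∀ x, c ≤ ρ t x ∧ ρ t x ≤ C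
  rho_L2 : LinfL2 T (fun t x => ρ t x - ρbar x)
  rhox_L2 : LinfL2 T ρx
  u_L2 : LinfL2 T u
  ux_L2 : LinfL2 T ux
  rhot_L2 : MemL2L2 T ρt
  ut_L2 : MemL2L2 T ut
  uxx_L2 : MemL2L2 T uxx
  ux_prim : ∀ᵐ t ∂volume.restrict (Ioo 0 T), ∃ w, ux t =ᵐ[volume] w ∧ Prim univ w (uxx t)
  mass : ∀ᵐ z ∂volume.restrict (strip T),
    ρt z.1 z.2 + u z.1 z.2 * ρx z.1 z.2 + ρ z.1 z.2 * ux z.1 z.2 = 0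
  momentum : ∀ᵐ z ∂volume.restrict (strip T),
    ρ z.1 z.2 * (ut z.1 z.2 + u z.1 z.2 * ux z.1 z.2) +
      a * γ * ρ z.1 z.2 ^ (γ - 1) * ρx z.1 z.2 =
    α * ρ z.1 z.2 ^ (α - 1) * ρx z.1 z.2 * ux z.1 z.2 + ρ z.1 z.2 ^ α * uxx z.1 z.2

lemma deriv_eq_zero_of_reference {ρm ρp : ℝ} {ρbar : ℝ → ℝ} (h : IsReferenceDensity ρm ρp ρbar)
    {x : ℝ} (hx : x ∉ Icc (-1 : ℝ) 1) : deriv ρbar x = 0 := by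
  rw [mem_Icc, not_and_or, not_le, not_le] at hx
  rcases hx with hx | hx
  · have : ρbar =ᶠ[𝓝 x] fun _ => ρm := by
      filter_upwards [Iio_mem_nhds hx] with y hy using h.left_eq y (le_of_lt hy)
    rw [this.deriv_eq, deriv_const]
  · have : ρbar =ᶠ[𝓝 x] fun _ => ρp := by
      filter_upwards [Ioi_mem_nhds hx] with y hy using h.right_eq y (le_of_lt hy)
    rw [this.deriv_eq, deriv_const]

lemma continuous_deriv_reference {ρm ρp : ℝ} {ρbar : ℝ → ℝ}
    (h : IsReferenceDensity ρm ρp ρbar) : Continuous (deriv ρbar) :=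
  h.smooth.continuous_deriv (by norm_cast)

lemma hasCompactSupport_deriv_reference {ρm ρp : ℝ} {ρbar : ℝ → ℝ}
    (h : IsReferenceDensity ρm ρp ρbar) : HasCompactSupport (deriv ρbar) :=
  HasCompactSupport.intro isCompact_Icc fun _ hx => deriv_eq_zero_of_reference h hx

lemma reference_bounds {ρm ρp : ℝ} {ρbar : ℝ → ℝ} (h : IsReferenceDensity ρm ρp ρbar) (x : ℝ) :
    min ρm ρp ≤ ρbar x ∧ ρbar x ≤ max ρm ρp := by
  have hl := h.left_eq (min x (-1)) (min_le_right _ _)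
  have hr := h.right_eq (max x 1) (le_max_right _ _)
  rcases h.mono with hm | hm
  · exact ⟨(min_le_left _ _).trans (hl ▸ hm (min_le_left _ _)),
      (hm (le_max_left x 1)).trans (hr ▸ le_max_right _ _)⟩
  · exact ⟨(min_le_right _ _).trans (hr ▸ hm (le_max_left _ _)),
      (hm (min_le_left x (-1))).trans (hl ▸ le_max_left _ _)⟩

lemma linfL2_of_space {T : ℝ} {g : ℝ → ℝ} (hg : MemLp g 2 volume) :
    LinfL2 T (fun _ x => g x) := by
  refine ⟨?_, ∫ x, g x ^ 2, .of_forall fun t => ⟨hg, le_rfl⟩⟩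
  rw [restrict_strip]
  exact hg.1.comp_snd

lemma eq_of_ae_eq_of_continuous {f g : ℝ → ℝ} (hf : Continuous f) (hg : Continuous g)
    (h : f =ᵐ[volume] g) : f = g :=
  (Continuous.ae_eq_iff_eq volume hf hg).1 h

lemma slice_continuous {T : ℝ} {f : ℝ → ℝ → ℝ}
    (hf : ContinuousOn (fun z : ℝ × ℝ => f z.1 z.2) (Icc 0 T ×ˢ univ)) {t : ℝ}
    (ht : t ∈ Icc 0 T) : Continuous (f t) :=
  continuousOn_univ.1 (hf.comp (f := fun x : ℝ => (t, x)) (by fun_prop)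
    fun _ _ => ⟨ht, trivial⟩)

lemma bounded_of_prim {T : ℝ} (hT : 0 < T) {f fx : ℝ → ℝ → ℝ}
    (hf : ContinuousOn (fun z : ℝ × ℝ => f z.1 z.2) (Icc 0 T ×ˢ univ))
    (h : ∀ᵐ t ∂volume.restrict (Ioo 0 T), Prim univ (f t) (fx t)) (hfL : LinfL2 T f)
    (hfxL : LinfL2 T fx) : ∃ M, ∀ t ∈ Icc 0 T, ∀ x, |f t x| ≤ M := by
  obtain ⟨K, hK⟩ := hfL.bound
  obtain ⟨L, hL⟩ := hfxL.bound
  have key : ∀ x, ∀ t ∈ Icc 0 T, f t x ^ 2 ≤ 2 * K + 2 * L := fun x => by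
    refine le_of_ae_le (f := fun t => f t x ^ 2) hT ?_ ?_
    · exact (hf.comp (f := fun t : ℝ => (t, x)) (by fun_prop) fun t ht => ⟨ht, trivial⟩).pow 2
    · filter_upwards [h, hK, hL] with t h1 h2 h3
      have := h1.sq_le h2.1 h3.1 x
      linarith [h2.2, h3.2]
  exact ⟨√(2 * K + 2 * L), fun t ht x => Real.abs_le_sqrt (key x t ht)⟩

lemma rpow_hasDerivAt_of_mem {p c C : ℝ} (hc : 0 < c) :
    ∀ y ∈ Icc c C, HasDerivAt (fun y : ℝ => y ^ p) (p * y ^ (p - 1)) y := fun _ hy =>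
  Real.hasDerivAt_rpow_const (Or.inl (lt_of_lt_of_le hc hy.1).ne')

lemma rpow_continuousOn {p c C : ℝ} (hc : 0 < c) :
    ContinuousOn (fun y : ℝ => y ^ p) (Icc c C) :=
  continuousOn_id.rpow_const fun _ hy => Or.inl (lt_of_lt_of_le hc hy.1).ne'

lemma Reg.rpow {T c C : ℝ} {ρ ρt ρx : ℝ → ℝ → ℝ} (h : Reg T ρ ρt ρx) (hc : 0 < c)
    (hb : ∀ t ∈ Icc 0 T, ∀ x, c ≤ ρ t x ∧ ρ t x ≤ C) (p : ℝ) :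
    Reg T (fun t x => ρ t x ^ p) (fun t x => p * ρ t x ^ (p - 1) * ρt t x)
      (fun t x => p * ρ t x ^ (p - 1) * ρx t x) :=
  h.comp (G := fun y => y ^ p) (G' := fun y => p * y ^ (p - 1)) isCompact_Icc
    (fun t ht x => hb t ht x) (rpow_hasDerivAt_of_mem hc)
    (continuousOn_const.mul (rpow_continuousOn hc))

/-- A conservation law in the sense of distributions holds almost everywhere. -/
lemma ae_of_conservation_law {T : ℝ} (hT : 0 < T) {q qt qx Φ Φx : ℝ → ℝ → ℝ} (hq : Reg T q qt qx)
    (hΦ : LocL1 T Φ)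
    (hΦx : AEStronglyMeasurable (fun z : ℝ × ℝ => Φx z.1 z.2) (volume.restrict (strip T)))
    (hqt : AEStronglyMeasurable (fun z : ℝ × ℝ => qt z.1 z.2) (volume.restrict (strip T)))
    (hp : ∀ᵐ t ∂volume.restrict (Ioo 0 T), ∃ w, Φ t =ᵐ[volume] w ∧ Prim univ w (Φx t))
    (h : ∀ ψ, IsTest T ψ →
      ∫ z in strip T, (q z.1 z.2 * dt ψ z + Φ z.1 z.2 * dx ψ z) = 0) :
    ∀ᵐ z ∂volume.restrict (strip T), qt z.1 z.2 + Φx z.1 z.2 = 0 := by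
  obtain ⟨M, hM⟩ := hq.bdd
  have hn : LocL1 T (fun t x => -1 * qt t x) := (hq.dt_locL2.const_mul (-1)).locL1
  -- Moving the time derivative onto `q` shows that `-qt` is a weak `x`-derivative of `Φ`. On almost
  -- every slice it must then coincide with `Φx`.
  have hw : HasWeakDx T Φ (fun t x => -1 * qt t x) := by
    refine ⟨hΦ.locallyIntegrableOn, hn.locallyIntegrableOn, fun ψ hψ => ?_⟩
    have h1 := h ψ hψ
    rw [integral_add ((LocL2.of_bdd hq.cont hM).locL1.integrable_mul (continuous_dt hψ.smooth)
      (hasCompactSupport_dt hψ.compact)) (hΦ.integrable_mul (continuous_dx hψ.smooth)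
      (hasCompactSupport_dx hψ.compact)), hq.integral_mul_dt hT hψ] at h1
    simp only [neg_mul, one_mul, integral_neg]
    linarith
  have := ae_strip_of_ae_ae (f := Φx) (g := fun t x => -1 * qt t x) hΦx (hqt.const_mul (-1)) (by
    filter_upwards [hp, (ae_restrict_iff' measurableSet_Ioo).2 (hw.ae_prim hΦ hn)]
      with t ⟨w, hw1, hw2⟩ ⟨w', hw1', hw2'⟩
    have e := eq_of_ae_eq_of_continuous hw2.continuous hw2'.continuous (hw1.symm.trans hw1')
    rw [← e] at hw2'
    exact hw2.ae_eq_of_prim hw2')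
  filter_upwards [this] with z hz
  rw [hz]; ring

/-- The bridge from the distributional formulation to pointwise calculus on `[0, T]`. The derivative
of the density is assembled as that of `ρ - ρbar` plus `ρbar'`. -/
lemma exists_sol {α γ a T₀ ρm ρp : ℝ} {ρbar ρ0 u0 : ℝ → ℝ} {ρ u : ℝ → ℝ → ℝ}
    (hbar : IsReferenceDensity ρm ρp ρbar)
    (hsol : IsStrongSolution α γ a T₀ ρbar ρ0 u0 ρ u) {T : ℝ} (hT : T ∈ Ioo 0 T₀) :
    ∃ ρt ρx ut ux uxx, Sol α γ a T ρbar ρ u ρt ρx ut ux uxx := by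
  have hT0 : 0 < T := hT.1
  have hsub : Icc 0 T ×ˢ (univ : Set ℝ) ⊆ Ico 0 T₀ ×ˢ univ :=
    prod_mono (fun t ht => ⟨ht.1, lt_of_le_of_lt ht.2 hT.2⟩) le_rfl
  have hρc := hsol.density_cont.mono hsub
  have huc := hsol.velocity_cont.mono hsub
  obtain ⟨c, C, hc, hbd⟩ := hsol.density_bounds T hT
  have hline : ∀ {f : ℝ → ℝ → ℝ},
      ContinuousOn (fun z : ℝ × ℝ => f z.1 z.2) (Icc 0 T ×ˢ univ) → ∀ x,
      ContinuousOn (fun t => f t x) (Icc 0 T) := fun hf x =>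
    hf.comp (f := fun t : ℝ => (t, x)) (by fun_prop) fun t ht => ⟨ht, trivial⟩
  have hbd' : ∀ t ∈ Icc 0 T, ∀ x, c ≤ ρ t x ∧ ρ t x ≤ C := by
    intro t ht x
    constructor
    · have := le_of_ae_le (f := fun t => -ρ t x) (M := -c) hT0 (hline hρc x).neg (by
        filter_upwards [ae_restrict_mem measurableSet_Ioo] with s hs
        exact neg_le_neg (hbd s hs x).1) t ht
      linarith
    · exact le_of_ae_le (f := fun t => ρ t x) hT0 (hline hρc x) (by
        filter_upwards [ae_restrict_mem measurableSet_Ioo] with s hs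
        exact (hbd s hs x).2) t ht
  have hρM : ∀ t ∈ Icc 0 T, ∀ x, |ρ t x| ≤ C := fun t ht x => by
    rw [abs_of_pos (lt_of_lt_of_le hc (hbd' t ht x).1)]
    exact (hbd' t ht x).2
  have hdbar : MemLp (deriv ρbar) 2 volume :=
    (continuous_deriv_reference hbar).memLp_of_hasCompactSupport
      (hasCompactSupport_deriv_reference hbar)
  obtain ⟨hρL, dρ, hdρ, hdρL⟩ := hsol.density_H1 T hT
  obtain ⟨ρt, hρt, hρtL⟩ := hsol.density_dt T hT
  obtain ⟨huL, ux', hux', hux'L⟩ := hsol.velocity_H1 T hT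
  obtain ⟨_, ux, uxx, hux, huxx, huxL, huxxL⟩ := hsol.velocity_H2 T hT
  obtain ⟨ut, hut, hutL⟩ := hsol.velocity_dt T hT
  obtain ⟨uxm, huxm, hmom⟩ := hsol.momentum
  have hρL2 := hρL.linfL2
  have hdρL2 := hdρL.linfL2
  have huL2 := huL.linfL2
  -- The `H¹`, `H²` and momentum clauses each provide their own `∂_x u`; all are replaced by the one
  -- from `H²`, which itself has a weak derivative.
  have huxeq : ∀ᵐ z ∂volume.restrict (strip T), ux' z.1 z.2 = ux z.1 z.2 :=
    (ae_restrict_iff' (measurableSet_strip T)).2 (hux'.ae_unique hux)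
  have huxL2 : LinfL2 T ux := hux'L.linfL2.congr huxeq
  have huxmeq : ∀ᵐ z ∂volume.restrict (strip T), uxm z.1 z.2 = ux z.1 z.2 :=
    (ae_restrict_iff' (measurableSet_strip T)).2 ((huxm.mono hT.2.le).ae_unique hux)
  have hρxL2 : LinfL2 T (fun t x => dρ t x + deriv ρbar x) := hdρL2.add (linfL2_of_space hdbar)
  -- absolute continuity on lines
  have hup : ∀ᵐ t ∂volume.restrict (Ioo 0 T), Prim univ (u t) (ux t) := by
    filter_upwards [(ae_restrict_iff' measurableSet_Ioo).2
      (hux.ae_prim huL2.memL2L2.locL2.locL1 huxL.locL2.locL1), ae_restrict_mem measurableSet_Ioo]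
      with t ⟨w, hw, hp⟩ ht
    have := eq_of_ae_eq_of_continuous (slice_continuous huc (Ioo_subset_Icc_self ht))
      hp.continuous hw
    rwa [this]
  have hρp : ∀ᵐ t ∂volume.restrict (Ioo 0 T),
      Prim univ (ρ t) (fun x => dρ t x + deriv ρbar x) := by
    filter_upwards [(ae_restrict_iff' measurableSet_Ioo).2
      (hdρ.ae_prim hρL2.memL2L2.locL2.locL1 hdρL2.memL2L2.locL2.locL1),
      ae_restrict_mem measurableSet_Ioo] with t ⟨w, hw, hp⟩ ht
    have h1 := eq_of_ae_eq_of_continuous ((slice_continuous hρc (Ioo_subset_Icc_self ht)).sub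
      hbar.smooth.continuous) hp.continuous hw
    rw [← h1] at hp
    have h2 : Prim univ ρbar (deriv ρbar) := Prim.of_hasDerivAt
      (fun x _ => (hbar.smooth.differentiable (by norm_num) x).hasDerivAt)
      (continuous_deriv_reference hbar).continuousOn
    exact (hp.add h2).congr_left fun x _ => by simp
  obtain ⟨Mu, hMu⟩ := bounded_of_prim hT0 huc hup huL2 huxL2
  have hρreg : Reg T ρ ρt (fun t x => dρ t x + deriv ρbar x) :=
    ⟨hρc, ⟨C, hρM⟩, hρtL.locL2, hρxL2.memL2L2.locL2,
      hρt.ae_prim hT0 hρc (LocL2.of_bdd hρc hρM).locL1 hρtL.locL2.locL1, hρp⟩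
  have hureg : Reg T u ut ux :=
    ⟨huc, ⟨Mu, hMu⟩, hutL.locL2, huxL.locL2,
      hut.ae_prim hT0 huc huL2.memL2L2.locL2.locL1 hutL.locL2.locL1, hup⟩
  have huxp : ∀ᵐ t ∂volume.restrict (Ioo 0 T), ∃ w, ux t =ᵐ[volume] w ∧ Prim univ w (uxx t) :=
    (ae_restrict_iff' measurableSet_Ioo).2 (huxx.ae_prim huxL.locL2.locL1 huxxL.locL2.locL1)
  have hmul := hρreg.mul hureg
  have hρm := hρreg.meas
  have hum := hureg.meas
  have hρxm := hρxL2.meas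
  have huxm' := huxL2.meas
  have hmass : ∀ᵐ z ∂volume.restrict (strip T),
      ρt z.1 z.2 + u z.1 z.2 * (dρ z.1 z.2 + deriv ρbar z.2) + ρ z.1 z.2 * ux z.1 z.2 = 0 := by
    obtain ⟨Mm, hMm⟩ := hmul.bdd
    have := ae_of_conservation_law hT0 hρreg (LocL2.of_bdd hmul.cont hMm).locL1
      ((hρxm.mul hum).add (hρm.mul huxm')) hρtL.1
      (by filter_upwards [hmul.prim_x] with t ht using ⟨_, ae_eq_refl _, ht⟩) fun ψ hψ => by
        have h1 := hsol.mass ψ (hψ.mono hT.2.le)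
        rwa [setIntegral_strip_eq_of_le hT.2.le fun z hz => by
          rw [dx_eq_zero hψ hz, dt_eq_zero hψ hz]; ring] at h1
    filter_upwards [this] with z hz
    linarith
  have hα := hρreg.rpow hc hbd' α
  have hγ := (hρreg.rpow hc hbd' γ).const_mul a
  have hmuu := hmul.mul hureg
  have hmom' : ∀ᵐ z ∂volume.restrict (strip T),
      ρ z.1 z.2 * (ut z.1 z.2 + u z.1 z.2 * ux z.1 z.2) +
        a * γ * ρ z.1 z.2 ^ (γ - 1) * (dρ z.1 z.2 + deriv ρbar z.2) =
      α * ρ z.1 z.2 ^ (α - 1) * (dρ z.1 z.2 + deriv ρbar z.2) * ux z.1 z.2 +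
        ρ z.1 z.2 ^ α * uxx z.1 z.2 := by
    obtain ⟨M1, hM1⟩ := hmuu.bdd
    obtain ⟨M2, hM2⟩ := hα.bdd
    obtain ⟨M3, hM3⟩ := hγ.bdd
    have hΦ : LocL1 T (fun t x => ρ t x * u t x * u t x + -1 * (ρ t x ^ α * ux t x) +
        a * ρ t x ^ γ) :=
      (((LocL2.of_bdd hmuu.cont hM1).add ((huxL.locL2.bdd_mul hα.cont hM2).const_mul (-1))).add
        (LocL2.of_bdd hγ.cont hM3)).locL1
    have m1 := (hρreg.rpow hc hbd' (α - 1)).meas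
    have m2 := (hρreg.rpow hc hbd' (γ - 1)).meas
    have m3 := hα.meas
    have := ae_of_conservation_law (Φx := fun t x =>
        (((dρ t x + deriv ρbar x) * u t x + ρ t x * ux t x) * u t x + ρ t x * u t x * ux t x) +
        -1 * (α * ρ t x ^ (α - 1) * (dρ t x + deriv ρbar x) * ux t x + ρ t x ^ α * uxx t x) +
        a * (γ * ρ t x ^ (γ - 1) * (dρ t x + deriv ρbar x))) hT0 hmul hΦ
      ((((((hρxm.mul hum).add (hρm.mul huxm')).mul hum).add ((hρm.mul hum).mul huxm')).add
        (((((m1.const_mul α).mul hρxm).mul huxm').add (m3.mul huxxL.1)).const_mul (-1))).add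
        (((m2.const_mul γ).mul hρxm).const_mul a))
      ((hρtL.1.mul hum).add (hρm.mul hutL.1))
      (by
        filter_upwards [hmuu.prim_x, hα.prim_x, hγ.prim_x, huxp] with t p1 p2 p3 ⟨w, hw, p4⟩
        refine ⟨_, ?_, ((p1.add ((p2.mul p4).const_mul (-1))).add p3).congr_right ?_⟩
        · filter_upwards [hw] with x hx
          rw [hx]
        · filter_upwards [hw] with x hx
          rw [hx]) fun ψ hψ => by
        have h1 := hmom ψ (hψ.mono hT.2.le)
        rw [setIntegral_strip_eq_of_le hT.2.le fun z hz => by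
          rw [dx_eq_zero hψ hz, dt_eq_zero hψ hz]; ring] at h1
        rw [← h1]
        refine integral_congr_ae ?_
        filter_upwards [huxmeq] with z hz
        rw [hz]; ring
    filter_upwards [this, hmass] with z hz hz'
    -- Subtracting `u` times the continuity equation gives the nonconservative form of the momentum
    -- equation.
    linear_combination hz - u z.1 z.2 * hz'
  exact ⟨ρt, _, ut, ux, uxx, hT0, hρreg, hureg, ⟨c, C, hc, hbd'⟩, hρL2, hρxL2, huL2, huxL2, hρtL,
    hutL, huxxL, huxp, hmass, hmom'⟩

/-! ### Integrability on the strip -/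

lemma MemL2L2.bdd_mul {T : ℝ} {b bt bx f : ℝ → ℝ → ℝ} (hf : MemL2L2 T f) (hb : Reg T b bt bx) :
    MemL2L2 T (fun t x => b t x * f t x) := by
  obtain ⟨M, hM⟩ := hb.bdd
  refine MemLp.of_le_mul (c := M) hf (hb.meas.mul hf.1) ?_
  filter_upwards [ae_restrict_mem (measurableSet_strip T)] with z hz
  rw [norm_mul]
  gcongr
  exact hM _ (Ioo_subset_Icc_self hz.1) _

lemma MemL2L2.integrableOn_mul {T : ℝ} {f g : ℝ → ℝ → ℝ} (hf : MemL2L2 T f) (hg : MemL2L2 T g) :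
    IntegrableOn (fun z : ℝ × ℝ => f z.1 z.2 * g z.1 z.2) (strip T) :=
  MemLp.integrable_mul hf hg

lemma Reg.integrableOn_mul {T : ℝ} {b bt bx f : ℝ → ℝ → ℝ} (hb : Reg T b bt bx)
    (hf : IntegrableOn (fun z : ℝ × ℝ => f z.1 z.2) (strip T)) :
    IntegrableOn (fun z : ℝ × ℝ => b z.1 z.2 * f z.1 z.2) (strip T) := by
  obtain ⟨M, hM⟩ := hb.bdd
  refine Integrable.bdd_mul (c := M) hf hb.meas ?_
  filter_upwards [ae_restrict_mem (measurableSet_strip T)] with z hz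
  exact hM _ (Ioo_subset_Icc_self hz.1) _

lemma integrable_slice {T : ℝ} {f : ℝ → ℝ → ℝ}
    (hf : IntegrableOn (fun z : ℝ × ℝ => f z.1 z.2) (strip T)) :
    ∀ᵐ t ∂volume.restrict (Ioo 0 T), Integrable (f t) := by
  rw [IntegrableOn, restrict_strip] at hf
  exact hf.prod_right_ae

lemma memLp_slice {T : ℝ} {f : ℝ → ℝ → ℝ} (hf : MemL2L2 T f) :
    ∀ᵐ t ∂volume.restrict (Ioo 0 T), MemLp (f t) 2 volume := by
  have h1 := integrable_slice (f := fun t x => f t x ^ 2) hf.integrable_sq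
  have hm := hf.1
  rw [restrict_strip] at hm
  filter_upwards [h1, hm.prodMk_left] with t h2 h3
  exact (memLp_two_iff_integrable_sq h3).2 h2

lemma integrableOn_integral_slice {T : ℝ} {f : ℝ → ℝ → ℝ}
    (hf : IntegrableOn (fun z : ℝ × ℝ => f z.1 z.2) (strip T)) :
    IntegrableOn (fun t => ∫ x, f t x) (Ioo 0 T) := by
  rw [IntegrableOn, restrict_strip] at hf
  exact hf.integral_prod_left

lemma integral_strip_eq {T : ℝ} {f : ℝ → ℝ → ℝ}
    (hf : IntegrableOn (fun z : ℝ × ℝ => f z.1 z.2) (strip T)) :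
    ∫ z in strip T, f z.1 z.2 = ∫ t in Ioo 0 T, ∫ x, f t x := by
  rw [IntegrableOn, restrict_strip] at hf
  rw [restrict_strip, integral_prod _ hf]

lemma integral_strip_congr {T t : ℝ} (htT : t ≤ T) {f g : ℝ → ℝ → ℝ}
    (hf : IntegrableOn (fun z : ℝ × ℝ => f z.1 z.2) (strip T))
    (hg : IntegrableOn (fun z : ℝ × ℝ => g z.1 z.2) (strip T))
    (h : ∀ᵐ t ∂volume.restrict (Ioo 0 T), ∫ x, f t x = ∫ x, g t x) :
    ∫ z in strip t, f z.1 z.2 = ∫ z in strip t, g z.1 z.2 := by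
  rw [integral_strip_eq (hf.mono_set (strip_mono htT)),
    integral_strip_eq (hg.mono_set (strip_mono htT))]
  exact integral_congr_ae (ae_restrict_of_ae_restrict_of_subset (Ioo_subset_Ioo_right htT) h)

lemma prim_integral_slice {T : ℝ} {f : ℝ → ℝ → ℝ} (c : ℝ)
    (hf : IntegrableOn (fun z : ℝ × ℝ => f z.1 z.2) (strip T)) :
    Prim (Icc 0 T) (fun t => c + ∫ z in strip t, f z.1 z.2) (fun t => ∫ x, f t x) := by
  have h0 := integrableOn_integral_slice hf
  have hii : ∀ a ∈ Icc 0 T, ∀ b ∈ Icc 0 T,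
      IntervalIntegrable (fun t => ∫ x, f t x) volume a b := by
    intro a ha b hb
    rw [intervalIntegrable_iff]
    have : IntegrableOn (fun t => ∫ x, f t x) (Icc 0 T) := by
      rwa [integrableOn_Icc_iff_integrableOn_Ioo]
    exact this.mono_set (uIoc_subset_uIcc.trans (ordConnected_Icc.uIcc_subset ha hb))
  have e : ∀ t ∈ Icc 0 T, ∫ z in strip t, f z.1 z.2 = ∫ s in (0 : ℝ)..t, ∫ x, f s x := by
    intro t ht
    rw [integral_strip_eq (hf.mono_set (strip_mono ht.2)), intervalIntegral.integral_of_le ht.1,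
      integral_Ioc_eq_integral_Ioo]
  intro a ha b hb
  refine ⟨hii a ha b hb, ?_⟩
  have hT : (0 : ℝ) ∈ Icc 0 T := ⟨le_rfl, ha.1.trans ha.2⟩
  simp only
  rw [e a ha, e b hb,
    ← intervalIntegral.integral_interval_sub_left (hii 0 hT b hb) (hii 0 hT a ha)]
  ring

/-! ### Gronwall's inequality -/

/-- The function `e^(-Ct) (1 + Y)` is absolutely continuous with nonpositive derivative almost
everywhere, so it does not exceed its initial value. -/
lemma Prim.gronwall {T C : ℝ} {Y g : ℝ → ℝ} (h : Prim (Icc 0 T) Y g)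
    (hg : ∀ᵐ t ∂volume.restrict (Ioo 0 T), g t ≤ C * (1 + Y t)) :
    ∀ t ∈ Icc 0 T, 1 + Y t ≤ (1 + Y 0) * Real.exp (C * t) := by
  intro t ht
  have h0 : (0 : ℝ) ∈ Icc 0 T := ⟨le_rfl, ht.1.trans ht.2⟩
  have he : Prim (Icc 0 T) (fun t => Real.exp (-C * t)) (fun t => Real.exp (-C * t) * -C) := by
    refine Prim.of_hasDerivAt (fun s _ => ?_) (by fun_prop)
    simpa using ((hasDerivAt_id s).const_mul (-C)).exp
  have h1 := (he.mul ((Prim.const (Icc 0 T) 1).add h)) 0 h0 t ht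
  have h2 : ∫ x in (0 : ℝ)..t, (Real.exp (-C * x) * -C * (1 + Y x) +
      Real.exp (-C * x) * (0 + g x)) ≤ 0 := by
    rw [intervalIntegral.integral_of_le ht.1, integral_Ioc_eq_integral_Ioo]
    refine integral_nonpos_of_ae ?_
    filter_upwards [ae_restrict_of_ae_restrict_of_subset (Ioo_subset_Ioo_right ht.2) hg] with s hs
    have := Real.exp_pos (-C * s)
    simp only [Pi.zero_apply]
    nlinarith
  rw [h1.2] at h2
  simp only [mul_zero, Real.exp_zero, one_mul] at h2
  have h3 : Real.exp (-C * t) * Real.exp (C * t) = 1 := by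
    rw [← Real.exp_add]; simp
  have h4 := Real.exp_pos (C * t)
  calc 1 + Y t = (Real.exp (-C * t) * (1 + Y t)) * Real.exp (C * t) := by
        linear_combination (-(1 + Y t)) * h3
    _ ≤ _ := by gcongr; linarith

/-! ### The relative potential energy -/

/-- The potential energy of the density `r` relative to the reference density `s`. -/
def relEnergy (a γ r s : ℝ) : ℝ := a / (γ - 1) * (r ^ γ - s ^ γ - γ * s ^ (γ - 1) * (r - s))

/-- Convexity of `r ↦ r^γ`, in the form of Bernoulli's inequality for `r / s`. -/
lemma rpow_tangent {γ r s : ℝ} (hγ : 1 < γ) (hr : 0 < r) (hs : 0 < s) :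
    s ^ γ + γ * s ^ (γ - 1) * (r - s) ≤ r ^ γ := by
  have h := one_add_mul_self_le_rpow_one_add (s := r / s - 1) (by
    have := div_pos hr hs; linarith) hγ.le
  have h1 : (1 + (r / s - 1)) ^ γ = r ^ γ / s ^ γ := by
    rw [add_sub_cancel, Real.div_rpow hr.le hs.le]
  have hsγ := Real.rpow_pos_of_pos hs γ
  rw [h1, le_div_iff₀ hsγ] at h
  rw [Real.rpow_sub_one hs.ne']
  calc _ = (1 + γ * (r / s - 1)) * s ^ γ := by field_simp
    _ ≤ _ := h

lemma relEnergy_nonneg {a γ r s : ℝ} (ha : 0 < a) (hγ : 1 < γ) (hr : 0 < r) (hs : 0 < s) :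
    0 ≤ relEnergy a γ r s := by
  have := rpow_tangent hγ hr hs
  have h1 : 0 < γ - 1 := by linarith
  rw [relEnergy]
  exact mul_nonneg (by positivity) (by linarith)

/-- Linear growth comes from comparing the tangent of `r^γ` at `2s` with the one at `s`: their
slopes differ by `γ ((2s)^(γ-1) - s^(γ-1))`, which is bounded below by `d > 0` for `s ≥ m`. -/
lemma relEnergy_coercive {a γ m M : ℝ} (ha : 0 < a) (hγ : 1 < γ) (hm : 0 < m) :
    ∃ C : ℝ, 0 < C ∧ ∀ r s, 0 < r → m ≤ s → s ≤ M → r ≤ C * (1 + relEnergy a γ r s) := by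
  have h1 : 0 < γ - 1 := by linarith
  have h2 : 1 < (2 : ℝ) ^ (γ - 1) := Real.one_lt_rpow one_lt_two h1
  set d := γ * (m ^ (γ - 1) * (2 ^ (γ - 1) - 1)) with hd
  have hmp := Real.rpow_pos_of_pos hm (γ - 1)
  have hd0 : 0 < d := by
    have : 0 < (2 : ℝ) ^ (γ - 1) - 1 := by linarith
    positivity
  set N := (γ - 1) * (2 * |M|) ^ γ with hN
  have hN0 : 0 ≤ N := by positivity
  -- The tangent comparison yields `d r ≤ ((γ - 1) / a) · relEnergy + N`, and both terms are
  -- absorbed into a multiple of `1 + relEnergy`.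
  refine ⟨((γ - 1) / a + N + 1) / d, by positivity, fun r s hr hms hsM => ?_⟩
  have hs : 0 < s := lt_of_lt_of_le hm hms
  have hM : 0 < M := lt_of_lt_of_le hs hsM
  have ht := rpow_tangent hγ hr (mul_pos two_pos hs)
  have hR := relEnergy_nonneg ha hγ hr hs
  have e1 : relEnergy a γ r s * ((γ - 1) / a) =
      r ^ γ - s ^ γ - γ * s ^ (γ - 1) * (r - s) := by
    rw [relEnergy]; field_simp
  have e2 : (2 * s) ^ γ = (2 * s) ^ (γ - 1) * (2 * s) := by
    rw [← Real.rpow_add_one (by positivity)]; ring_nf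
  have e3 : s ^ γ = s ^ (γ - 1) * s := by
    rw [← Real.rpow_add_one (by positivity)]; ring_nf
  have e4 : (2 * s) ^ (γ - 1) = 2 ^ (γ - 1) * s ^ (γ - 1) := Real.mul_rpow zero_le_two hs.le
  have h5 : (2 * s) ^ γ ≤ (2 * |M|) ^ γ := by
    rw [abs_of_pos hM]
    gcongr
  have h6 : m ^ (γ - 1) ≤ s ^ (γ - 1) := Real.rpow_le_rpow hm.le hms h1.le
  have h7 : d * r ≤ γ * ((2 * s) ^ (γ - 1) - s ^ (γ - 1)) * r := by
    rw [hd, e4]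
    have : m ^ (γ - 1) * (2 ^ (γ - 1) - 1) ≤ s ^ (γ - 1) * (2 ^ (γ - 1) - 1) :=
      mul_le_mul_of_nonneg_right h6 (by linarith)
    have h8 : γ * (m ^ (γ - 1) * (2 ^ (γ - 1) - 1)) * r ≤
        γ * (s ^ (γ - 1) * (2 ^ (γ - 1) - 1)) * r := by gcongr
    linarith
  have h9 : γ * ((2 * s) ^ (γ - 1) - s ^ (γ - 1)) * r ≤
      relEnergy a γ r s * ((γ - 1) / a) + (γ - 1) * (2 * s) ^ γ := by
    have h10 : 0 ≤ (γ - 1) * s ^ γ := mul_nonneg h1.le (Real.rpow_nonneg hs.le _)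
    rw [e1]
    rw [e3] at h10 ⊢
    rw [e2] at ht ⊢
    nlinarith
  rw [div_mul_eq_mul_div, le_div_iff₀ hd0]
  have h11 : (γ - 1) * (2 * s) ^ γ ≤ N := by rw [hN]; gcongr
  have h12 : 0 < (γ - 1) / a := by positivity
  nlinarith

/-- The tangent inequality at `r` bounds the bracket by `γ (r^(γ-1) - s^(γ-1)) (r - s)`, and
`y^(γ-1)` is Lipschitz on `[c, C]`. It makes the relative energy integrable when `ρ - ρbar` is in
`L²`. -/
lemma relEnergy_le_sq {a γ c C : ℝ} (ha : 0 < a) (hγ : 1 < γ) (hc : 0 < c) :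
    ∃ L : ℝ, 0 ≤ L ∧ ∀ r ∈ Icc c C, ∀ s ∈ Icc c C, relEnergy a γ r s ≤ L * (r - s) ^ 2 := by
  have h1 : 0 < γ - 1 := by linarith
  have hlip : ∃ K : ℝ≥0, LipschitzOnWith K (fun y : ℝ => y ^ (γ - 1)) (Icc c C) := by
    obtain ⟨K, hK⟩ := isCompact_Icc.exists_bound_of_continuousOn (s := Icc c C)
      (f := fun y : ℝ => (γ - 1) * y ^ (γ - 1 - 1)) (continuousOn_const.mul (rpow_continuousOn hc))
    refine ⟨K.toNNReal, (convex_Icc c C).lipschitzOnWith_of_nnnorm_hasDerivWithin_le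
      (fun y hy => (rpow_hasDerivAt_of_mem hc y hy).hasDerivWithinAt) fun y hy => ?_⟩
    rw [← NNReal.coe_le_coe, coe_nnnorm]
    exact (hK y hy).trans (Real.le_coe_toNNReal K)
  obtain ⟨K, hK⟩ := hlip
  refine ⟨a / (γ - 1) * (γ * K), by positivity, fun r hr s hs => ?_⟩
  have hr0 : 0 < r := lt_of_lt_of_le hc hr.1
  have hs0 : 0 < s := lt_of_lt_of_le hc hs.1
  have ht := rpow_tangent hγ hs0 hr0
  have h2 : (r ^ (γ - 1) - s ^ (γ - 1)) * (r - s) ≤ K * (r - s) ^ 2 := by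
    have := hK.dist_le_mul r hr s hs
    rw [Real.dist_eq, Real.dist_eq] at this
    calc _ ≤ |r ^ (γ - 1) - s ^ (γ - 1)| * |r - s| := by rw [← abs_mul]; exact le_abs_self _
      _ ≤ K * |r - s| * |r - s| := by gcongr
      _ = K * (r - s) ^ 2 := by rw [mul_assoc, ← sq, sq_abs]
  have h3 := mul_le_mul_of_nonneg_left h2 (by linarith : (0 : ℝ) ≤ γ)
  have h4 : r ^ γ - s ^ γ - γ * s ^ (γ - 1) * (r - s) ≤ γ * K * (r - s) ^ 2 := by linarith
  calc relEnergy a γ r s ≤ a / (γ - 1) * (γ * K * (r - s) ^ 2) := by rw [relEnergy]; gcongr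
    _ = _ := by ring

/-! ### Transport along the flow -/

namespace Sol

variable {α γ a T : ℝ} {ρbar : ℝ → ℝ} {ρ u ρt ρx ut ux uxx : ℝ → ℝ → ℝ}

/-- By the continuity equation `(ρ f)_t + (ρ u f)_x = ρ (f_t + u f_x)`, so this is
`integral_balance` with density `ρ f` and flux `ρ u f`. -/
lemma transport (h : Sol α γ a T ρbar ρ u ρt ρx ut ux uxx) {f ft fx : ℝ → ℝ → ℝ}
    (hf : Reg T f ft fx)
    (hB : IntegrableOn (fun z : ℝ × ℝ => ρ z.1 z.2 * u z.1 z.2 * f z.1 z.2) (strip T))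
    (hS : IntegrableOn
      (fun z : ℝ × ℝ => ρ z.1 z.2 * (ft z.1 z.2 + u z.1 z.2 * fx z.1 z.2)) (strip T))
    (h0 : Integrable (fun x => ρ 0 x * f 0 x)) {t : ℝ} (ht : t ∈ Icc 0 T)
    (hAt : Integrable (fun x => ρ t x * f t x)) :
    (∫ x, ρ t x * f t x) - ∫ x, ρ 0 x * f 0 x =
      ∫ z in strip t, ρ z.1 z.2 * (ft z.1 z.2 + u z.1 z.2 * fx z.1 z.2) := by
  refine integral_balance (S := fun t x => ρ t x * (ft t x + u t x * fx t x)) (h.rho_reg.mul hf)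
    ((h.rho_reg.mul h.u_reg).mul hf) hB hS ?_ h0 ht hAt
  filter_upwards [h.mass] with z hz
  linear_combination f z.1 z.2 * hz

end Sol

lemma Reg.pow {T : ℝ} {f ft fx : ℝ → ℝ → ℝ} (h : Reg T f ft fx) (n : ℕ) :
    Reg T (fun t x => f t x ^ (n + 1)) (fun t x => (n + 1) * f t x ^ n * ft t x)
      (fun t x => (n + 1) * f t x ^ n * fx t x) := by
  obtain ⟨M, hM⟩ := h.bdd
  refine h.comp (G := fun y => y ^ (n + 1)) (G' := fun y => (n + 1) * y ^ n)
    (isCompact_Icc (a := -M) (b := M)) (fun t ht x => abs_le.1 (hM t ht x)) (fun y _ => ?_)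
    (by fun_prop)
  simpa using hasDerivAt_pow (n + 1) y

lemma Reg.const (T c : ℝ) : Reg T (fun _ _ => c) (fun _ _ => 0) (fun _ _ => 0) := by
  simpa using Reg.of_space (b := fun _ => c) contDiff_const (M := |c|) (by simp) T

/-- Pure powers including the zeroth. -/
lemma Reg.exists_pow {T : ℝ} {f ft fx : ℝ → ℝ → ℝ} (h : Reg T f ft fx) (n : ℕ) :
    ∃ gt gx, Reg T (fun t x => f t x ^ n) gt gx := by
  cases n with
  | zero => exact ⟨_, _, by simpa using Reg.const T 1⟩
  | succ n => exact ⟨_, _, h.pow n⟩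

lemma Reg.prim_mul_slice {T : ℝ} {f ft fx w wx : ℝ → ℝ → ℝ} (h : Reg T f ft fx)
    (hw : ∀ᵐ t ∂volume.restrict (Ioo 0 T), ∃ v, w t =ᵐ[volume] v ∧ Prim univ v (wx t)) :
    ∀ᵐ t ∂volume.restrict (Ioo 0 T), ∃ v, (fun x => f t x * w t x) =ᵐ[volume] v ∧
      Prim univ v (fun x => fx t x * w t x + f t x * wx t x) := by
  filter_upwards [h.prim_x, hw] with t h1 ⟨v, hv, h2⟩
  refine ⟨_, ?_, (h1.mul h2).congr_right ?_⟩
  · filter_upwards [hv] with x hx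
    rw [hx]
  · filter_upwards [hv] with x hx
    rw [hx]

lemma integral_slice_eq_zero {T : ℝ} {K Kx : ℝ → ℝ → ℝ}
    (h : ∀ᵐ t ∂volume.restrict (Ioo 0 T), ∃ v, K t =ᵐ[volume] v ∧ Prim univ v (Kx t))
    (hK : IntegrableOn (fun z : ℝ × ℝ => K z.1 z.2) (strip T))
    (hKx : IntegrableOn (fun z : ℝ × ℝ => Kx z.1 z.2) (strip T)) :
    ∀ᵐ t ∂volume.restrict (Ioo 0 T), ∫ x, Kx t x = 0 := by
  filter_upwards [h, integrable_slice hK, integrable_slice hKx] with t ⟨v, hv, hp⟩ h1 h2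
  exact hp.integral_eq_zero (h1.congr hv) h2

/-- If `F = K_x + G` with `K` integrable, then `F` and `G` have the same integral. -/
lemma integral_strip_eq_of_divergence {T t : ℝ} (ht : t ≤ T) {F G K Kx : ℝ → ℝ → ℝ}
    (h : ∀ᵐ t ∂volume.restrict (Ioo 0 T), ∃ v, K t =ᵐ[volume] v ∧ Prim univ v (Kx t))
    (hK : IntegrableOn (fun z : ℝ × ℝ => K z.1 z.2) (strip T))
    (hKx : IntegrableOn (fun z : ℝ × ℝ => Kx z.1 z.2) (strip T))
    (hG : IntegrableOn (fun z : ℝ × ℝ => G z.1 z.2) (strip T))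
    (hF : ∀ᵐ z ∂volume.restrict (strip T), F z.1 z.2 = Kx z.1 z.2 + G z.1 z.2) :
    IntegrableOn (fun z : ℝ × ℝ => F z.1 z.2) (strip T) ∧
      ∫ z in strip t, F z.1 z.2 = ∫ z in strip t, G z.1 z.2 := by
  have hFi : IntegrableOn (fun z : ℝ × ℝ => F z.1 z.2) (strip T) :=
    (hKx.add hG).congr (by filter_upwards [hF] with z hz using hz.symm)
  refine ⟨hFi, integral_strip_congr ht hFi hG ?_⟩
  filter_upwards [integral_slice_eq_zero h hK hKx, integrable_slice hKx, integrable_slice hG,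
    ae_ae_of_ae_strip hF] with s h1 h2 h3 h4
  rw [integral_congr_ae h4]
  rw [integral_add h2 h3, h1, zero_add]

/-! ### Balance of the moments of the velocity -/

namespace Sol

variable {α γ a T : ℝ} {ρbar : ℝ → ℝ} {ρ u ρt ρx ut ux uxx : ℝ → ℝ → ℝ}

lemma exists_reg_rpow (h : Sol α γ a T ρbar ρ u ρt ρx ut ux uxx) (p : ℝ) :
    Reg T (fun t x => ρ t x ^ p) (fun t x => p * ρ t x ^ (p - 1) * ρt t x)
      (fun t x => p * ρ t x ^ (p - 1) * ρx t x) := by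
  obtain ⟨c, C, hc, hb⟩ := h.rho_bounds
  exact h.rho_reg.rpow hc hb p

lemma rho_pos (h : Sol α γ a T ρbar ρ u ρt ρx ut ux uxx) {t : ℝ} (ht : t ∈ Icc 0 T) (x : ℝ) :
    0 < ρ t x := by
  obtain ⟨c, C, hc, hb⟩ := h.rho_bounds
  exact lt_of_lt_of_le hc (hb t ht x).1

/-- Two factors `u` supply integrability through `L²`; all remaining factors are bounded. The
neighbouring integrability lemmas follow the same pattern. -/
lemma integrable_pow_mul (h : Sol α γ a T ρbar ρ u ρt ρx ut ux uxx) (k : ℕ) :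
    IntegrableOn (fun z : ℝ × ℝ => ρ z.1 z.2 * u z.1 z.2 ^ (k + 2)) (strip T) := by
  obtain ⟨_, _, hk⟩ := h.u_reg.exists_pow k
  have := (h.rho_reg.mul hk).integrableOn_mul (f := fun t x => u t x * u t x)
    (h.u_L2.memL2L2.integrableOn_mul h.u_L2.memL2L2)
  refine this.congr (.of_forall fun z => ?_)
  ring

lemma integrable_dissipation (h : Sol α γ a T ρbar ρ u ρt ρx ut ux uxx) (k : ℕ) :
    IntegrableOn (fun z : ℝ × ℝ => u z.1 z.2 ^ k * (ρ z.1 z.2 ^ α * ux z.1 z.2 ^ 2))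
      (strip T) := by
  obtain ⟨_, _, hk⟩ := h.u_reg.exists_pow k
  have := (hk.mul (h.exists_reg_rpow α)).integrableOn_mul (f := fun t x => ux t x * ux t x)
    (h.ux_L2.memL2L2.integrableOn_mul h.ux_L2.memL2L2)
  refine this.congr (.of_forall fun z => ?_)
  ring

lemma integrable_pressure_work (h : Sol α γ a T ρbar ρ u ρt ρx ut ux uxx) (k : ℕ) :
    IntegrableOn (fun z : ℝ × ℝ => u z.1 z.2 ^ (k + 1) *
      (a * γ * ρ z.1 z.2 ^ (γ - 1) * ρx z.1 z.2)) (strip T) := by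
  obtain ⟨_, _, hk⟩ := h.u_reg.exists_pow k
  have := (hk.mul ((h.exists_reg_rpow (γ - 1)).const_mul (a * γ))).integrableOn_mul
    (f := fun t x => u t x * ρx t x)
    (h.u_L2.memL2L2.integrableOn_mul h.rhox_L2.memL2L2)
  refine this.congr (.of_forall fun z => ?_)
  ring

/-- Balance of `∫ ρ u^(k+2) / (k+2)`. -/
lemma velocity_moment (h : Sol α γ a T ρbar ρ u ρt ρx ut ux uxx) (k : ℕ)
    (h0 : Integrable (fun x => ρ 0 x * u 0 x ^ (k + 2))) :
    ∀ᵐ t ∂volume.restrict (Ioo 0 T), Integrable (fun x => ρ t x * u t x ^ (k + 2)) ∧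
      (∫ x, ρ t x * u t x ^ (k + 2)) - ∫ x, ρ 0 x * u 0 x ^ (k + 2) =
      -((k + 2) * (k + 1) *
        ∫ z in strip t, u z.1 z.2 ^ k * (ρ z.1 z.2 ^ α * ux z.1 z.2 ^ 2)) -
      (k + 2) * ∫ z in strip t, u z.1 z.2 ^ (k + 1) *
        (a * γ * ρ z.1 z.2 ^ (γ - 1) * ρx z.1 z.2) := by
  obtain ⟨_, _, hk⟩ := h.u_reg.exists_pow k
  have hα := h.exists_reg_rpow α
  have hα1 := h.exists_reg_rpow (α - 1)
  have hD := h.integrable_dissipation k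
  have hP := h.integrable_pressure_work k
  have huxL := h.ux_L2.memL2L2
  have huL := h.u_L2.memL2L2
  have hflux : IntegrableOn (fun z : ℝ × ℝ => ρ z.1 z.2 * u z.1 z.2 * u z.1 z.2 ^ (k + 1 + 1))
      (strip T) := by
    refine (h.integrable_pow_mul (k + 1)).congr (.of_forall fun z => ?_)
    ring
  have hK : IntegrableOn (fun z : ℝ × ℝ => u z.1 z.2 ^ (k + 1) * ρ z.1 z.2 ^ α * ux z.1 z.2)
      (strip T) := by
    refine ((hk.mul hα).integrableOn_mul (f := fun t x => u t x * ux t x)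
      (huL.integrableOn_mul huxL)).congr (.of_forall fun z => ?_)
    ring
  have hKx : IntegrableOn (fun z : ℝ × ℝ =>
      ((k + 1) * u z.1 z.2 ^ k * ux z.1 z.2 * ρ z.1 z.2 ^ α +
        u z.1 z.2 ^ (k + 1) * (α * ρ z.1 z.2 ^ (α - 1) * ρx z.1 z.2)) * ux z.1 z.2 +
        u z.1 z.2 ^ (k + 1) * ρ z.1 z.2 ^ α * uxx z.1 z.2) (strip T) := by
    have h1 := ((h.u_reg.pow k).mul (hα1.const_mul α)).integrableOn_mul
      (f := fun t x => ρx t x * ux t x) (h.rhox_L2.memL2L2.integrableOn_mul huxL)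
    have h2 := (hk.mul hα).integrableOn_mul
      (f := fun t x => u t x * uxx t x) (huL.integrableOn_mul h.uxx_L2)
    refine (((hD.const_mul ((k : ℝ) + 1)).add h1).add h2).congr (.of_forall fun z => ?_)
    simp only [Pi.add_apply]
    ring
  have hprim := ((h.u_reg.pow k).mul hα).prim_mul_slice h.ux_prim
  have hG : IntegrableOn (fun z : ℝ × ℝ =>
      -((k + 1) * (u z.1 z.2 ^ k * (ρ z.1 z.2 ^ α * ux z.1 z.2 ^ 2))) -
      u z.1 z.2 ^ (k + 1) * (a * γ * ρ z.1 z.2 ^ (γ - 1) * ρx z.1 z.2)) (strip T) :=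
    (hD.const_mul ((k : ℝ) + 1)).neg.sub hP
  -- The momentum equation times `u^(k+1)`: the viscous term splits into the exact derivative of
  -- `u^(k+1) ρ^α u_x` and the dissipation `-(k+1) u^k ρ^α u_x²`.
  have hF : ∀ᵐ z ∂volume.restrict (strip T),
      u z.1 z.2 ^ (k + 1) * (ρ z.1 z.2 * (ut z.1 z.2 + u z.1 z.2 * ux z.1 z.2)) =
      (((k + 1) * u z.1 z.2 ^ k * ux z.1 z.2 * ρ z.1 z.2 ^ α +
        u z.1 z.2 ^ (k + 1) * (α * ρ z.1 z.2 ^ (α - 1) * ρx z.1 z.2)) * ux z.1 z.2 +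
        u z.1 z.2 ^ (k + 1) * ρ z.1 z.2 ^ α * uxx z.1 z.2) +
      (-((k + 1) * (u z.1 z.2 ^ k * (ρ z.1 z.2 ^ α * ux z.1 z.2 ^ 2))) -
        u z.1 z.2 ^ (k + 1) * (a * γ * ρ z.1 z.2 ^ (γ - 1) * ρx z.1 z.2)) := by
    filter_upwards [h.momentum] with z hz
    linear_combination u z.1 z.2 ^ (k + 1) * hz
  filter_upwards [integrable_slice (f := fun t x => ρ t x * u t x ^ (k + 2))
    (h.integrable_pow_mul k), ae_restrict_mem measurableSet_Ioo] with t hInt ht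
  refine ⟨hInt, ?_⟩
  obtain ⟨hFi, hFe⟩ := integral_strip_eq_of_divergence
    (F := fun t x => u t x ^ (k + 1) * (ρ t x * (ut t x + u t x * ux t x)))
    (G := fun t x => -((k + 1) * (u t x ^ k * (ρ t x ^ α * ux t x ^ 2))) -
      u t x ^ (k + 1) * (a * γ * ρ t x ^ (γ - 1) * ρx t x)) ht.2.le hprim hK hKx hG hF
  have hk2 : ((k : ℝ) + 2) ≠ 0 := by positivity
  -- Transport of `f = u^(k+2)`; its material derivative is `k + 2` times `u^(k+1)` times that of
  -- `u`.
  have htr := h.transport (h.u_reg.pow (k + 1)) hflux (by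
    refine (hFi.const_mul ((k : ℝ) + 2)).congr (.of_forall fun z => ?_)
    push_cast
    ring) h0 (Ioo_subset_Icc_self ht) hInt
  rw [htr]
  have e1 : ∫ z in strip t, ρ z.1 z.2 * ((((k + 1 : ℕ) : ℝ) + 1) * u z.1 z.2 ^ (k + 1) *
      ut z.1 z.2 + u z.1 z.2 * ((((k + 1 : ℕ) : ℝ) + 1) * u z.1 z.2 ^ (k + 1) * ux z.1 z.2)) =
      (k + 2) * ∫ z in strip t, u z.1 z.2 ^ (k + 1) *
        (ρ z.1 z.2 * (ut z.1 z.2 + u z.1 z.2 * ux z.1 z.2)) := by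
    rw [← integral_const_mul]
    refine integral_congr_ae (.of_forall fun z => ?_)
    push_cast
    ring
  have hDt := hD.mono_set (strip_mono ht.2.le)
  have hPt := hP.mono_set (strip_mono ht.2.le)
  have e2 := integral_sub (hDt.const_mul ((k : ℝ) + 1)).neg hPt
  simp only [Pi.neg_apply] at e2
  rw [e1, hFe, e2, integral_neg, integral_const_mul]
  ring

end Sol

/-! ### Energy estimate -/

section Reference

variable {ρm ρp : ℝ} {ρbar : ℝ → ℝ}

lemma reference_pos (h : IsReferenceDensity ρm ρp ρbar) (x : ℝ) : 0 < ρbar x :=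
  lt_of_lt_of_le (lt_min h.left_pos h.right_pos) (reference_bounds h x).1

lemma reference_rpow_contDiff (h : IsReferenceDensity ρm ρp ρbar) (c p : ℝ) :
    ContDiff ℝ ∞ (fun x => c * ρbar x ^ p) :=
  contDiff_const.mul (h.smooth.rpow_const_of_ne fun x => (reference_pos h x).ne')

lemma reference_rpow_deriv (h : IsReferenceDensity ρm ρp ρbar) (c p x : ℝ) :
    deriv (fun x => c * ρbar x ^ p) x = c * (deriv ρbar x * p * ρbar x ^ (p - 1)) := by
  have h1 := (h.smooth.differentiable (by norm_num) x).hasDerivAt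
  exact ((h1.rpow_const (Or.inl (reference_pos h x).ne')).const_mul c).deriv

lemma reference_rpow_bounded (h : IsReferenceDensity ρm ρp ρbar) (c p : ℝ) :
    ∃ M, ∀ x, |c * ρbar x ^ p| ≤ M := by
  obtain ⟨M, hM⟩ := isCompact_Icc.exists_bound_of_continuousOn
    (s := Icc (min ρm ρp) (max ρm ρp)) (f := fun y => c * y ^ p)
    (continuousOn_const.mul (rpow_continuousOn (lt_min h.left_pos h.right_pos)))
  exact ⟨M, fun x => hM _ (reference_bounds h x)⟩

lemma reference_rpow_deriv_memLp (h : IsReferenceDensity ρm ρp ρbar) (c p : ℝ) :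
    MemLp (deriv fun x => c * ρbar x ^ p) 2 volume := by
  refine ((reference_rpow_contDiff h c p).continuous_deriv (by norm_cast)).memLp_of_hasCompactSupport
    (HasCompactSupport.intro isCompact_Icc (K := Icc (-1) 1) fun x hx => ?_)
  rw [reference_rpow_deriv h, deriv_eq_zero_of_reference h hx]
  ring

end Reference

lemma lipschitz_rpow {c C : ℝ} (hc : 0 < c) (p : ℝ) :
    ∃ L : ℝ, 0 ≤ L ∧ ∀ r ∈ Icc c C, ∀ s ∈ Icc c C, |r ^ p - s ^ p| ≤ L * |r - s| := by
  obtain ⟨K, hK⟩ := isCompact_Icc.exists_bound_of_continuousOn (s := Icc c C)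
    (f := fun y : ℝ => p * y ^ (p - 1)) (continuousOn_const.mul (rpow_continuousOn hc))
  refine ⟨|K|, abs_nonneg _, fun r hr s hs => ?_⟩
  have := (convex_Icc c C).norm_image_sub_le_of_norm_hasDerivWithin_le (C := |K|)
    (fun y hy => (rpow_hasDerivAt_of_mem (p := p) hc y hy).hasDerivWithinAt)
    (fun y hy => (hK y hy).trans (le_abs_self K)) hs hr
  simpa using this

namespace Sol

variable {α γ a T ρm ρp : ℝ} {ρbar : ℝ → ℝ} {ρ u ρt ρx ut ux uxx : ℝ → ℝ → ℝ}

/-- Common bounds for the density and the reference density. -/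
lemma common_bounds (h : Sol α γ a T ρbar ρ u ρt ρx ut ux uxx)
    (hbar : IsReferenceDensity ρm ρp ρbar) :
    ∃ c C : ℝ, 0 < c ∧ (∀ t ∈ Icc 0 T, ∀ x, ρ t x ∈ Icc c C) ∧ ∀ x, ρbar x ∈ Icc c C := by
  obtain ⟨c, C, hc, hb⟩ := h.rho_bounds
  refine ⟨min c (min ρm ρp), max C (max ρm ρp), lt_min hc (lt_min hbar.left_pos hbar.right_pos),
    fun t ht x => ⟨(min_le_left _ _).trans (hb t ht x).1, (hb t ht x).2.trans (le_max_left _ _)⟩,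
    fun x => ⟨(min_le_right _ _).trans (reference_bounds hbar x).1,
      (reference_bounds hbar x).2.trans (le_max_right _ _)⟩⟩

lemma reg_reference_rpow (hbar : IsReferenceDensity ρm ρp ρbar) (T c p : ℝ) :
    Reg T (fun _ x => c * ρbar x ^ p) (fun _ _ => 0)
      (fun _ x => deriv (fun x => c * ρbar x ^ p) x) := by
  obtain ⟨M, hM⟩ := reference_rpow_bounded hbar c p
  exact Reg.of_space (reference_rpow_contDiff hbar c p) hM T

lemma rpow_sub_L2 (h : Sol α γ a T ρbar ρ u ρt ρx ut ux uxx)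
    (hbar : IsReferenceDensity ρm ρp ρbar) (p : ℝ) :
    MemL2L2 T (fun t x => ρ t x ^ p - 1 * ρbar x ^ p) := by
  obtain ⟨c, C, hc, hb, hb'⟩ := h.common_bounds hbar
  obtain ⟨L, _, hL⟩ := lipschitz_rpow (C := C) hc p
  refine MemLp.of_le_mul (c := L) h.rho_L2.memL2L2
    ((h.exists_reg_rpow p).meas.sub (reg_reference_rpow hbar T 1 p).meas) ?_
  filter_upwards [ae_restrict_mem (measurableSet_strip T)] with z hz
  rw [one_mul]
  exact hL _ (hb _ (Ioo_subset_Icc_self hz.1) _) _ (hb' _)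

lemma integrable_relEnergy_slice {c C : ℝ} (ha : 0 < a) (hγ : 1 < γ) (hc : 0 < c) {r s : ℝ → ℝ}
    (hr : Continuous r) (hs : Continuous s) (hrm : ∀ x, r x ∈ Icc c C) (hsm : ∀ x, s x ∈ Icc c C)
    (h : MemLp (fun x => r x - s x) 2 volume) : Integrable (fun x => relEnergy a γ (r x) (s x)) := by
  obtain ⟨L, hL0, hL⟩ := relEnergy_le_sq (C := C) ha hγ hc
  have hr0 : ∀ x, r x ≠ 0 := fun x => (lt_of_lt_of_le hc (hrm x).1).ne'
  have hs0 : ∀ x, s x ≠ 0 := fun x => (lt_of_lt_of_le hc (hsm x).1).ne'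
  refine (h.integrable_sq.const_mul L).mono' ?_ (.of_forall fun x => ?_)
  · refine Continuous.aestronglyMeasurable ?_
    unfold relEnergy
    have h1 := hr.rpow_const (p := γ) fun x => Or.inl (hr0 x)
    have h2 := hs.rpow_const (p := γ) fun x => Or.inl (hs0 x)
    have h3 := hs.rpow_const (p := γ - 1) fun x => Or.inl (hs0 x)
    fun_prop
  · rw [Real.norm_eq_abs, abs_of_nonneg (relEnergy_nonneg ha hγ (lt_of_lt_of_le hc (hrm x).1)
      (lt_of_lt_of_le hc (hsm x).1))]
    exact hL _ (hrm x) _ (hsm x)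

/-- Writing the relative energy as `ρ` times a function makes it accessible to `transport`. -/
lemma mul_potential {r s : ℝ} (hγ : 1 < γ) (hr : 0 < r) (hs : 0 < s) :
    r * (a / (γ - 1) * r ^ (γ - 1) + -(a * γ / (γ - 1)) * s ^ (γ - 1) +
      a * s ^ γ * r ^ (-1 : ℝ)) = relEnergy a γ r s := by
  have h1 : γ - 1 ≠ 0 := by linarith
  rw [relEnergy, Real.rpow_sub_one hr.ne', Real.rpow_sub_one hs.ne', Real.rpow_neg_one]
  field_simp
  ring

lemma integrable_relEnergy (h : Sol α γ a T ρbar ρ u ρt ρx ut ux uxx)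
    (hbar : IsReferenceDensity ρm ρp ρbar) (ha : 0 < a) (hγ : 1 < γ) :
    IntegrableOn (fun z : ℝ × ℝ => relEnergy a γ (ρ z.1 z.2) (ρbar z.2)) (strip T) := by
  obtain ⟨c, C, hc, hb, hb'⟩ := h.common_bounds hbar
  obtain ⟨L, hL0, hL⟩ := relEnergy_le_sq (C := C) ha hγ hc
  refine (h.rho_L2.memL2L2.integrable_sq.const_mul L).mono' ?_ ?_
  · have h1 := (h.exists_reg_rpow γ).meas
    have h2 := (reg_reference_rpow hbar T 1 γ).meas
    have h3 := (reg_reference_rpow hbar T 1 (γ - 1)).meas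
    have h4 := h.rho_L2.meas
    refine (((h1.sub h2).sub ((h3.const_mul γ).mul h4)).const_mul (a / (γ - 1))).congr
      (.of_forall fun z => ?_)
    simp only [relEnergy, Pi.sub_apply, Pi.mul_apply, one_mul]
  · filter_upwards [ae_restrict_mem (measurableSet_strip T)] with z hz
    have h1 := hb _ (Ioo_subset_Icc_self hz.1) z.2
    have h2 := hb' z.2
    rw [Real.norm_eq_abs, abs_of_nonneg (relEnergy_nonneg ha hγ (lt_of_lt_of_le hc h1.1)
      (lt_of_lt_of_le hc h2.1))]
    exact hL _ h1 _ h2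

lemma integrable_reference_work (h : Sol α γ a T ρbar ρ u ρt ρx ut ux uxx)
    (hbar : IsReferenceDensity ρm ρp ρbar) (c p : ℝ) :
    IntegrableOn (fun z : ℝ × ℝ => ρ z.1 z.2 *
      (u z.1 z.2 * deriv (fun x => c * ρbar x ^ p) z.2)) (strip T) :=
  h.rho_reg.integrableOn_mul (f := fun t x => u t x * deriv (fun x => c * ρbar x ^ p) x)
    (h.u_L2.memL2L2.integrableOn_mul
      (linfL2_of_space (reference_rpow_deriv_memLp hbar c p)).memL2L2)

/-- Balance of the relative potential energy. -/
lemma potential_balance (h : Sol α γ a T ρbar ρ u ρt ρx ut ux uxx)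
    (hbar : IsReferenceDensity ρm ρp ρbar) (ha : 0 < a) (hγ : 1 < γ)
    (h0 : Integrable fun x => relEnergy a γ (ρ 0 x) (ρbar x)) :
    ∀ᵐ t ∂volume.restrict (Ioo 0 T), Integrable (fun x => relEnergy a γ (ρ t x) (ρbar x)) ∧
      (∫ x, relEnergy a γ (ρ t x) (ρbar x)) - ∫ x, relEnergy a γ (ρ 0 x) (ρbar x) =
      (∫ z in strip t, u z.1 z.2 * (a * γ * ρ z.1 z.2 ^ (γ - 1) * ρx z.1 z.2)) +
      ∫ z in strip t, ρ z.1 z.2 *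
        (u z.1 z.2 * deriv (fun x => -(a * γ / (γ - 1)) * ρbar x ^ (γ - 1)) z.2) := by
  have hγ1 : γ - 1 ≠ 0 := by linarith
  set b₁ : ℝ → ℝ := fun x => -(a * γ / (γ - 1)) * ρbar x ^ (γ - 1) with hb₁
  set b₂ : ℝ → ℝ := fun x => a * ρbar x ^ γ with hb₂
  have huL := h.u_L2.memL2L2
  have huxL := h.ux_L2.memL2L2
  have hW := h.integrable_reference_work hbar (-(a * γ / (γ - 1))) (γ - 1)
  have hP := h.integrable_pressure_work 0
  simp only [zero_add, pow_one] at hP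
  have hE := (((h.exists_reg_rpow (γ - 1)).const_mul (a / (γ - 1))).add
    (reg_reference_rpow hbar T (-(a * γ / (γ - 1))) (γ - 1))).add
    ((reg_reference_rpow hbar T a γ).mul (h.exists_reg_rpow (-1)))
  have hRi := h.integrable_relEnergy hbar ha hγ
  have hflux := h.u_reg.integrableOn_mul
    (f := fun t x => relEnergy a γ (ρ t x) (ρbar x)) hRi
  have hpd : MemL2L2 T (fun t x => a * (ρ t x ^ γ - 1 * ρbar x ^ γ)) :=
    (h.rpow_sub_L2 hbar γ).const_mul a
  have hPreg := ((h.exists_reg_rpow γ).const_mul a).add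
    ((reg_reference_rpow hbar T a γ).const_mul (-1))
  have hKr := h.u_reg.mul hPreg
  -- The flux is built from the pressure minus its reference value: the difference is in `L²`, so
  -- its product with `u` is integrable on the whole strip, which the pressure alone would not give.
  have hK : IntegrableOn (fun z : ℝ × ℝ => -1 * (u z.1 z.2 *
      (a * ρ z.1 z.2 ^ γ + -1 * (a * ρbar z.2 ^ γ)))) (strip T) := by
    refine ((huL.integrableOn_mul hpd).const_mul (-1)).congr (.of_forall fun z => ?_)
    simp only
    ring
  have hKx : IntegrableOn (fun z : ℝ × ℝ => -1 * (ux z.1 z.2 *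
      (a * ρ z.1 z.2 ^ γ + -1 * (a * ρbar z.2 ^ γ)) + u z.1 z.2 *
      (a * (γ * ρ z.1 z.2 ^ (γ - 1) * ρx z.1 z.2) + -1 * deriv b₂ z.2))) (strip T) := by
    have h1 := huxL.integrableOn_mul hpd
    have h2 := huL.integrableOn_mul
      (linfL2_of_space (T := T) (reference_rpow_deriv_memLp hbar a γ)).memL2L2
    refine (((h1.add hP).sub h2).const_mul (-1)).congr (.of_forall fun z => ?_)
    simp only [Pi.add_apply, Pi.sub_apply]
    ring
  have hprim : ∀ᵐ t ∂volume.restrict (Ioo 0 T), ∃ v,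
      (fun x => -1 * (u t x * (a * ρ t x ^ γ + -1 * (a * ρbar x ^ γ)))) =ᵐ[volume] v ∧
      Prim univ v (fun x => -1 * (ux t x * (a * ρ t x ^ γ + -1 * (a * ρbar x ^ γ)) + u t x *
      (a * (γ * ρ t x ^ (γ - 1) * ρx t x) + -1 * deriv b₂ x))) := by
    filter_upwards [(hKr.const_mul (-1)).prim_x] with t ht using ⟨_, ae_eq_refl _, ht⟩
  -- Eliminating `ρ_t` by the continuity equation leaves an exact derivative, the pressure work that
  -- occurs with opposite sign in the kinetic balance, and the work done against `ρbar`.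
  have hF : ∀ᵐ z ∂volume.restrict (strip T), ρ z.1 z.2 *
      (a / (γ - 1) * ((γ - 1) * ρ z.1 z.2 ^ (γ - 1 - 1) * ρt z.1 z.2) + 0 +
        (0 * ρ z.1 z.2 ^ (-1 : ℝ) + a * ρbar z.2 ^ γ *
          (-1 * ρ z.1 z.2 ^ (-1 - 1 : ℝ) * ρt z.1 z.2)) + u z.1 z.2 *
      (a / (γ - 1) * ((γ - 1) * ρ z.1 z.2 ^ (γ - 1 - 1) * ρx z.1 z.2) + deriv b₁ z.2 +
        (deriv b₂ z.2 * ρ z.1 z.2 ^ (-1 : ℝ) + a * ρbar z.2 ^ γ *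
          (-1 * ρ z.1 z.2 ^ (-1 - 1 : ℝ) * ρx z.1 z.2)))) =
      -1 * (ux z.1 z.2 * (a * ρ z.1 z.2 ^ γ + -1 * (a * ρbar z.2 ^ γ)) + u z.1 z.2 *
      (a * (γ * ρ z.1 z.2 ^ (γ - 1) * ρx z.1 z.2) + -1 * deriv b₂ z.2)) +
      (u z.1 z.2 * (a * γ * ρ z.1 z.2 ^ (γ - 1) * ρx z.1 z.2) +
        ρ z.1 z.2 * (u z.1 z.2 * deriv b₁ z.2)) := by
    filter_upwards [h.mass, ae_restrict_mem (measurableSet_strip T)] with z hz hzT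
    have hpos := h.rho_pos (Ioo_subset_Icc_self hzT.1) z.2
    have e1 : ρt z.1 z.2 = -(u z.1 z.2 * ρx z.1 z.2 + ρ z.1 z.2 * ux z.1 z.2) := by linarith
    rw [e1, Real.rpow_sub_one hpos.ne', Real.rpow_sub_one hpos.ne', Real.rpow_sub_one hpos.ne',
      Real.rpow_neg_one]
    field_simp
    ring
  have hG : IntegrableOn (fun z : ℝ × ℝ =>
      u z.1 z.2 * (a * γ * ρ z.1 z.2 ^ (γ - 1) * ρx z.1 z.2) +
        ρ z.1 z.2 * (u z.1 z.2 * deriv b₁ z.2)) (strip T) := hP.add hW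
  have hpt : ∀ t ∈ Icc 0 T, ∀ x, ρ t x * (a / (γ - 1) * ρ t x ^ (γ - 1) +
      -(a * γ / (γ - 1)) * ρbar x ^ (γ - 1) + a * ρbar x ^ γ * ρ t x ^ (-1 : ℝ)) = relEnergy a γ (ρ t x) (ρbar x) := fun t ht x =>
    mul_potential hγ (h.rho_pos ht x) (reference_pos hbar x)
  have hT0 : (0 : ℝ) ∈ Icc 0 T := ⟨le_rfl, h.T_pos.le⟩
  filter_upwards [integrable_slice (f := fun t x => relEnergy a γ (ρ t x) (ρbar x)) hRi,
    ae_restrict_mem measurableSet_Ioo] with t hInt ht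
  have ht' := Ioo_subset_Icc_self ht
  refine ⟨hInt, ?_⟩
  obtain ⟨hFi, hFe⟩ := integral_strip_eq_of_divergence
    (G := fun t x => u t x * (a * γ * ρ t x ^ (γ - 1) * ρx t x) + ρ t x * (u t x * deriv b₁ x))
    (F := fun t x => ρ t x *
      (a / (γ - 1) * ((γ - 1) * ρ t x ^ (γ - 1 - 1) * ρt t x) + 0 +
        (0 * ρ t x ^ (-1 : ℝ) + a * ρbar x ^ γ *
          (-1 * ρ t x ^ (-1 - 1 : ℝ) * ρt t x)) + u t x *
      (a / (γ - 1) * ((γ - 1) * ρ t x ^ (γ - 1 - 1) * ρx t x) + deriv b₁ x +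
        (deriv b₂ x * ρ t x ^ (-1 : ℝ) + a * ρbar x ^ γ *
          (-1 * ρ t x ^ (-1 - 1 : ℝ) * ρx t x))))) ht.2.le hprim hK hKx hG hF
  have htr := h.transport (t := t) hE (by
      refine hflux.congr ?_
      filter_upwards [ae_restrict_mem (measurableSet_strip T)] with z hz
      rw [← hpt z.1 (Ioo_subset_Icc_self hz.1) z.2]
      ring)
    hFi (by simpa only [hpt 0 hT0] using h0) ht' (by simpa only [hpt t ht'] using hInt)
  simp only [hpt 0 hT0, hpt t ht'] at htr
  rw [htr, ← integral_add (hP.mono_set (strip_mono ht.2.le)) (hW.mono_set (strip_mono ht.2.le)),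
    ← hFe]

end Sol

namespace Sol

variable {α γ a T ρm ρp : ℝ} {ρbar : ℝ → ℝ} {ρ u ρt ρx ut ux uxx : ℝ → ℝ → ℝ}

/-- The weight `d` lives on `[-1, 1]`. There `ρ |u| ≤ ρ (1 + u²) / 2`, and the bare `ρ` is bounded
by coercivity of the relative energy, so the work is at most linear in the energy. -/
lemma slice_reference_work_le (h : Sol α γ a T ρbar ρ u ρt ρx ut ux uxx)
    (hbar : IsReferenceDensity ρm ρp ρbar) (ha : 0 < a) (hγ : 1 < γ) {C D : ℝ} {d : ℝ → ℝ}
    (hC0 : 0 < C) (hD : ∀ x, |d x| ≤ D) (hd : ∀ x, x ∉ Icc (-1 : ℝ) 1 → d x = 0)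
    (hC : ∀ r s, 0 < r → min ρm ρp ≤ s → s ≤ max ρm ρp → r ≤ C * (1 + relEnergy a γ r s))
    {t : ℝ} (ht : t ∈ Icc 0 T) (hi1 : Integrable fun x => ρ t x * u t x ^ 2)
    (hi2 : Integrable fun x => relEnergy a γ (ρ t x) (ρbar x)) :
    ∫ x, |ρ t x * (u t x * d x)| ≤ D * (C + 1) *
      (1 + ((∫ x, ρ t x * u t x ^ 2) / 2 + ∫ x, relEnergy a γ (ρ t x) (ρbar x))) := by
  have hD0 : 0 ≤ D := (abs_nonneg _).trans (hD 0)
  have hR : ∀ x, 0 ≤ relEnergy a γ (ρ t x) (ρbar x) := fun x =>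
    relEnergy_nonneg ha hγ (h.rho_pos ht x) (reference_pos hbar x)
  have hind : Integrable ((Icc (-1 : ℝ) 1).indicator fun _ => C) :=
    (integrable_indicator_iff measurableSet_Icc).2 (integrableOn_const (by simp))
  have hbound : ∀ x, |ρ t x * (u t x * d x)| ≤
      D / 2 * ((Icc (-1 : ℝ) 1).indicator (fun _ => C) x + C * relEnergy a γ (ρ t x) (ρbar x) +
        ρ t x * u t x ^ 2) := fun x => by
    have hp := h.rho_pos ht x
    have hRx := hR x
    by_cases hx : x ∈ Icc (-1 : ℝ) 1
    · rw [indicator_of_mem hx, abs_mul, abs_mul, abs_of_pos hp]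
      have h1 := hC _ _ hp (reference_bounds hbar x).1 (reference_bounds hbar x).2
      have h2 : ρ t x * (|u t x| * |d x|) ≤ ρ t x * (|u t x| * D) := by
        gcongr; exact hD x
      have h3 : |u t x| ≤ (1 + u t x ^ 2) / 2 := by
        nlinarith [sq_nonneg (|u t x| - 1), sq_abs (u t x)]
      have h4 : ρ t x * (|u t x| * D) ≤ ρ t x * ((1 + u t x ^ 2) / 2 * D) := by gcongr
      nlinarith
    · rw [indicator_of_notMem hx, hd x hx]
      simp only [mul_zero, abs_zero]
      positivity
  have hmaj : Integrable fun x => D / 2 * ((Icc (-1 : ℝ) 1).indicator (fun _ => C) x +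
      C * relEnergy a γ (ρ t x) (ρbar x) + ρ t x * u t x ^ 2) :=
    ((hind.add (hi2.const_mul C)).add hi1).const_mul _
  have h1 := integral_mono_of_nonneg (.of_forall fun x => abs_nonneg _) hmaj
    (.of_forall hbound)
  have e1 : ∫ x, (Icc (-1 : ℝ) 1).indicator (fun _ => C) x = 2 * C := by
    rw [integral_indicator measurableSet_Icc, setIntegral_const]
    simp
    norm_num
  have hadd : Integrable fun x => (Icc (-1 : ℝ) 1).indicator (fun _ => C) x +
      C * relEnergy a γ (ρ t x) (ρbar x) := hind.add (hi2.const_mul C)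
  rw [integral_const_mul, integral_add hadd hi1, integral_add hind (hi2.const_mul C),
    integral_const_mul, e1] at h1
  have h2 : 0 ≤ ∫ x, relEnergy a γ (ρ t x) (ρbar x) := integral_nonneg hR
  have h3 : 0 ≤ ∫ x, ρ t x * u t x ^ 2 := integral_nonneg fun x =>
    mul_nonneg (h.rho_pos ht x).le (sq_nonneg _)
  have h4 : 0 ≤ D * C := by positivity
  nlinarith

/-- The energy estimate, uniform in the time of existence. -/
lemma energy_bound (hbar : IsReferenceDensity ρm ρp ρbar) (ha : 0 < a) (hγ : 1 < γ) (T₀ : ℝ)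
    (ρ u : ℝ → ℝ → ℝ) (hu0 : Integrable fun x => ρ 0 x * u 0 x ^ 2)
    (hρ0 : Integrable fun x => relEnergy a γ (ρ 0 x) (ρbar x)) :
    ∃ K : ℝ, 0 ≤ K ∧ ∀ T ≤ T₀, ∀ ρt ρx ut ux uxx, Sol α γ a T ρbar ρ u ρt ρx ut ux uxx →
      ∀ᵐ t ∂volume.restrict (Ioo 0 T), (∫ x, ρ t x * u t x ^ 2 ≤ K) ∧
        (∫ x, relEnergy a γ (ρ t x) (ρbar x) ≤ K) ∧
        (∫ z in strip t, ρ z.1 z.2 ^ α * ux z.1 z.2 ^ 2 ≤ K) ∧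
        ∫ z in strip t, ρ z.1 z.2 *
          (u z.1 z.2 * deriv (fun x => -(a * γ / (γ - 1)) * ρbar x ^ (γ - 1)) z.2) ≤ K := by
  obtain ⟨C, hC0, hC⟩ := relEnergy_coercive (M := max ρm ρp) ha hγ
    (lt_min hbar.left_pos hbar.right_pos)
  set b₁ : ℝ → ℝ := fun x => -(a * γ / (γ - 1)) * ρbar x ^ (γ - 1) with hb₁
  have hd : ∀ x, x ∉ Icc (-1 : ℝ) 1 → deriv b₁ x = 0 := fun x hx => by
    rw [hb₁, reference_rpow_deriv hbar, deriv_eq_zero_of_reference hbar hx]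
    ring
  obtain ⟨D, hD⟩ : ∃ D, ∀ x, |deriv b₁ x| ≤ D := by
    have hcont : Continuous (deriv b₁) :=
      (reference_rpow_contDiff hbar _ _).continuous_deriv (by norm_cast)
    obtain ⟨D, hD⟩ := isCompact_Icc.exists_bound_of_continuousOn (s := Icc (-1 : ℝ) 1)
      hcont.continuousOn
    refine ⟨D, fun x => ?_⟩
    by_cases hx : x ∈ Icc (-1 : ℝ) 1
    · exact hD x hx
    · rw [hd x hx, abs_zero]
      exact (norm_nonneg _).trans (hD 0 (by norm_num))
  have hD0 : 0 ≤ D := (abs_nonneg _).trans (hD 0)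
  set E₀ := (∫ x, ρ 0 x * u 0 x ^ 2) / 2 + ∫ x, relEnergy a γ (ρ 0 x) (ρbar x) with hE₀
  -- The factor `2` accounts for the one half in the kinetic energy; `T` has been replaced by `|T₀|`
  -- in the Gronwall exponential.
  refine ⟨2 * ((1 + |E₀|) * Real.exp (D * (C + 1) * |T₀|)), by positivity,
    fun T hT ρt ρx ut ux uxx h => ?_⟩
  have hW := h.integrable_reference_work hbar (-(a * γ / (γ - 1))) (γ - 1)
  have hWabs : IntegrableOn (fun z : ℝ × ℝ => |ρ z.1 z.2 * (u z.1 z.2 * deriv b₁ z.2)|)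
    (strip T) := hW.abs
  have hT0 : (0 : ℝ) ∈ Icc 0 T := ⟨le_rfl, h.T_pos.le⟩
  have hdis := h.integrable_dissipation 0
  simp only [pow_zero, one_mul] at hdis
  have hid : ∀ᵐ t ∂volume.restrict (Ioo 0 T),
      (Integrable fun x => ρ t x * u t x ^ 2) ∧
      (Integrable fun x => relEnergy a γ (ρ t x) (ρbar x)) ∧
      (∫ x, ρ t x * u t x ^ 2) / 2 + (∫ x, relEnergy a γ (ρ t x) (ρbar x)) +
        ∫ z in strip t, ρ z.1 z.2 ^ α * ux z.1 z.2 ^ 2 =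
      E₀ + ∫ z in strip t, ρ z.1 z.2 * (u z.1 z.2 * deriv b₁ z.2) := by
    filter_upwards [h.velocity_moment 0 hu0, h.potential_balance hbar ha hγ hρ0]
      with t ⟨h1, h2⟩ ⟨h3, h4⟩
    refine ⟨h1, h3, ?_⟩
    simp only [zero_add, pow_zero, one_mul, Nat.cast_zero, mul_one, pow_one] at h2
    rw [hE₀]
    linarith
  -- Gronwall is applied to this majorant of the energy: it is absolutely continuous in time by
  -- construction, while the energy identity itself is known only for almost every `t`.
  set Y : ℝ → ℝ := fun t => E₀ + ∫ z in strip t, |ρ z.1 z.2 * (u z.1 z.2 * deriv b₁ z.2)|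
    with hY
  have hYp : Prim (Icc 0 T) Y (fun t => ∫ x, |ρ t x * (u t x * deriv b₁ x)|) :=
    prim_integral_slice (f := fun t x => |ρ t x * (u t x * deriv b₁ x)|) E₀ hWabs
  have habs : ∀ t ≤ T, |∫ z in strip t, ρ z.1 z.2 * (u z.1 z.2 * deriv b₁ z.2)| ≤
      ∫ z in strip t, |ρ z.1 z.2 * (u z.1 z.2 * deriv b₁ z.2)| := fun t _ =>
    abs_integral_le_integral_abs
  have hD' : ∀ t ∈ Icc 0 T, 0 ≤ ∫ z in strip t, ρ z.1 z.2 ^ α * ux z.1 z.2 ^ 2 := by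
    intro t ht
    refine setIntegral_nonneg (measurableSet_strip t) fun z hz => ?_
    have := h.rho_pos (Ioo_subset_Icc_self (strip_mono ht.2 hz).1) z.2
    positivity
  have hP : ∀ t ∈ Icc 0 T, 0 ≤ ∫ x, ρ t x * u t x ^ 2 := fun t ht =>
    integral_nonneg fun x => mul_nonneg (h.rho_pos ht x).le (sq_nonneg _)
  have hR : ∀ t ∈ Icc 0 T, 0 ≤ ∫ x, relEnergy a γ (ρ t x) (ρbar x) := fun t ht =>
    integral_nonneg fun x => relEnergy_nonneg ha hγ (h.rho_pos ht x) (reference_pos hbar x)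
  have hE0 : 0 ≤ E₀ := by
    have := hP 0 hT0
    have := hR 0 hT0
    rw [hE₀]
    positivity
  have hgr := hYp.gronwall (C := D * (C + 1)) (by
    filter_upwards [hid, ae_restrict_mem measurableSet_Ioo] with t ⟨h1, h2, h3⟩ ht
    have ht' := Ioo_subset_Icc_self ht
    refine (h.slice_reference_work_le hbar ha hγ hC0 hD hd hC ht' h1 h2).trans ?_
    have := hD' t ht'
    have := (abs_le.1 (habs t ht'.2)).2
    have h5 := le_abs_self (∫ z in strip t, ρ z.1 z.2 * (u z.1 z.2 * deriv b₁ z.2))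
    gcongr
    simp only [hY]
    linarith)
  filter_upwards [hid, ae_restrict_mem measurableSet_Ioo] with t ⟨h1, h2, h3⟩ ht
  have ht' := Ioo_subset_Icc_self ht
  have h4 := hgr t ht'
  have hY0 : Y 0 = E₀ := by simp [hY, strip]
  have hexp : Real.exp (D * (C + 1) * t) ≤ Real.exp (D * (C + 1) * |T₀|) := by
    have := (ht'.2.trans hT).trans (le_abs_self T₀)
    gcongr
  have h5 : (1 + E₀) * Real.exp (D * (C + 1) * t) ≤
      (1 + E₀) * Real.exp (D * (C + 1) * |T₀|) := by gcongr
  rw [hY0] at h4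
  have h6 := (abs_le.1 (habs t ht'.2)).2
  have h7 := hD' t ht'
  have h8 := hP t ht'
  have h9 := hR t ht'
  simp only [hY] at h4
  rw [abs_of_nonneg hE0]
  refine ⟨?_, ?_, ?_, ?_⟩ <;> linarith

end Sol

/-! ### Difference quotients in `L²` -/

lemma eLpNorm_two_sq {X E : Type*} [MeasurableSpace X] [NormedAddCommGroup E] (μ : Measure X)
    (f : X → E) :
    eLpNorm f 2 μ ^ 2 = ∫⁻ x, ‖f x‖ₑ ^ 2 ∂μ := by
  rw [eLpNorm_eq_lintegral_rpow_enorm_toReal (by norm_num) (by norm_num)]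
  simp only [ENNReal.toReal_ofNat, ENNReal.rpow_ofNat]
  rw [← ENNReal.rpow_natCast, ← ENNReal.rpow_mul]
  norm_num

lemma sq_lintegral_unit_le {k : ℝ → ℝ} (hk : AEStronglyMeasurable k (volume.restrict (Ioc 0 1))) :
    (∫⁻ s in Ioc (0 : ℝ) 1, ‖k s‖ₑ) ^ 2 ≤ ∫⁻ s in Ioc (0 : ℝ) 1, ‖k s‖ₑ ^ 2 := by
  have h := eLpNorm_le_eLpNorm_mul_rpow_measure_univ (p := 1) (q := 2) one_le_two hk
  rw [← eLpNorm_two_sq, ← eLpNorm_one_eq_lintegral_enorm]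
  gcongr
  simpa using h

/-- Jensen's inequality for difference quotients. -/
lemma Prim.sq_difference_quotient_le {f g : ℝ → ℝ} (hp : Prim univ f g) {h : ℝ} (hh : 0 < h)
    (x c : ℝ) :
    ‖h⁻¹ * (f (x + h) - f x) - c‖ₑ ^ 2 ≤ ∫⁻ s in Ioc (0 : ℝ) 1, ‖g (x + h * s) - c‖ₑ ^ 2 := by
  have hi := (hp x trivial (x + h) trivial)
  have hgi : IntervalIntegrable (fun s => g (x + h * s)) volume 0 1 := by
    have h1 := hi.1.comp_add_left x |>.comp_mul_left (c := h)
    simpa [hh.ne'] using h1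
  have hI : IntervalIntegrable (fun s => g (x + h * s) - c) volume 0 1 := hgi.sub (by simp)
  have e : h⁻¹ * (f (x + h) - f x) - c = ∫ s in (0 : ℝ)..1, (g (x + h * s) - c) := by
    rw [intervalIntegral.integral_sub hgi (by simp),
      intervalIntegral.integral_comp_add_mul _ hh.ne']
    simp [hi.2]
  rw [e, intervalIntegral.integral_of_le zero_le_one]
  refine (pow_le_pow_left' (enorm_integral_le_lintegral_enorm _) 2).trans ?_
  exact sq_lintegral_unit_le ((intervalIntegrable_iff_integrableOn_Ioc_of_le zero_le_one).1
    hI).aestronglyMeasurable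

lemma measurePreserving_shift (T h : ℝ) :
    MeasurePreserving (fun z : ℝ × ℝ => (z.1, z.2 + h)) (volume.restrict (strip T))
      (volume.restrict (strip T)) := by
  rw [restrict_strip]
  exact (MeasurePreserving.id _).prod (measurePreserving_add_right volume h)

lemma MemL2L2.shift {T : ℝ} {f : ℝ → ℝ → ℝ} (hf : MemL2L2 T f) (h : ℝ) :
    MemL2L2 T (fun t x => f t (x + h)) :=
  MemLp.comp_measurePreserving hf (measurePreserving_shift T h)

/-- Continuity of translations in `L²`. -/
lemma tendsto_shift {T : ℝ} {f : ℝ → ℝ → ℝ} (hf : MemL2L2 T f) :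
    Tendsto (fun h => eLpNorm (fun z : ℝ × ℝ => f z.1 (z.2 + h) - f z.1 z.2) 2
      (volume.restrict (strip T))) (𝓝 0) (𝓝 0) := by
  set μ := (volume : Measure (ℝ × ℝ)).restrict (strip T)
  let g : ℝ → C(ℝ × ℝ, ℝ × ℝ) := fun h => ⟨fun z => (z.1, z.2 + h), by fun_prop⟩
  have hg : Continuous g := ContinuousMap.continuous_of_continuous_uncurry _
    (by simp only [g, Function.uncurry_def, ContinuousMap.coe_mk]; fun_prop)
  have h1 := Filter.Tendsto.compMeasurePreservingLp (E := ℝ) (p := 2) (μ := μ) (ν := μ)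
    (tendsto_const_nhds (x := hf.toLp _) (f := 𝓝 (0 : ℝ))) (hg.tendsto 0)
    (fun h => measurePreserving_shift T h) (measurePreserving_shift T 0) (by norm_num)
  rw [Lp.tendsto_Lp_iff_tendsto_eLpNorm'] at h1
  refine h1.congr fun h => eLpNorm_congr_ae ?_
  have e : ∀ h, Lp.compMeasurePreserving (g h) (measurePreserving_shift T h) (hf.toLp _)
      =ᵐ[μ] fun z : ℝ × ℝ => f z.1 (z.2 + h) := fun h =>
    (Lp.coeFn_compMeasurePreserving _ (measurePreserving_shift T h)).trans
      ((measurePreserving_shift T h).quasiMeasurePreserving.ae_eq_comp hf.coeFn_toLp)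
  filter_upwards [e h, e 0] with z h2 h3
  rw [Pi.sub_apply, h2, h3, add_zero]

lemma ae_eq_shift {f w : ℝ → ℝ} (h : f =ᵐ[volume] w) (c : ℝ) :
    ∀ᵐ x, f (x + c) = w (x + c) :=
  (measurePreserving_add_right volume c).quasiMeasurePreserving.ae h

lemma aemeasurable_shift_sub {T : ℝ} {g k : ℝ → ℝ → ℝ} (hg : MemL2L2 T g) (hk : MemL2L2 T k)
    (h : ℝ) : AEMeasurable (fun p : ℝ × (ℝ × ℝ) => ‖g p.2.1 (p.2.2 + h * p.1) - k p.2.1 p.2.2‖ₑ ^ 2)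
      ((volume.restrict (Ioc (0 : ℝ) 1)).prod (volume.restrict (strip T))) := by
  have h1 : Measure.QuasiMeasurePreserving (fun p : ℝ × (ℝ × ℝ) => (p.2.1, p.2.2 + h * p.1))
      ((volume.restrict (Ioc (0 : ℝ) 1)).prod (volume.restrict (strip T)))
      (volume.restrict (strip T)) :=
    QuasiMeasurePreserving.prod_of_right (by fun_prop)
      (.of_forall fun s => (measurePreserving_shift T (h * s)).quasiMeasurePreserving)
  have h2 := hg.1.comp_quasiMeasurePreserving h1
  have h3 := hk.1.comp_quasiMeasurePreserving
    (Measure.quasiMeasurePreserving_snd (μ := volume.restrict (Ioc (0 : ℝ) 1))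
      (ν := (volume : Measure (ℝ × ℝ)).restrict (strip T)))
  exact ((h2.sub h3).enorm).pow_const 2

/-- Jensen on each slice, then Tonelli. The comparison function `k` is free: `k = fx` yields
convergence of difference quotients, `k = 0` their boundedness. -/
lemma sq_difference_quotient_le {T : ℝ} {f fx k : ℝ → ℝ → ℝ}
    (hf : AEStronglyMeasurable (fun z : ℝ × ℝ => f z.1 z.2) (volume.restrict (strip T)))
    (hfx : MemL2L2 T fx) (hk : MemL2L2 T k)
    (hp : ∀ᵐ t ∂volume.restrict (Ioo 0 T), ∃ w, f t =ᵐ[volume] w ∧ Prim univ w (fx t))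
    {h : ℝ} (hh : 0 < h) :
    eLpNorm (fun z : ℝ × ℝ => h⁻¹ * (f z.1 (z.2 + h) - f z.1 z.2) - k z.1 z.2) 2
      (volume.restrict (strip T)) ^ 2 ≤
    ∫⁻ s in Ioc (0 : ℝ) 1, eLpNorm (fun z : ℝ × ℝ => fx z.1 (z.2 + h * s) - k z.1 z.2) 2
      (volume.restrict (strip T)) ^ 2 := by
  have hm := aemeasurable_shift_sub hfx hk h
  have hfs : AEStronglyMeasurable (fun z : ℝ × ℝ => f z.1 (z.2 + h)) (volume.restrict (strip T)) :=
    hf.comp_measurePreserving (measurePreserving_shift T h)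
  have hL : AEMeasurable (fun z : ℝ × ℝ =>
      ‖h⁻¹ * (f z.1 (z.2 + h) - f z.1 z.2) - k z.1 z.2‖ₑ ^ 2) (volume.restrict (strip T)) :=
    ((((hfs.sub hf).const_mul h⁻¹).sub hk.1).enorm).pow_const 2
  simp only [eLpNorm_two_sq]
  rw [lintegral_lintegral_swap hm]
  have hR : AEMeasurable (fun z : ℝ × ℝ => ∫⁻ s in Ioc (0 : ℝ) 1,
      ‖fx z.1 (z.2 + h * s) - k z.1 z.2‖ₑ ^ 2) (volume.restrict (strip T)) :=
    hm.lintegral_prod_left'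
  rw [restrict_strip] at hL hR ⊢
  rw [lintegral_prod _ hL, lintegral_prod _ hR]
  refine lintegral_mono_ae ?_
  filter_upwards [hp] with t ⟨w, hw, hwp⟩
  refine lintegral_mono_ae ?_
  filter_upwards [hw, ae_eq_shift hw h] with x h1 h2
  rw [h1, h2]
  exact hwp.sq_difference_quotient_le hh x _

lemma tendsto_difference_quotient {T : ℝ} {f fx : ℝ → ℝ → ℝ}
    (hf : AEStronglyMeasurable (fun z : ℝ × ℝ => f z.1 z.2) (volume.restrict (strip T)))
    (hfx : MemL2L2 T fx)
    (hp : ∀ᵐ t ∂volume.restrict (Ioo 0 T), ∃ w, f t =ᵐ[volume] w ∧ Prim univ w (fx t)) :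
    Tendsto (fun h => eLpNorm (fun z : ℝ × ℝ => h⁻¹ * (f z.1 (z.2 + h) - f z.1 z.2) - fx z.1 z.2) 2
      (volume.restrict (strip T))) (𝓝[>] 0) (𝓝 0) := by
  have hsh := tendsto_shift hfx
  rw [ENNReal.tendsto_nhds_zero] at hsh ⊢
  intro ε hε
  obtain ⟨δ, hδ, hball⟩ := Metric.eventually_nhds_iff.1 (hsh ε hε)
  filter_upwards [self_mem_nhdsWithin, nhdsWithin_le_nhds (Iio_mem_nhds hδ)] with h hh hhδ
  have hh0 : 0 < h := hh
  refine (ENNReal.pow_le_pow_left_iff (n := 2) (by norm_num)).1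
    ((sq_difference_quotient_le hf hfx hfx hp hh0).trans ?_)
  calc ∫⁻ s in Ioc (0 : ℝ) 1, eLpNorm (fun z : ℝ × ℝ => fx z.1 (z.2 + h * s) - fx z.1 z.2) 2
        (volume.restrict (strip T)) ^ 2 ≤ ∫⁻ s in Ioc (0 : ℝ) 1, ε ^ 2 := by
        refine setLIntegral_mono' measurableSet_Ioc fun s hs => ?_
        gcongr
        refine hball ?_
        rw [Real.dist_eq, sub_zero, abs_of_nonneg (by have := hs.1; positivity)]
        have : h * s ≤ h * 1 := by gcongr; exact hs.2
        exact lt_of_le_of_lt (by linarith) hhδ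
    _ = ε ^ 2 := by simp

/-- Difference quotients on the line are bounded in `L²` by the derivative. -/
lemma Prim.lintegral_sq_difference_quotient_le {f g : ℝ → ℝ} (hp : Prim univ f g)
    (hg : AEStronglyMeasurable g volume) {h : ℝ} (hh : 0 < h) :
    ∫⁻ x, ‖h⁻¹ * (f (x + h) - f x)‖ₑ ^ 2 ≤ ∫⁻ x, ‖g x‖ₑ ^ 2 := by
  have hm : AEMeasurable (fun p : ℝ × ℝ => ‖g (p.1 + h * p.2)‖ₑ ^ 2)
      (volume.prod (volume.restrict (Ioc (0 : ℝ) 1))) := by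
    have h1 : Measure.QuasiMeasurePreserving (fun p : ℝ × ℝ => p.1 + h * p.2)
        (volume.prod (volume.restrict (Ioc (0 : ℝ) 1))) volume :=
      QuasiMeasurePreserving.prod_of_left (by fun_prop)
        (.of_forall fun s => (measurePreserving_add_right volume (h * s)).quasiMeasurePreserving)
    exact (hg.comp_quasiMeasurePreserving h1).enorm.pow_const 2
  calc ∫⁻ x, ‖h⁻¹ * (f (x + h) - f x)‖ₑ ^ 2
      ≤ ∫⁻ x, ∫⁻ s in Ioc (0 : ℝ) 1, ‖g (x + h * s)‖ₑ ^ 2 := lintegral_mono fun x => by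
        simpa using hp.sq_difference_quotient_le hh x 0
    _ = ∫⁻ s in Ioc (0 : ℝ) 1, ∫⁻ x, ‖g (x + h * s)‖ₑ ^ 2 := lintegral_lintegral_swap hm
    _ = ∫⁻ s in Ioc (0 : ℝ) 1, ∫⁻ x, ‖g x‖ₑ ^ 2 := by
        congr 1
        ext s
        exact lintegral_add_right_eq_self (fun x => ‖g x‖ₑ ^ 2) (h * s)
    _ = _ := by simp

/-- `F h → f` in `L²((0, T) × ℝ)` as `h ↓ 0`. -/
structure TendstoL2 (T : ℝ) (F : ℝ → ℝ → ℝ → ℝ) (f : ℝ → ℝ → ℝ) : Prop where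
  mem : ∀ h, 0 < h → MemL2L2 T (F h)
  lim_mem : MemL2L2 T f
  tendsto : Tendsto (fun h => eLpNorm (fun z : ℝ × ℝ => F h z.1 z.2 - f z.1 z.2) 2
    (volume.restrict (strip T))) (𝓝[>] 0) (𝓝 0)

namespace TendstoL2

variable {T : ℝ} {F G : ℝ → ℝ → ℝ → ℝ} {f g : ℝ → ℝ → ℝ}

lemma const (hf : MemL2L2 T f) : TendstoL2 T (fun _ => f) f :=
  ⟨fun _ _ => hf, hf, by simp⟩

lemma add (hF : TendstoL2 T F f) (hG : TendstoL2 T G g) :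
    TendstoL2 T (fun h t x => F h t x + G h t x) (fun t x => f t x + g t x) where
  mem h hh := (hF.mem h hh).add (hG.mem h hh)
  lim_mem := hF.lim_mem.add hG.lim_mem
  tendsto := by
    have h1 := hF.tendsto.add hG.tendsto
    rw [add_zero] at h1
    refine tendsto_of_tendsto_of_tendsto_of_le_of_le' tendsto_const_nhds h1
      (.of_forall fun _ => zero_le) ?_
    filter_upwards [self_mem_nhdsWithin] with h hh
    refine le_trans (le_of_eq ?_) (eLpNorm_add_le ((hF.mem h hh).sub hF.lim_mem).1
      ((hG.mem h hh).sub hG.lim_mem).1 one_le_two)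
    congr 1
    ext z
    simp only [Pi.add_apply]
    ring

lemma bdd_mul {b bt bx : ℝ → ℝ → ℝ} (hb : Reg T b bt bx) (hF : TendstoL2 T F f) :
    TendstoL2 T (fun h t x => b t x * F h t x) (fun t x => b t x * f t x) where
  mem h hh := (hF.mem h hh).bdd_mul hb
  lim_mem := hF.lim_mem.bdd_mul hb
  tendsto := by
    obtain ⟨M, hM⟩ := hb.bdd
    have h1 := ENNReal.Tendsto.const_mul (a := ENNReal.ofReal M) hF.tendsto
      (Or.inr ENNReal.ofReal_ne_top)
    rw [mul_zero] at h1
    refine tendsto_of_tendsto_of_tendsto_of_le_of_le tendsto_const_nhds h1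
      (fun _ => zero_le) fun h => ?_
    refine eLpNorm_le_mul_eLpNorm_of_ae_le_mul ?_ 2
    filter_upwards [ae_restrict_mem (measurableSet_strip T)] with z hz
    rw [← mul_sub, norm_mul]
    gcongr
    exact hM _ (Ioo_subset_Icc_self hz.1) _

lemma congr (hF : TendstoL2 T F f) (hFG : ∀ h, 0 < h → ∀ᵐ z ∂volume.restrict (strip T),
      F h z.1 z.2 = G h z.1 z.2)
    (hfg : ∀ᵐ z ∂volume.restrict (strip T), f z.1 z.2 = g z.1 z.2) : TendstoL2 T G g where
  mem h hh := (memLp_congr_ae (hFG h hh)).1 (hF.mem h hh)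
  lim_mem := (memLp_congr_ae hfg).1 hF.lim_mem
  tendsto := by
    refine hF.tendsto.congr' ?_
    filter_upwards [self_mem_nhdsWithin] with h hh
    refine eLpNorm_congr_ae ?_
    filter_upwards [hFG h hh, hfg] with z h1 h2
    rw [h1, h2]

/-- Integrals of products of `L²` convergent families converge. -/
lemma integral_mul (hF : TendstoL2 T F f) (hG : TendstoL2 T G g) {t : ℝ} (ht : t ≤ T) :
    Tendsto (fun h => ∫ z in strip t, F h z.1 z.2 * G h z.1 z.2) (𝓝[>] 0)
      (𝓝 (∫ z in strip t, f z.1 z.2 * g z.1 z.2)) := by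
  have hμ : (volume : Measure (ℝ × ℝ)).restrict (strip t) ≤ volume.restrict (strip T) :=
    Measure.restrict_mono (strip_mono ht) le_rfl
  -- Membership of `F h` in `L²` is known only for `h > 0`, so convergence in `Lp` is expressed
  -- along a filter on the subtype of positive reals. The inner product of `L²` is then continuous.
  have key : ∀ {F : ℝ → ℝ → ℝ → ℝ} {f : ℝ → ℝ → ℝ} (hF : TendstoL2 T F f),
      Tendsto (fun h : Ioi (0 : ℝ) => ((hF.mem h h.2).mono_measure hμ).toLp
        (fun z : ℝ × ℝ => F h z.1 z.2)) (comap (↑) (𝓝[>] (0 : ℝ)))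
        (𝓝 ((hF.lim_mem.mono_measure hμ).toLp (fun z : ℝ × ℝ => f z.1 z.2))) := by
    intro F f hF
    rw [Lp.tendsto_Lp_iff_tendsto_eLpNorm'']
    have h1 : Tendsto (fun h => eLpNorm (fun z : ℝ × ℝ => F h z.1 z.2 - f z.1 z.2) 2
        (volume.restrict (strip t))) (𝓝[>] 0) (𝓝 0) :=
      tendsto_of_tendsto_of_tendsto_of_le_of_le tendsto_const_nhds hF.tendsto
        (fun _ => zero_le) fun h => eLpNorm_mono_measure _ hμ
    exact h1.comp tendsto_comap
  have h1 := (key hF).inner (𝕜 := ℝ) (key hG)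
  have e : ∀ {p q : ℝ × ℝ → ℝ} (hp : MemLp p 2 (volume.restrict (strip t)))
      (hq : MemLp q 2 (volume.restrict (strip t))),
      inner ℝ (hp.toLp p) (hq.toLp q) = ∫ z in strip t, p z * q z := by
    intro p q hp hq
    rw [L2.inner_def]
    refine integral_congr_ae ?_
    filter_upwards [hp.coeFn_toLp, hq.coeFn_toLp] with z h1 h2
    rw [h1, h2]
    simp [mul_comm]
  simp only [e] at h1
  have h2 := tendsto_map' (f := fun h => ∫ z in strip t, F h z.1 z.2 * G h z.1 z.2)
    (g := ((↑) : Ioi (0 : ℝ) → ℝ)) h1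
  rwa [map_comap_of_mem] at h2
  rw [Subtype.range_coe]
  exact self_mem_nhdsWithin

lemma shift (hf : MemL2L2 T f) : TendstoL2 T (fun h t x => f t (x + h)) f :=
  ⟨fun h _ => hf.shift h, hf, (tendsto_shift hf).mono_left nhdsWithin_le_nhds⟩

lemma difference_quotient {fx : ℝ → ℝ → ℝ}
    (hf : AEStronglyMeasurable (fun z : ℝ × ℝ => f z.1 z.2) (volume.restrict (strip T)))
    (hfx : MemL2L2 T fx)
    (hp : ∀ᵐ t ∂volume.restrict (Ioo 0 T), ∃ w, f t =ᵐ[volume] w ∧ Prim univ w (fx t)) :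
    TendstoL2 T (fun h t x => h⁻¹ * (f t (x + h) - f t x)) fx := by
  refine ⟨fun h hh => ⟨?_, ?_⟩, hfx, tendsto_difference_quotient hf hfx hp⟩
  · exact ((hf.comp_measurePreserving (measurePreserving_shift T h)).sub hf).const_mul h⁻¹
  · have h0 : MemL2L2 T (fun _ _ => 0) := MemLp.zero
    have h1 := sq_difference_quotient_le hf hfx h0 hp hh
    simp only [sub_zero] at h1
    have h2 : ∀ s, eLpNorm (fun z : ℝ × ℝ => fx z.1 (z.2 + h * s)) 2 (volume.restrict (strip T)) =
        eLpNorm (fun z : ℝ × ℝ => fx z.1 z.2) 2 (volume.restrict (strip T)) := fun s => by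
      have hs := measurePreserving_shift T (h * s)
      have := eLpNorm_comp_measurePreserving (p := 2) hfx.1 hs
      simpa only [Function.comp_def] using this
    simp only [h2, lintegral_const, Measure.restrict_apply_univ, Real.volume_Ioc, sub_zero,
      ENNReal.ofReal_one, mul_one] at h1
    exact lt_of_le_of_lt ((ENNReal.pow_le_pow_left_iff two_ne_zero).1 h1) hfx.2

end TendstoL2

lemma lintegral_enorm_sq {f : ℝ → ℝ} (hf : MemLp f 2 volume) :
    ∫⁻ x, ‖f x‖ₑ ^ 2 = ENNReal.ofReal (∫ x, f x ^ 2) := by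
  rw [ofReal_integral_eq_lintegral_ofReal hf.integrable_sq (.of_forall fun x => sq_nonneg _)]
  congr 1
  ext x
  rw [← sq_abs, ENNReal.ofReal_pow (abs_nonneg _), Real.enorm_eq_ofReal_abs]

/-! ### Products of `L²_t L^∞_x` and `L^∞_t L²_x` functions -/

lemma LinfL2.bdd_mul {T : ℝ} {b bt bx f : ℝ → ℝ → ℝ} (hf : LinfL2 T f) (hb : Reg T b bt bx) :
    LinfL2 T (fun t x => b t x * f t x) := by
  refine ⟨hb.meas.mul hf.meas, ?_⟩
  obtain ⟨M, hM⟩ := hb.bdd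
  obtain ⟨K, hK⟩ := hf.bound
  have hm := hb.meas
  rw [restrict_strip] at hm
  refine ⟨M ^ 2 * K, ?_⟩
  filter_upwards [hK, hm.prodMk_left, ae_restrict_mem measurableSet_Ioo] with t ⟨h1, h2⟩ h3 ht
  have hMt := hM t (Ioo_subset_Icc_self ht)
  have hL : MemLp (fun x => b t x * f t x) 2 volume :=
    MemLp.of_le_mul (c := M) h1 (h3.mul h1.1) (.of_forall fun x => by
      rw [norm_mul]; gcongr; exact hMt x)
  refine ⟨hL, ?_⟩
  calc ∫ x, (b t x * f t x) ^ 2 ≤ ∫ x, M ^ 2 * f t x ^ 2 := by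
        refine integral_mono hL.integrable_sq (h1.integrable_sq.const_mul _) fun x => ?_
        simp only [mul_pow]
        gcongr ?_ * _
        rw [← sq_abs]
        have := hMt x
        gcongr
    _ = M ^ 2 * ∫ x, f t x ^ 2 := integral_const_mul _ _
    _ ≤ _ := by gcongr

/-- Hölder in mixed norms, slice by slice: `m t` dominates the squared supremum of `A` and `K` the
squared `L²` norm of `b`. The constant is independent of the shift `h` by translation invariance. -/
lemma LinfL2.exists_eLpNorm_mul_le {T : ℝ} {b : ℝ → ℝ → ℝ} (hb : LinfL2 T b) :
    ∃ K : ℝ≥0, ∀ (A : ℝ → ℝ → ℝ) (m : ℝ → ℝ≥0∞) (h : ℝ),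
      AEStronglyMeasurable (fun z : ℝ × ℝ => A z.1 z.2) (volume.restrict (strip T)) →
      (∀ᵐ t ∂volume.restrict (Ioo 0 T), ∀ᵐ x, ‖A t x‖ₑ ^ 2 ≤ m t) →
      eLpNorm (fun z : ℝ × ℝ => A z.1 z.2 * b z.1 (z.2 + h)) 2 (volume.restrict (strip T)) ^ 2 ≤
        (∫⁻ t in Ioo 0 T, m t) * K := by
  obtain ⟨K, hK⟩ := hb.bound
  refine ⟨K.toNNReal, fun A m h hA hm => ?_⟩
  have hbs := hb.meas.comp_measurePreserving (measurePreserving_shift T h)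
  have hme : AEMeasurable (fun z : ℝ × ℝ => ‖A z.1 z.2 * b z.1 (z.2 + h)‖ₑ ^ 2)
    (volume.restrict (strip T)) := (hA.mul hbs).enorm.pow_const 2
  rw [eLpNorm_two_sq]
  rw [restrict_strip] at hme ⊢
  rw [lintegral_prod _ hme, ← lintegral_mul_const' _ _ ENNReal.coe_ne_top]
  refine lintegral_mono_ae ?_
  filter_upwards [hm, hK] with t h1 ⟨h2, h3⟩
  calc ∫⁻ x, ‖A t x * b t (x + h)‖ₑ ^ 2 ≤ ∫⁻ x, m t * ‖b t (x + h)‖ₑ ^ 2 := by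
        refine lintegral_mono_ae ?_
        filter_upwards [h1] with x hx
        rw [enorm_mul, mul_pow]
        gcongr
    _ = m t * ∫⁻ x, ‖b t (x + h)‖ₑ ^ 2 := by
        refine lintegral_const_mul'' _ ?_
        exact ((h2.1.comp_measurePreserving (measurePreserving_add_right volume h)).enorm).pow_const 2
    _ = m t * ∫⁻ x, ‖b t x‖ₑ ^ 2 := by
        rw [lintegral_add_right_eq_self (fun x => ‖b t x‖ₑ ^ 2) h]
    _ ≤ _ := by
        rw [lintegral_enorm_sq h2]
        gcongr
        exact ENNReal.ofReal_le_ofReal h3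

/-- Hölder continuity of primitives of square integrable functions. -/
lemma Prim.sq_sub_le {s : Set ℝ} {f g : ℝ → ℝ} (hp : Prim s f g) {c d : ℝ} (hc : c ∈ s)
    (hd : d ∈ s) (hcd : c ≤ d) (hg : IntegrableOn (fun y => g y ^ 2) (Ioc c d)) :
    (f d - f c) ^ 2 ≤ (d - c) * ∫ y in Ioc c d, g y ^ 2 := by
  obtain ⟨h1, h2⟩ := hp c hc d hd
  rcases hcd.eq_or_lt with rfl | hlt
  · simp
  set m := (f d - f c) / (d - c) with hm
  have hi2 : IntervalIntegrable (fun y => g y ^ 2) volume c d :=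
    (intervalIntegrable_iff_integrableOn_Ioc_of_le hcd).2 hg
  have h0 : 0 ≤ ∫ y in c..d, (g y ^ 2 - 2 * m * g y + m ^ 2) :=
    intervalIntegral.integral_nonneg hcd fun y _ => by nlinarith [sq_nonneg (g y - m)]
  rw [intervalIntegral.integral_add (hi2.sub (h1.const_mul _)) (by simp),
    intervalIntegral.integral_sub hi2 (h1.const_mul _),
    intervalIntegral.integral_const_mul, h2] at h0
  simp only [intervalIntegral.integral_const, smul_eq_mul] at h0
  rw [intervalIntegral.integral_of_le hcd] at h0
  have h3 : 0 < d - c := by linarith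
  have h4 : f d - f c = m * (d - c) := by rw [hm]; field_simp
  rw [h4] at h0 ⊢
  nlinarith

lemma enorm_sq_le_ofReal {x m : ℝ} (h : x ^ 2 ≤ m) : ‖x‖ₑ ^ 2 ≤ ENNReal.ofReal m := by
  rw [Real.enorm_eq_ofReal_abs, ← ENNReal.ofReal_pow (abs_nonneg _), sq_abs]
  exact ENNReal.ofReal_le_ofReal h

lemma Prim.memLp_difference_quotient {f g : ℝ → ℝ} (hp : Prim univ f g) (hg : MemLp g 2 volume)
    {h : ℝ} (hh : 0 < h) : MemLp (fun x => h⁻¹ * (f (x + h) - f x)) 2 volume ∧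
      ∫ x, (h⁻¹ * (f (x + h) - f x)) ^ 2 ≤ ∫ x, g x ^ 2 := by
  have h1 := hp.lintegral_sq_difference_quotient_le hg.1 hh
  have hc := hp.continuous
  have hm : AEStronglyMeasurable (fun x => h⁻¹ * (f (x + h) - f x)) volume :=
    Continuous.aestronglyMeasurable (by fun_prop)
  have hL : MemLp (fun x => h⁻¹ * (f (x + h) - f x)) 2 volume := by
    refine ⟨hm, ?_⟩
    rw [← eLpNorm_two_sq, ← eLpNorm_two_sq] at h1
    exact lt_of_le_of_lt ((ENNReal.pow_le_pow_left_iff two_ne_zero).1 h1) hg.2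
  refine ⟨hL, ?_⟩
  rw [lintegral_enorm_sq hL, lintegral_enorm_sq hg] at h1
  exact (ENNReal.ofReal_le_ofReal_iff (integral_nonneg fun x => sq_nonneg _)).1 h1

lemma Reg.difference_quotient {T : ℝ} {f ft fx : ℝ → ℝ → ℝ} (hf : Reg T f ft fx) (h : ℝ) :
    Reg T (fun t x => h⁻¹ * (f t (x + h) - f t x)) (fun t x => h⁻¹ * (ft t (x + h) - ft t x))
      (fun t x => h⁻¹ * (fx t (x + h) - fx t x)) := by
  simpa only [neg_one_mul, ← sub_eq_add_neg] using
    ((hf.shift h).add (hf.const_mul (-1))).const_mul h⁻¹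

/-! ### The viscous potential and products with the velocity gradient -/

/-- An antiderivative of `r ^ (α - 2)`. -/
def viscousPotential (α r : ℝ) : ℝ := if α = 1 then Real.log r else r ^ (α - 1) / (α - 1)

lemma viscousPotential_hasDerivAt (α : ℝ) {r : ℝ} (hr : 0 < r) :
    HasDerivAt (viscousPotential α) (r ^ (α - 2)) r := by
  unfold viscousPotential
  by_cases h : α = 1
  · simp only [h, if_true]
    convert Real.hasDerivAt_log hr.ne' using 1
    rw [← Real.rpow_neg_one]
    norm_num
  · simp only [h, if_false]
    have h1 : α - 1 ≠ 0 := sub_ne_zero.2 h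
    have h2 := (Real.hasDerivAt_rpow_const (p := α - 1) (Or.inl hr.ne')).div_const (α - 1)
    rwa [mul_div_cancel_left₀ _ h1, show α - 1 - 1 = α - 2 by ring] at h2

namespace Sol

variable {α γ a T ρm ρp : ℝ} {ρbar : ℝ → ℝ} {ρ u ρt ρx ut ux uxx : ℝ → ℝ → ℝ}

/-- The quantity `ρ^(α-2) ρ_x` is an exact `x`-derivative, so difference quotients of the potential
regularise the effective velocity. -/
lemma reg_viscousPotential (h : Sol α γ a T ρbar ρ u ρt ρx ut ux uxx) :
    Reg T (fun t x => viscousPotential α (ρ t x)) (fun t x => ρ t x ^ (α - 2) * ρt t x)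
      (fun t x => ρ t x ^ (α - 2) * ρx t x) := by
  obtain ⟨c, C, hc, hb⟩ := h.rho_bounds
  exact h.rho_reg.comp (G' := fun y => y ^ (α - 2)) isCompact_Icc (fun t ht x => hb t ht x)
    (fun y hy => viscousPotential_hasDerivAt α (lt_of_lt_of_le hc hy.1)) (rpow_continuousOn hc)

/-- Almost every slice of `u_x` is in `H¹`, so `u_x` is in `L²` in time with values in `L^∞`, and
may be paired with a factor in `L^∞` in time with values in `L²`. -/
lemma ux_mul_memL2L2 (h : Sol α γ a T ρbar ρ u ρt ρx ut ux uxx) {b : ℝ → ℝ → ℝ}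
    (hb : LinfL2 T b) : MemL2L2 T (fun t x => ux t x * b t x) := by
  refine ⟨h.ux_L2.meas.mul hb.meas, ?_⟩
  obtain ⟨K, hK⟩ := hb.exists_eLpNorm_mul_le
  set m : ℝ → ℝ := fun t => 2 * (∫ y, ux t y ^ 2) + 2 * ∫ y, uxx t y ^ 2 with hm
  have hmi : IntegrableOn m (Ioo 0 T) :=
    ((integrableOn_integral_slice (f := fun t x => ux t x ^ 2)
      h.ux_L2.memL2L2.integrable_sq).const_mul 2).add
    ((integrableOn_integral_slice (f := fun t x => uxx t x ^ 2)
      h.uxx_L2.integrable_sq).const_mul 2)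
  have h1 := hK ux (fun t => ENNReal.ofReal (m t)) 0 h.ux_L2.meas (by
    filter_upwards [h.ux_prim, memLp_slice h.ux_L2.memL2L2, memLp_slice h.uxx_L2]
      with t ⟨w, hw, hp⟩ h2 h3
    filter_upwards [hw] with x hx
    have h4 := hp.sq_le ((memLp_congr_ae hw).1 h2) h3 x
    rw [← integral_congr_ae (f := fun x => ux t x ^ 2) (by
      filter_upwards [hw] with x hx; rw [hx])] at h4
    rw [hx]
    exact enorm_sq_le_ofReal h4)
  simp only [add_zero] at h1
  have h5 : eLpNorm (fun z : ℝ × ℝ => ux z.1 z.2 * b z.1 z.2) 2 (volume.restrict (strip T)) ^ 2 <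
      ⊤ := lt_of_le_of_lt h1 (ENNReal.mul_lt_top hmi.lintegral_lt_top ENNReal.coe_lt_top)
  simpa using h5

/-- The quotient is the mean of `u_x` over `[x, x + δ]`, and `u_x` is Hölder of exponent `1/2` in
`x` with constant given by the `L²` norm of `u_xx`. -/
lemma sq_difference_quotient_sub_le (h : Sol α γ a T ρbar ρ u ρt ρx ut ux uxx) :
    ∀ᵐ t ∂volume.restrict (Ioo 0 T), ∀ δ, 0 < δ → ∀ᵐ x,
      ‖δ⁻¹ * (u t (x + δ) - u t x) - ux t (x + δ)‖ₑ ^ 2 ≤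
        ENNReal.ofReal δ * ENNReal.ofReal (∫ y, uxx t y ^ 2) := by
  filter_upwards [h.ux_prim, h.u_reg.prim_x, memLp_slice h.uxx_L2] with t ⟨w, hw, hp⟩ hu hL δ hδ
  have huw : Prim univ (u t) w := hu.congr_right hw
  filter_upwards [ae_eq_shift hw δ] with x hx
  rw [hx]
  refine (huw.sq_difference_quotient_le hδ x _).trans ?_
  rw [← ENNReal.ofReal_mul hδ.le]
  calc ∫⁻ s in Ioc (0 : ℝ) 1, ‖w (x + δ * s) - w (x + δ)‖ₑ ^ 2
      ≤ ∫⁻ s in Ioc (0 : ℝ) 1, ENNReal.ofReal (δ * ∫ y, uxx t y ^ 2) := by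
        refine setLIntegral_mono' measurableSet_Ioc fun s hs => enorm_sq_le_ofReal ?_
        have hδs : δ * s ≤ δ * 1 := by gcongr; exact hs.2
        have h1 := hp.sq_sub_le (c := x + δ * s) (d := x + δ) trivial trivial (by linarith)
          hL.integrable_sq.integrableOn
        have h2 : ∫ y in Ioc (x + δ * s) (x + δ), uxx t y ^ 2 ≤ ∫ y, uxx t y ^ 2 :=
          setIntegral_le_integral hL.integrable_sq (.of_forall fun _ => sq_nonneg _)
        have h3 : 0 ≤ ∫ y, uxx t y ^ 2 := integral_nonneg fun _ => sq_nonneg _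
        have h4 : 0 ≤ δ * s := mul_nonneg hδ.le hs.1.le
        calc _ = (w (x + δ) - w (x + δ * s)) ^ 2 := by ring
          _ ≤ _ := h1
          _ ≤ _ := mul_le_mul (by linarith) h2
            (integral_nonneg fun _ => sq_nonneg _) hδ.le
    _ = _ := by simp

lemma tendsto_difference_quotient_mul (h : Sol α γ a T ρbar ρ u ρt ρx ut ux uxx)
    {b : ℝ → ℝ → ℝ} (hb : LinfL2 T b) :
    TendstoL2 T (fun δ t x => δ⁻¹ * (u t (x + δ) - u t x) * b t (x + δ))
      (fun t x => ux t x * b t x) := by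
  have hub := h.ux_mul_memL2L2 hb
  have hmem : ∀ δ, MemL2L2 T (fun t x => δ⁻¹ * (u t (x + δ) - u t x) * b t (x + δ)) := fun δ =>
    (hb.memL2L2.shift δ).bdd_mul (h.u_reg.difference_quotient δ)
  -- Splitting off the translate of `u_x b`, which converges by continuity of translations, leaves a
  -- remainder whose first factor is of order `√δ` uniformly in `x`. No convergence of `b` stronger
  -- than `L²` is needed.
  have hA : TendstoL2 T (fun δ t x => (δ⁻¹ * (u t (x + δ) - u t x) - ux t (x + δ)) * b t (x + δ))
      (fun _ _ => 0) := by
    refine ⟨fun δ _ => ?_, MemLp.zero, ?_⟩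
    · refine (memLp_congr_ae (.of_forall fun z => ?_)).1 ((hmem δ).sub (hub.shift δ))
      simp only [Pi.sub_apply]
      ring
    · obtain ⟨K, hK⟩ := hb.exists_eLpNorm_mul_le
      set I := ∫⁻ t in Ioo 0 T, ENNReal.ofReal (∫ y, uxx t y ^ 2) with hI
      have hIt : I ≠ ⊤ := (integrableOn_integral_slice (f := fun t x => uxx t x ^ 2)
        h.uxx_L2.integrable_sq).lintegral_lt_top.ne
      have hle : ∀ δ : ℝ, 0 < δ → eLpNorm (fun z : ℝ × ℝ =>
          (δ⁻¹ * (u z.1 (z.2 + δ) - u z.1 z.2) - ux z.1 (z.2 + δ)) * b z.1 (z.2 + δ)) 2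
          (volume.restrict (strip T)) ^ 2 ≤ ENNReal.ofReal δ * (I * K) := fun δ hδ => by
        refine (hK (fun t x => δ⁻¹ * (u t (x + δ) - u t x) - ux t (x + δ))
          (fun t => ENNReal.ofReal δ * ENNReal.ofReal (∫ y, uxx t y ^ 2)) δ
          ((h.u_reg.difference_quotient δ).meas.sub (h.ux_L2.memL2L2.shift δ).1) ?_).trans ?_
        · filter_upwards [h.sq_difference_quotient_sub_le] with t ht using ht δ hδ
        · rw [lintegral_const_mul' _ _ ENNReal.ofReal_ne_top, mul_assoc]
      have hlim : Tendsto (fun δ : ℝ => ENNReal.ofReal δ * (I * K)) (𝓝[>] 0) (𝓝 0) := by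
        have h1 : Tendsto (fun δ : ℝ => ENNReal.ofReal δ) (𝓝[>] 0) (𝓝 0) := by
          simpa using (ENNReal.continuous_ofReal.tendsto 0).mono_left nhdsWithin_le_nhds
        simpa using ENNReal.Tendsto.mul_const (b := I * K) h1
          (Or.inr (ENNReal.mul_ne_top hIt ENNReal.coe_ne_top))
      rw [ENNReal.tendsto_nhds_zero] at hlim ⊢
      intro ε hε
      filter_upwards [hlim (ε ^ 2) (by positivity), self_mem_nhdsWithin] with δ h1 hδ
      simp only [sub_zero]
      exact (ENNReal.pow_le_pow_left_iff two_ne_zero).1 ((hle δ hδ).trans h1)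
  refine (hA.add (TendstoL2.shift hub)).congr (fun δ _ => .of_forall fun z => ?_)
    (.of_forall fun z => ?_)
  · ring
  · ring

end Sol

/-! ### The effective velocity and the Bresch–Desjardins entropy -/

/-- The effective velocity `u + ∂_x θ(ρ)`, with the derivative replaced by a difference quotient. -/
def effVel (α : ℝ) (ρ u : ℝ → ℝ → ℝ) (δ t x : ℝ) : ℝ :=
  u t x + δ⁻¹ * (viscousPotential α (ρ t (x + δ)) - viscousPotential α (ρ t x))

/-- The material derivative of the effective velocity. -/
def effForce (α : ℝ) (ρ u ρx ut ux : ℝ → ℝ → ℝ) (δ t x : ℝ) : ℝ :=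
  ut t x + u t x * ux t x -
    δ⁻¹ * (ρ t (x + δ) ^ (α - 1) * ux t (x + δ) - ρ t x ^ (α - 1) * ux t x) -
    δ⁻¹ * (u t (x + δ) - u t x) * (ρ t (x + δ) ^ (α - 2) * ρx t (x + δ))

namespace Sol

variable {α γ a T ρm ρp : ℝ} {ρbar : ℝ → ℝ} {ρ u ρt ρx ut ux uxx : ℝ → ℝ → ℝ}

lemma tendsto_effVel (h : Sol α γ a T ρbar ρ u ρt ρx ut ux uxx) :
    TendstoL2 T (effVel α ρ u) (fun t x => u t x + ρ t x ^ (α - 2) * ρx t x) := by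
  have hθ := h.reg_viscousPotential
  refine (TendstoL2.const h.u_L2.memL2L2).add (TendstoL2.difference_quotient
    (f := fun t x => viscousPotential α (ρ t x)) hθ.meas
    (h.rhox_L2.memL2L2.bdd_mul (h.exists_reg_rpow (α - 2))) ?_)
  filter_upwards [hθ.prim_x] with t ht using ⟨_, .rfl, ht⟩

/-- Formally the limit is `ρ (u_t + u u_x - (ρ^(α-1) u_x)_x - ρ^(α-2) ρ_x u_x)`. Since `(ρ^α u_x)_x
= ρ (ρ^(α-1) u_x)_x + ρ^(α-1) ρ_x u_x`, the momentum equation cancels all viscous terms and only the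
pressure gradient is left. -/
lemma tendsto_effForce (h : Sol α γ a T ρbar ρ u ρt ρx ut ux uxx) :
    TendstoL2 T (fun δ t x => ρ t x * effForce α ρ u ρx ut ux δ t x)
      (fun t x => -(a * γ * ρ t x ^ (γ - 1) * ρx t x)) := by
  have hr := h.exists_reg_rpow (α - 1)
  have hrx : MemL2L2 T (fun t x => (α - 1) * ρ t x ^ (α - 1 - 1) * ρx t x * ux t x +
      ρ t x ^ (α - 1) * uxx t x) := by
    refine MemLp.add ?_ (h.uxx_L2.bdd_mul hr)
    have h1 := h.ux_mul_memL2L2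
      (h.rhox_L2.bdd_mul ((h.exists_reg_rpow (α - 1 - 1)).const_mul (α - 1)))
    refine (memLp_congr_ae (.of_forall fun z => ?_)).1 h1
    ring
  have h1 := TendstoL2.difference_quotient (f := fun t x => ρ t x ^ (α - 1) * ux t x)
    (hr.meas.mul h.ux_L2.meas) hrx (hr.prim_mul_slice h.ux_prim)
  have h2 := h.tendsto_difference_quotient_mul (h.rhox_L2.bdd_mul (h.exists_reg_rpow (α - 2)))
  have h3 := (TendstoL2.const h.ut_L2).add (TendstoL2.const (h.ux_L2.memL2L2.bdd_mul h.u_reg))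
  have h4 := ((h3.add (h1.bdd_mul (Reg.const T (-1)))).add
    (h2.bdd_mul (Reg.const T (-1)))).bdd_mul h.rho_reg
  refine h4.congr (fun δ _ => .of_forall fun z => ?_) ?_
  · simp only [effForce]
    ring
  · filter_upwards [h.momentum, ae_restrict_mem (measurableSet_strip T)] with z hz hzT
    have hp := h.rho_pos (Ioo_subset_Icc_self hzT.1) z.2
    have e1 : ρ z.1 z.2 ^ α = ρ z.1 z.2 * ρ z.1 z.2 ^ (α - 1) := by
      rw [Real.rpow_sub_one hp.ne']; field_simp
    have e2 : ρ z.1 z.2 ^ (α - 1) = ρ z.1 z.2 * ρ z.1 z.2 ^ (α - 1 - 1) := by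
      rw [Real.rpow_sub_one hp.ne' (α - 1)]; field_simp
    have e3 : α - 2 = α - 1 - 1 := by ring
    rw [e1] at hz
    rw [e3]
    rw [e2] at hz ⊢
    linear_combination hz

/-- The continuity equation times `ρ^(α-2)` transports the viscous potential with source `-ρ^(α-1)
u_x`. Taking the difference of this law at `x + δ` and at `x` produces, besides the quotient of the
source, a commutator from `u (x + δ) - u x`. -/
lemma effVel_material (h : Sol α γ a T ρbar ρ u ρt ρx ut ux uxx) (δ : ℝ) :
    ∀ᵐ z ∂volume.restrict (strip T),
      (ut z.1 z.2 + δ⁻¹ * (ρ z.1 (z.2 + δ) ^ (α - 2) * ρt z.1 (z.2 + δ) -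
          ρ z.1 z.2 ^ (α - 2) * ρt z.1 z.2)) +
        u z.1 z.2 * (ux z.1 z.2 + δ⁻¹ * (ρ z.1 (z.2 + δ) ^ (α - 2) * ρx z.1 (z.2 + δ) -
          ρ z.1 z.2 ^ (α - 2) * ρx z.1 z.2)) =
      effForce α ρ u ρx ut ux δ z.1 z.2 := by
  filter_upwards [h.mass, (measurePreserving_shift T δ).quasiMeasurePreserving.ae h.mass,
    ae_restrict_mem (measurableSet_strip T)] with z h1 h2 hzT
  have e : ∀ x, ρ z.1 x ^ (α - 1) = ρ z.1 x * ρ z.1 x ^ (α - 2) := fun x => by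
    have hp := h.rho_pos (Ioo_subset_Icc_self hzT.1) x
    rw [show α - 2 = α - 1 - 1 by ring, Real.rpow_sub_one hp.ne' (α - 1)]
    field_simp
  rw [effForce, e, e]
  linear_combination δ⁻¹ * ρ z.1 (z.2 + δ) ^ (α - 2) * h2 - δ⁻¹ * ρ z.1 z.2 ^ (α - 2) * h1

lemma reg_effVel (h : Sol α γ a T ρbar ρ u ρt ρx ut ux uxx) (δ : ℝ) :
    Reg T (effVel α ρ u δ)
      (fun t x => ut t x + δ⁻¹ * (ρ t (x + δ) ^ (α - 2) * ρt t (x + δ) -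
          ρ t x ^ (α - 2) * ρt t x))
      (fun t x => ux t x + δ⁻¹ * (ρ t (x + δ) ^ (α - 2) * ρx t (x + δ) -
          ρ t x ^ (α - 2) * ρx t x)) :=
  h.u_reg.add (h.reg_viscousPotential.difference_quotient δ)

lemma integrable_rho_mul_sq (h : Sol α γ a T ρbar ρ u ρt ρx ut ux uxx) {t : ℝ}
    (ht : t ∈ Icc 0 T) {v : ℝ → ℝ} (hv : MemLp v 2 volume) :
    Integrable fun x => ρ t x * (v x * v x) := by
  obtain ⟨c, C, hc, hb⟩ := h.rho_bounds
  have hcont : Continuous (ρ t) := slice_continuous h.rho_reg.cont ht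
  refine Integrable.bdd_mul (c := C) (hv.integrable_mul hv) hcont.aestronglyMeasurable
    (.of_forall fun x => ?_)
  rw [Real.norm_eq_abs, abs_of_pos (h.rho_pos ht x)]
  exact (hb t ht x).2

lemma memLp_effVel {t δ : ℝ} {q : ℝ → ℝ}
    (hδ : 0 < δ) (hu : MemLp (u t) 2 volume) (hq : MemLp q 2 volume)
    (hp : Prim univ (fun x => viscousPotential α (ρ t x)) q) :
    MemLp (effVel α ρ u δ t) 2 volume :=
  hu.add (hp.memLp_difference_quotient hq hδ).1

/-- Balance of `∫ ρ V²` for the effective velocity `V`. -/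
lemma effVel_balance (h : Sol α γ a T ρbar ρ u ρt ρx ut ux uxx) {q₀ : ℝ → ℝ}
    (hu0 : MemLp (u 0) 2 volume) (hq0 : MemLp q₀ 2 volume)
    (hp0 : Prim univ (fun x => viscousPotential α (ρ 0 x)) q₀) :
    ∀ᵐ t ∂volume.restrict (Ioo 0 T), ∀ δ, 0 < δ →
      (∫ x, ρ t x * (effVel α ρ u δ t x * effVel α ρ u δ t x)) -
        ∫ x, ρ 0 x * (effVel α ρ u δ 0 x * effVel α ρ u δ 0 x) =
      2 * ∫ z in strip t, effVel α ρ u δ z.1 z.2 *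
        (ρ z.1 z.2 * effForce α ρ u ρx ut ux δ z.1 z.2) := by
  filter_upwards [memLp_slice h.u_L2.memL2L2, h.reg_viscousPotential.prim_x,
    memLp_slice (h.rhox_L2.memL2L2.bdd_mul (h.exists_reg_rpow (α - 2))),
    ae_restrict_mem measurableSet_Ioo] with t hu hp hq ht δ hδ
  have ht' := Ioo_subset_Icc_self ht
  have h0 : (0 : ℝ) ∈ Icc 0 T := ⟨le_rfl, h.T_pos.le⟩
  have hV := h.reg_effVel δ
  have hVL := h.tendsto_effVel.mem δ hδ
  have hGL := h.tendsto_effForce.mem δ hδ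
  have hVG := (hVL.integrableOn_mul hGL).const_mul 2
  have hae : ∀ᵐ z ∂volume.restrict (strip T), 2 * (effVel α ρ u δ z.1 z.2 *
        (ρ z.1 z.2 * effForce α ρ u ρx ut ux δ z.1 z.2)) =
      2 * (effVel α ρ u δ z.1 z.2 * (ρ z.1 z.2 *
        ((ut z.1 z.2 + δ⁻¹ * (ρ z.1 (z.2 + δ) ^ (α - 2) * ρt z.1 (z.2 + δ) -
          ρ z.1 z.2 ^ (α - 2) * ρt z.1 z.2)) +
        u z.1 z.2 * (ux z.1 z.2 + δ⁻¹ * (ρ z.1 (z.2 + δ) ^ (α - 2) * ρx z.1 (z.2 + δ) -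
          ρ z.1 z.2 ^ (α - 2) * ρx z.1 z.2))))) := by
    filter_upwards [h.effVel_material δ] with z hz
    rw [hz]
  have hB := (h.rho_reg.mul h.u_reg).integrableOn_mul
    (f := fun t x => effVel α ρ u δ t x * effVel α ρ u δ t x) (hVL.integrableOn_mul hVL)
  rw [h.transport (hV.mul hV) hB (hVG.congr (by
      filter_upwards [hae] with z hz
      rw [hz]
      ring))
    (h.integrable_rho_mul_sq h0 (memLp_effVel hδ hu0 hq0 hp0)) ht'
    (h.integrable_rho_mul_sq ht' (memLp_effVel hδ hu hq hp)), ← integral_const_mul]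
  refine integral_congr_ae ?_
  filter_upwards [ae_restrict_of_ae_restrict_of_subset (strip_mono ht'.2) hae] with z hz
  rw [hz]
  ring

end Sol

lemma Prim.ae_hasDerivAt_univ {f g : ℝ → ℝ} (h : Prim univ f g) :
    ∀ᵐ x, HasDerivAt f (g x) x := by
  have key : ∀ n : ℕ, ∀ᵐ x : ℝ, x ∈ uIcc (-(n : ℝ)) n → HasDerivAt f (g x) x := fun n =>
    h.ae_hasDerivAt trivial trivial
  filter_upwards [ae_all_iff.2 key] with x hx
  obtain ⟨n, hn⟩ := exists_nat_ge |x|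
  refine hx n ?_
  rw [uIcc_of_le (by linarith [abs_nonneg x])]
  exact _root_.abs_le.1 hn

/-- Fatou's lemma along `δ ↓ 0`, for families of integrable functions. -/
lemma integral_le_of_tendsto {F : ℝ → ℝ → ℝ} {f : ℝ → ℝ} {B : ℝ → ℝ} {b : ℝ}
    (hF : ∀ δ, 0 < δ → Integrable (F δ)) (hF0 : ∀ δ, 0 < δ → ∀ x, 0 ≤ F δ x)
    (hf : Integrable f) (hf0 : ∀ x, 0 ≤ f x)
    (hlim : ∀ᵐ x, Tendsto (fun δ => F δ x) (𝓝[>] 0) (𝓝 (f x)))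
    (hB : ∀ δ, 0 < δ → ∫ x, F δ x ≤ B δ) (hBb : Tendsto B (𝓝[>] 0) (𝓝 b)) :
    ∫ x, f x ≤ b := by
  set d : ℕ → ℝ := fun n => 1 / ((n : ℝ) + 1) with hd
  have hd0 : ∀ n, 0 < d n := fun n => by positivity
  have hdt : Tendsto d atTop (𝓝[>] 0) :=
    tendsto_nhdsWithin_iff.2 ⟨tendsto_one_div_add_atTop_nhds_zero_nat, .of_forall hd0⟩
  have hb0 : 0 ≤ b := ge_of_tendsto hBb (by
    filter_upwards [self_mem_nhdsWithin] with δ hδ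
    exact (integral_nonneg (hF0 δ hδ)).trans (hB δ hδ))
  have h1 : ENNReal.ofReal (∫ x, f x) ≤ ENNReal.ofReal b := by
    rw [ofReal_integral_eq_lintegral_ofReal hf (.of_forall hf0)]
    calc ∫⁻ x, ENNReal.ofReal (f x)
        = ∫⁻ x, liminf (fun n => ENNReal.ofReal (F (d n) x)) atTop := by
          refine lintegral_congr_ae ?_
          filter_upwards [hlim] with x hx
          exact ((ENNReal.continuous_ofReal.tendsto _).comp (hx.comp hdt)).liminf_eq.symm
      _ ≤ liminf (fun n => ∫⁻ x, ENNReal.ofReal (F (d n) x)) atTop :=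
          lintegral_liminf_le' fun n => (hF _ (hd0 n)).1.aemeasurable.ennreal_ofReal
      _ ≤ liminf (fun n => ENNReal.ofReal (B (d n))) atTop := by
          refine liminf_le_liminf (.of_forall fun n => ?_)
          rw [← ofReal_integral_eq_lintegral_ofReal (hF _ (hd0 n)) (.of_forall (hF0 _ (hd0 n)))]
          exact ENNReal.ofReal_le_ofReal (hB _ (hd0 n))
      _ = ENNReal.ofReal b :=
          ((ENNReal.continuous_ofReal.tendsto _).comp (hBb.comp hdt)).liminf_eq
  exact (ENNReal.ofReal_le_ofReal_iff hb0).1 h1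

namespace Sol

variable {α γ a T ρm ρp : ℝ} {ρbar : ℝ → ℝ} {ρ u ρt ρx ut ux uxx : ℝ → ℝ → ℝ}

/-- A bound at time zero independent of `δ`: the difference quotient is controlled in `L²` by the
derivative `q₀`. -/
lemma integral_effVel_zero_le (h : Sol α γ a T ρbar ρ u ρt ρx ut ux uxx) {q₀ : ℝ → ℝ} {C₀ : ℝ}
    (hC₀ : ∀ x, ρ 0 x ≤ C₀) (hu0 : MemLp (u 0) 2 volume) (hq0 : MemLp q₀ 2 volume)
    (hp0 : Prim univ (fun x => viscousPotential α (ρ 0 x)) q₀) {δ : ℝ} (hδ : 0 < δ) :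
    ∫ x, ρ 0 x * (effVel α ρ u δ 0 x * effVel α ρ u δ 0 x) ≤
      C₀ * (2 * (∫ x, u 0 x ^ 2) + 2 * ∫ x, q₀ x ^ 2) := by
  have h0 : (0 : ℝ) ∈ Icc 0 T := ⟨le_rfl, h.T_pos.le⟩
  obtain ⟨h1, h2⟩ := hp0.memLp_difference_quotient hq0 hδ
  set D : ℝ → ℝ := fun x => δ⁻¹ * (viscousPotential α (ρ 0 (x + δ)) - viscousPotential α (ρ 0 x))
  have hC : 0 ≤ C₀ := (h.rho_pos h0 0).le.trans (hC₀ 0)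
  have hmaj : Integrable fun x => C₀ * (2 * u 0 x ^ 2 + 2 * D x ^ 2) :=
    ((hu0.integrable_sq.const_mul 2).add (h1.integrable_sq.const_mul 2)).const_mul C₀
  refine (integral_mono (h.integrable_rho_mul_sq h0 (memLp_effVel hδ hu0 hq0 hp0)) hmaj
    fun x => ?_).trans ?_
  · have e : effVel α ρ u δ 0 x = u 0 x + D x := rfl
    simp only [e]
    have h3 : ρ 0 x * ((u 0 x + D x) * (u 0 x + D x)) ≤
        C₀ * ((u 0 x + D x) * (u 0 x + D x)) :=
      mul_le_mul_of_nonneg_right (hC₀ x) (mul_self_nonneg _)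
    refine h3.trans (mul_le_mul_of_nonneg_left ?_ hC)
    nlinarith [sq_nonneg (u 0 x - D x)]
  · rw [integral_const_mul, integral_add (hu0.integrable_sq.const_mul 2)
      (h1.integrable_sq.const_mul 2), integral_const_mul, integral_const_mul]
    gcongr

/-- The Bresch–Desjardins entropy estimate, uniform in the time of existence. -/
lemma entropy_bound (hbar : IsReferenceDensity ρm ρp ρbar) (ha : 0 < a) (hγ : 1 < γ) (T₀ : ℝ)
    (ρ u : ℝ → ℝ → ℝ) {q₀ : ℝ → ℝ} {C₀ : ℝ} (hC₀ : ∀ x, 0 < ρ 0 x ∧ ρ 0 x ≤ C₀)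
    (hu0 : MemLp (u 0) 2 volume) (hq0 : MemLp q₀ 2 volume)
    (hp0 : Prim univ (fun x => viscousPotential α (ρ 0 x)) q₀)
    (hu0' : Integrable fun x => ρ 0 x * u 0 x ^ 2)
    (hρ0 : Integrable fun x => relEnergy a γ (ρ 0 x) (ρbar x)) :
    ∃ K : ℝ, 0 ≤ K ∧ ∀ T ≤ T₀, ∀ ρt ρx ut ux uxx, Sol α γ a T ρbar ρ u ρt ρx ut ux uxx →
      ∀ᵐ t ∂volume.restrict (Ioo 0 T), ∫ x, ρ t x * (ρ t x ^ (α - 2) * ρx t x) ^ 2 ≤ K := by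
  obtain ⟨K, hK0, hK⟩ := energy_bound (α := α) hbar ha hγ T₀ ρ u hu0' hρ0
  set I₀ := C₀ * (2 * (∫ x, u 0 x ^ 2) + 2 * ∫ x, q₀ x ^ 2) with hI₀
  set R := ∫ x, relEnergy a γ (ρ 0 x) (ρbar x) with hR
  have hC : 0 ≤ C₀ := (hC₀ 0).1.le.trans (hC₀ 0).2
  have hI₀' : 0 ≤ I₀ := by
    have h1 : 0 ≤ ∫ x, u 0 x ^ 2 := integral_nonneg fun x => sq_nonneg _
    have h2 : 0 ≤ ∫ x, q₀ x ^ 2 := integral_nonneg fun x => sq_nonneg _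
    positivity
  have hR' : 0 ≤ R := integral_nonneg fun x =>
    relEnergy_nonneg ha hγ (hC₀ x).1 (reference_pos hbar x)
  -- With `q = ρ^(α-2) ρ_x`, the bound on `∫ ρ (u + q)²` is `I₀ + 2 (R + K)`, and `q² ≤ 2 (u + q)² +
  -- 2 u²`.
  refine ⟨2 * (I₀ + 2 * (R + K)) + 2 * K, by positivity, fun T hT ρt ρx ut ux uxx h => ?_⟩
  have hqL := h.rhox_L2.memL2L2.bdd_mul (h.exists_reg_rpow (α - 2))
  have hPw := h.integrable_pressure_work 0
  simp only [zero_add, pow_one] at hPw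
  have hPq : IntegrableOn (fun z : ℝ × ℝ => (ρ z.1 z.2 ^ (α - 2) * ρx z.1 z.2) *
      (a * γ * ρ z.1 z.2 ^ (γ - 1) * ρx z.1 z.2)) (strip T) :=
    hqL.integrableOn_mul
      (h.rhox_L2.memL2L2.bdd_mul ((h.exists_reg_rpow (γ - 1)).const_mul (a * γ)))
  filter_upwards [hK T hT ρt ρx ut ux uxx h, h.effVel_balance hu0 hq0 hp0,
    h.potential_balance hbar ha hγ hρ0, memLp_slice h.u_L2.memL2L2,
    h.reg_viscousPotential.prim_x, memLp_slice hqL, ae_restrict_mem measurableSet_Ioo]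
    with t ⟨hK1, _, _, hK4⟩ hbal ⟨_, hpot⟩ hu hp hq ht
  have ht' := Ioo_subset_Icc_self ht
  have hlim := (h.tendsto_effVel.integral_mul h.tendsto_effForce ht'.2)
  set J := ∫ z in strip t, (u z.1 z.2 + ρ z.1 z.2 ^ (α - 2) * ρx z.1 z.2) *
    -(a * γ * ρ z.1 z.2 ^ (γ - 1) * ρx z.1 z.2) with hJ
  -- The pressure work against `u` is evaluated by the balance of the relative energy, whose final
  -- value is dropped by sign. The work against `ρ^(α-2) ρ_x` is a nonnegative multiple of `ρ_x²`
  -- and enters `J` with a minus sign.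
  have hJle : J ≤ R + K := by
    have e : J = -(∫ z in strip t, u z.1 z.2 * (a * γ * ρ z.1 z.2 ^ (γ - 1) * ρx z.1 z.2)) -
        ∫ z in strip t, (ρ z.1 z.2 ^ (α - 2) * ρx z.1 z.2) *
          (a * γ * ρ z.1 z.2 ^ (γ - 1) * ρx z.1 z.2) := by
      have e1 := integral_add (hPw.mono_set (strip_mono ht'.2)) (hPq.mono_set (strip_mono ht'.2))
      rw [← neg_add', ← e1, ← integral_neg, hJ]
      congr 1
      ext z
      ring
    have h1 : 0 ≤ ∫ z in strip t, (ρ z.1 z.2 ^ (α - 2) * ρx z.1 z.2) *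
          (a * γ * ρ z.1 z.2 ^ (γ - 1) * ρx z.1 z.2) := by
      refine setIntegral_nonneg (measurableSet_strip t) fun z hz => ?_
      have hpos := h.rho_pos (Ioo_subset_Icc_self (strip_mono ht'.2 hz).1) z.2
      have : 0 < γ := by linarith
      calc 0 ≤ (ρ z.1 z.2 ^ (α - 2) * (a * γ * ρ z.1 z.2 ^ (γ - 1))) * ρx z.1 z.2 ^ 2 := by
            positivity
        _ = _ := by ring
    have h2 : 0 ≤ ∫ x, relEnergy a γ (ρ t x) (ρbar x) := integral_nonneg fun x =>
      relEnergy_nonneg ha hγ (h.rho_pos ht' x) (reference_pos hbar x)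
    linarith
  have hV : MemLp (fun x => u t x + ρ t x ^ (α - 2) * ρx t x) 2 volume := hu.add hq
  -- The limit `δ ↓ 0`: Fatou on the left, convergence of products in `L²` on the right.
  have hmain : ∫ x, ρ t x * ((u t x + ρ t x ^ (α - 2) * ρx t x) *
      (u t x + ρ t x ^ (α - 2) * ρx t x)) ≤ I₀ + 2 * J := by
    refine integral_le_of_tendsto
      (F := fun δ x => ρ t x * (effVel α ρ u δ t x * effVel α ρ u δ t x))
      (B := fun δ => I₀ + 2 * ∫ z in strip t, effVel α ρ u δ z.1 z.2 *
        (ρ z.1 z.2 * effForce α ρ u ρx ut ux δ z.1 z.2))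
      (fun δ hδ => h.integrable_rho_mul_sq ht' (memLp_effVel hδ hu hq hp))
      (fun δ _ x => mul_nonneg (h.rho_pos ht' x).le (mul_self_nonneg _))
      (h.integrable_rho_mul_sq ht' hV)
      (fun x => mul_nonneg (h.rho_pos ht' x).le (mul_self_nonneg _)) ?_ (fun δ hδ => ?_)
      (tendsto_const_nhds.add (tendsto_const_nhds.mul hlim))
    · filter_upwards [hp.ae_hasDerivAt_univ] with x hx
      have h1 : Tendsto (fun δ => effVel α ρ u δ t x) (𝓝[>] 0)
          (𝓝 (u t x + ρ t x ^ (α - 2) * ρx t x)) :=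
        tendsto_const_nhds.add hx.tendsto_slope_zero_right
      exact tendsto_const_nhds.mul (h1.mul h1)
    · have h1 := hbal δ hδ
      have h2 := h.integral_effVel_zero_le (fun x => (hC₀ x).2) hu0 hq0 hp0 hδ
      linarith
  have hi1 := h.integrable_rho_mul_sq ht' hV
  have hi2 := h.integrable_rho_mul_sq ht' hu
  have hi3 := h.integrable_rho_mul_sq ht' hq
  calc ∫ x, ρ t x * (ρ t x ^ (α - 2) * ρx t x) ^ 2
      ≤ ∫ x, (2 * (ρ t x * ((u t x + ρ t x ^ (α - 2) * ρx t x) *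
      (u t x + ρ t x ^ (α - 2) * ρx t x))) + 2 * (ρ t x * (u t x * u t x))) := by
        refine integral_mono ?_ ((hi1.const_mul 2).add (hi2.const_mul 2)) fun x => ?_
        · refine hi3.congr (.of_forall fun x => ?_)
          ring
        · have hpos := h.rho_pos ht' x
          have h3 : (ρ t x ^ (α - 2) * ρx t x) ^ 2 ≤
              2 * ((u t x + ρ t x ^ (α - 2) * ρx t x) * (u t x + ρ t x ^ (α - 2) * ρx t x)) +
              2 * (u t x * u t x) := by
            nlinarith [sq_nonneg (2 * u t x + ρ t x ^ (α - 2) * ρx t x)]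
          calc _ ≤ ρ t x * (2 * ((u t x + ρ t x ^ (α - 2) * ρx t x) *
                (u t x + ρ t x ^ (α - 2) * ρx t x)) + 2 * (u t x * u t x)) := by gcongr
            _ = _ := by ring
    _ = 2 * (∫ x, ρ t x * ((u t x + ρ t x ^ (α - 2) * ρx t x) *
      (u t x + ρ t x ^ (α - 2) * ρx t x))) + 2 * ∫ x, ρ t x * (u t x * u t x) := by
        rw [integral_add (hi1.const_mul 2) (hi2.const_mul 2), integral_const_mul,
          integral_const_mul]
    _ ≤ _ := by
        have e : ∫ x, ρ t x * (u t x * u t x) = ∫ x, ρ t x * u t x ^ 2 := by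
          congr 1; ext x; ring
        rw [e]
        linarith

end Sol

/-! ### Upper bound on the density and propagation of moments -/

lemma rpow_le_one_add {r p : ℝ} (hr : 0 ≤ r) (hp : 0 ≤ p) (hp1 : p ≤ 1) : r ^ p ≤ 1 + r := by
  rcases le_total r 1 with h | h
  · exact (Real.rpow_le_one hr h hp).trans (by linarith)
  · calc r ^ p ≤ r ^ (1 : ℝ) := Real.rpow_le_rpow_of_exponent_le h hp1
      _ ≤ _ := by rw [Real.rpow_one]; linarith

lemma intervalIntegral_le_of_le {F G : ℝ → ℝ} {c : ℝ} (x : ℝ)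
    (hF : IntervalIntegrable F volume x (x + 1)) (hG : Integrable G)
    (hG0 : ∀ y, 0 ≤ G y) (h : ∀ y, F y ≤ c + G y) :
    ∫ y in x..(x + 1), F y ≤ c + ∫ y, G y := by
  have hx : x ≤ x + 1 := by linarith
  have h1 := intervalIntegral.integral_mono_on hx hF
    ((intervalIntegrable_const (c := c)).add hG.intervalIntegrable) fun y _ => h y
  rw [intervalIntegral.integral_add (by simp) hG.intervalIntegrable] at h1
  have h2 : ∫ y in x..(x + 1), G y ≤ ∫ y, G y := by
    rw [intervalIntegral.integral_of_le hx]
    exact setIntegral_le_integral hG (.of_forall hG0)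
  simp only [intervalIntegral.integral_const, smul_eq_mul, add_sub_cancel_left, one_mul] at h1
  linarith

lemma intervalIntegral_abs_le_sqrt {g : ℝ → ℝ} (hg : MemLp g 2 volume) {K : ℝ}
    (hK : ∫ y, g y ^ 2 ≤ K) (x : ℝ) : ∫ y in x..(x + 1), |g y| ≤ √K :=
  Real.le_sqrt_of_sq_le ((sq_intervalIntegral_abs_le_integral hg x).trans hK)

namespace Sol

variable {α γ a T ρm ρp : ℝ} {ρbar : ℝ → ℝ} {ρ u ρt ρx ut ux uxx : ℝ → ℝ → ℝ}

/-- Upper bound for the density in terms of the energy and the entropy. -/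
lemma exists_density_bound (hα : 1 / 2 < α) (hα' : α ≤ 1) (hbar : IsReferenceDensity ρm ρp ρbar)
    (ha : 0 < a) (hγ : 1 < γ) (K : ℝ) :
    ∃ M : ℝ, 0 < M ∧ ∀ (T : ℝ) (ρ u ρt ρx ut ux uxx : ℝ → ℝ → ℝ),
      Sol α γ a T ρbar ρ u ρt ρx ut ux uxx →
      (∀ᵐ t ∂volume.restrict (Ioo 0 T), ∫ x, relEnergy a γ (ρ t x) (ρbar x) ≤ K) →
      (∀ᵐ t ∂volume.restrict (Ioo 0 T), ∫ x, ρ t x * (ρ t x ^ (α - 2) * ρx t x) ^ 2 ≤ K) →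
      ∀ t ∈ Icc 0 T, ∀ x, ρ t x ≤ M := by
  obtain ⟨C, hC0, hC⟩ := relEnergy_coercive (M := max ρm ρp) ha hγ
    (lt_min hbar.left_pos hbar.right_pos)
  -- For this exponent the squared derivative of `ρ^p` is exactly `p²` times the entropy density; `α
  -- > 1/2` makes `p` positive, so that a bound on `ρ^p` bounds `ρ`.
  set p := α - 1 / 2 with hp
  have hp0 : 0 < p := by linarith
  set N := (1 + C + C * |K|) + √(p ^ 2 * |K|) with hN
  have hN0 : 0 < N := by positivity
  refine ⟨N ^ p⁻¹, by positivity, fun T ρ u ρt ρx ut ux uxx h hE hB t ht x => ?_⟩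
  refine le_of_ae_le h.T_pos (f := fun t => ρ t x) (h.rho_reg.cont.comp
    (f := fun t : ℝ => (t, x)) (by fun_prop) fun t ht => ⟨ht, trivial⟩) ?_ t ht
  filter_upwards [hE, hB, (h.exists_reg_rpow p).prim_x,
    integrable_slice (f := fun t x => relEnergy a γ (ρ t x) (ρbar x))
      (h.integrable_relEnergy hbar ha hγ),
    memLp_slice (h.rhox_L2.memL2L2.bdd_mul ((h.exists_reg_rpow (p - 1)).const_mul p)),
    ae_restrict_mem measurableSet_Ioo] with t h1 h2 h3 h4 h5 ht
  have ht' := Ioo_subset_Icc_self ht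
  have h6 : ∫ y, (p * ρ t y ^ (p - 1) * ρx t y) ^ 2 ≤ p ^ 2 * |K| := by
    have e : ∀ y, (p * ρ t y ^ (p - 1) * ρx t y) ^ 2 =
        p ^ 2 * (ρ t y * (ρ t y ^ (α - 2) * ρx t y) ^ 2) := fun y => by
      have hpos := h.rho_pos ht' y
      have e1 : (ρ t y ^ (p - 1)) ^ 2 = ρ t y * (ρ t y ^ (α - 2)) ^ 2 := by
        rw [← Real.rpow_natCast, ← Real.rpow_natCast, ← Real.rpow_mul hpos.le,
          ← Real.rpow_mul hpos.le, ← Real.rpow_one_add' hpos.le (by push_cast; linarith)]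
        congr 1
        push_cast
        rw [hp]
        ring
      calc _ = p ^ 2 * ((ρ t y ^ (p - 1)) ^ 2 * ρx t y ^ 2) := by ring
        _ = _ := by rw [e1]; ring
    simp only [e]
    rw [integral_const_mul]
    gcongr
    exact h2.trans (le_abs_self K)
  have h7 := h3.abs_le x
  have h8 := intervalIntegral_abs_le_sqrt h5 h6 x
  have hrc := h3.continuous
  -- The local integral of `ρ^p` is controlled through `ρ^p ≤ 1 + ρ` and coercivity of the relative
  -- energy.
  have h9 := intervalIntegral_le_of_le (c := 1 + C) x (hrc.abs.intervalIntegrable _ _)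
    (h4.const_mul C) (fun y => mul_nonneg hC0.le
      (relEnergy_nonneg ha hγ (h.rho_pos ht' y) (reference_pos hbar y))) fun y => by
    have hpos := h.rho_pos ht' y
    rw [abs_of_pos (Real.rpow_pos_of_pos hpos p)]
    have := rpow_le_one_add (p := p) hpos.le hp0.le (by linarith)
    have := hC _ _ hpos (reference_bounds hbar y).1 (reference_bounds hbar y).2
    linarith
  rw [integral_const_mul] at h9
  have h10 : C * ∫ y, relEnergy a γ (ρ t y) (ρbar y) ≤ C * |K| := by
    gcongr
    exact h1.trans (le_abs_self K)
  have hpos := h.rho_pos ht' x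
  have h11 : ρ t x ^ p ≤ N := by
    rw [abs_of_pos (Real.rpow_pos_of_pos hpos p)] at h7
    linarith
  calc ρ t x = (ρ t x ^ p) ^ p⁻¹ := by rw [← Real.rpow_mul hpos.le, mul_inv_cancel₀ hp0.ne',
        Real.rpow_one]
    _ ≤ _ := by gcongr

/-- Propagation of the even moments of the velocity. -/
lemma moment_step (h : Sol α γ a T ρbar ρ u ρt ρx ut ux uxx) (hα' : α ≤ 1) (ha : 0 < a)
    (hγ : 1 < γ) {M K : ℝ} (hM : ∀ t ∈ Icc 0 T, ∀ x, ρ t x ≤ M) {k : ℕ} (hk : Even k) (hk2 : 2 ≤ k)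
    (h0 : Integrable fun x => ρ 0 x * u 0 x ^ (k + 2))
    (hK : ∀ᵐ t ∂volume.restrict (Ioo 0 T), ∫ x, ρ t x * u t x ^ k ≤ K) :
    ∀ᵐ t ∂volume.restrict (Ioo 0 T), ∫ x, ρ t x * u t x ^ (k + 2) ≤
      (∫ x, ρ 0 x * u 0 x ^ (k + 2)) +
        (k + 2) * (k + 1) * (a ^ 2 / 2 * M ^ (2 * γ - α - 1) * (T * |K|)) := by
  -- Two powers of `u` are set aside to provide integrability through `L²`.
  obtain ⟨j, rfl⟩ : ∃ j, k = j + 2 := ⟨k - 2, by omega⟩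
  obtain ⟨_, _, hj1⟩ := h.u_reg.exists_pow (j + 1)
  have huL := h.u_L2.memL2L2
  have huu := huL.integrableOn_mul huL
  have hP := (h.exists_reg_rpow γ).const_mul a
  have hD := h.integrable_dissipation (j + 2)
  have hPx := h.integrable_pressure_work (j + 2)
  have hm := h.integrable_pow_mul j
  have hKi : IntegrableOn (fun z : ℝ × ℝ => u z.1 z.2 ^ (j + 2 + 1) * (a * ρ z.1 z.2 ^ γ))
      (strip T) :=
    ((hj1.mul hP).integrableOn_mul (f := fun t x => u t x * u t x) huu).congr
      (.of_forall fun z => by ring)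
  have hGi : IntegrableOn (fun z : ℝ × ℝ => u z.1 z.2 ^ (j + 2) * (a * ρ z.1 z.2 ^ γ) *
      ux z.1 z.2) (strip T) :=
    ((hj1.mul hP).integrableOn_mul (f := fun t x => u t x * ux t x)
      (huL.integrableOn_mul h.ux_L2.memL2L2)).congr (.of_forall fun z => by ring)
  have hGi' : IntegrableOn (fun z : ℝ × ℝ => -(((j + 2 : ℕ) : ℝ) + 1) *
      (u z.1 z.2 ^ (j + 2) * (a * ρ z.1 z.2 ^ γ) * ux z.1 z.2)) (strip T) := hGi.const_mul _
  have hKP := (h.u_reg.pow (j + 2)).mul hP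
  have hKxi : IntegrableOn (fun z : ℝ × ℝ =>
      ((((j + 2 : ℕ) : ℝ) + 1) * u z.1 z.2 ^ (j + 2) * ux z.1 z.2) * (a * ρ z.1 z.2 ^ γ) +
        u z.1 z.2 ^ (j + 2 + 1) * (a * (γ * ρ z.1 z.2 ^ (γ - 1) * ρx z.1 z.2))) (strip T) := by
    refine ((hGi.const_mul (((j + 2 : ℕ) : ℝ) + 1)).add hPx).congr (.of_forall fun z => ?_)
    simp only [Pi.add_apply]
    ring
  have hlow := integrableOn_integral_slice (f := fun t x => ρ t x * u t x ^ (j + 2)) hm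
  filter_upwards [h.velocity_moment (j + 2) h0, ae_restrict_mem measurableSet_Ioo]
    with t ⟨_, hvm⟩ ht
  have ht' := Ioo_subset_Icc_self ht
  have hst := strip_mono ht'.2
  -- Integration by parts moves the derivative from the pressure to `u^(k+1)`, `k = j + 2`, with no
  -- boundary contribution.
  have hIBP := (integral_strip_eq_of_divergence ht'.2
    (F := fun t x => u t x ^ (j + 2 + 1) * (a * γ * ρ t x ^ (γ - 1) * ρx t x))
    (G := fun t x => -(((j + 2 : ℕ) : ℝ) + 1) * (u t x ^ (j + 2) * (a * ρ t x ^ γ) * ux t x))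
    (by filter_upwards [hKP.prim_x] with t ht using ⟨_, .rfl, ht⟩) hKi hKxi hGi'
    (.of_forall fun z => by ring)).2
  -- Young's inequality against the dissipation leaves `ρ^(2γ-α) u^k = ρ^(2γ-α-1) (ρ u^k)`. The
  -- exponent `2γ - α - 1` is positive because `γ > 1 ≥ α`, so the density bound applies. The
  -- dissipation coefficient `1` suffices, since both terms carry the factor `(k+2)(k+1)`.
  have hpt : ∀ z ∈ strip t, u z.1 z.2 ^ (j + 2) * (a * ρ z.1 z.2 ^ γ) * ux z.1 z.2 ≤
      u z.1 z.2 ^ (j + 2) * (ρ z.1 z.2 ^ α * ux z.1 z.2 ^ 2) +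
      a ^ 2 / 2 * M ^ (2 * γ - α - 1) * (ρ z.1 z.2 * u z.1 z.2 ^ (j + 2)) := fun z hz => by
    have hzT := Ioo_subset_Icc_self (hst hz).1
    have hpos := h.rho_pos hzT z.2
    have e1 : ρ z.1 z.2 ^ γ * ρ z.1 z.2 ^ γ =
        ρ z.1 z.2 ^ α * (ρ z.1 z.2 ^ (2 * γ - α - 1) * ρ z.1 z.2) := by
      rw [← Real.rpow_add_one hpos.ne', ← Real.rpow_add hpos, ← Real.rpow_add hpos]
      congr 1
      ring
    have h1 : ρ z.1 z.2 ^ (2 * γ - α - 1) ≤ M ^ (2 * γ - α - 1) :=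
      Real.rpow_le_rpow hpos.le (hM _ hzT _) (by linarith)
    have hu0 : 0 ≤ u z.1 z.2 ^ (j + 2) := hk.pow_nonneg _
    have hα0 := Real.rpow_pos_of_pos hpos α
    have h2 : a * ρ z.1 z.2 ^ γ * ux z.1 z.2 ≤ ρ z.1 z.2 ^ α * ux z.1 z.2 ^ 2 +
        a ^ 2 / 2 * (ρ z.1 z.2 ^ (2 * γ - α - 1) * ρ z.1 z.2) := by
      refine le_of_mul_le_mul_left ?_ hα0
      have h3 := sq_nonneg (a * ρ z.1 z.2 ^ γ - ρ z.1 z.2 ^ α * ux z.1 z.2)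
      have h4 := sq_nonneg (ρ z.1 z.2 ^ α * ux z.1 z.2)
      linear_combination h3 / 2 + h4 / 2 + a ^ 2 / 2 * e1
    have h3 : a ^ 2 / 2 * (ρ z.1 z.2 ^ (2 * γ - α - 1) * ρ z.1 z.2) ≤
        a ^ 2 / 2 * (M ^ (2 * γ - α - 1) * ρ z.1 z.2) := by gcongr
    calc _ = u z.1 z.2 ^ (j + 2) * (a * ρ z.1 z.2 ^ γ * ux z.1 z.2) := by ring
      _ ≤ u z.1 z.2 ^ (j + 2) * (ρ z.1 z.2 ^ α * ux z.1 z.2 ^ 2 +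
        a ^ 2 / 2 * (M ^ (2 * γ - α - 1) * ρ z.1 z.2)) := by gcongr; linarith
      _ = _ := by ring
  have hInt := setIntegral_mono_on (hGi.mono_set hst)
    ((hD.mono_set hst).add ((hm.mono_set hst).const_mul (a ^ 2 / 2 * M ^ (2 * γ - α - 1))))
    (measurableSet_strip t) hpt
  have hadd := integral_add (hD.mono_set hst)
    ((hm.mono_set hst).const_mul (a ^ 2 / 2 * M ^ (2 * γ - α - 1)))
  rw [integral_const_mul] at hadd
  have hmom : ∫ z in strip t, ρ z.1 z.2 * u z.1 z.2 ^ (j + 2) ≤ T * |K| := by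
    rw [integral_strip_eq (f := fun t x => ρ t x * u t x ^ (j + 2)) (hm.mono_set hst)]
    have h1 : ∫ s in Ioo 0 t, ∫ x, ρ s x * u s x ^ (j + 2) ≤ ∫ s in Ioo 0 t, |K| := by
      refine setIntegral_mono_ae_restrict (hlow.mono_set (Ioo_subset_Ioo_right ht'.2))
        (integrableOn_const (by simp)) ?_
      filter_upwards [ae_restrict_of_ae_restrict_of_subset (Ioo_subset_Ioo_right ht'.2) hK]
        with s hs using hs.trans (le_abs_self K)
    refine h1.trans ?_
    rw [setIntegral_const]
    simp only [Real.volume_real_Ioo_of_le ht'.1, sub_zero, smul_eq_mul]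
    gcongr
    exact ht'.2
  have hM0 : 0 ≤ M := (h.rho_pos ht' 0).le.trans (hM t ht' 0)
  have hfin : a ^ 2 / 2 * M ^ (2 * γ - α - 1) *
      ∫ z in strip t, ρ z.1 z.2 * u z.1 z.2 ^ (j + 2) ≤
      a ^ 2 / 2 * M ^ (2 * γ - α - 1) * (T * |K|) := by gcongr
  rw [integral_const_mul] at hIBP
  rw [hIBP] at hvm
  set D := ∫ z in strip t, u z.1 z.2 ^ (j + 2) * (ρ z.1 z.2 ^ α * ux z.1 z.2 ^ 2)
  set W := ∫ z in strip t, u z.1 z.2 ^ (j + 2) * (a * ρ z.1 z.2 ^ γ) * ux z.1 z.2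
  have hW : W ≤ D + a ^ 2 / 2 * M ^ (2 * γ - α - 1) * (T * |K|) := by
    refine hInt.trans ?_
    simp only [Pi.add_apply]
    rw [hadd]
    linarith
  have hc : (0 : ℝ) ≤ (((j + 2 : ℕ) : ℝ) + 2) * (((j + 2 : ℕ) : ℝ) + 1) := by positivity
  have := mul_le_mul_of_nonneg_left hW hc
  linarith

end Sol

/-! ### Uniform moments and the supremum of the weighted velocity -/

lemma MemLp.intervalIntegrable {f : ℝ → ℝ} (hf : MemLp f 2 volume) (x y : ℝ) :
    IntervalIntegrable f volume x y :=
  ((hf.locallyIntegrable one_le_two).integrableOn_isCompact isCompact_uIcc).intervalIntegrable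

lemma abs_le_one_add_sq (y : ℝ) : |y| ≤ 1 + y ^ 2 := by
  nlinarith [sq_nonneg (|y| - 1), sq_abs y, abs_nonneg y]

/-- Interpolation between `1` and a high moment. -/
lemma rpow_mul_sq_le_moment {r v s M : ℝ} {m : ℕ} (hr : 0 < r) (hrM : r ≤ M) (hm : 1 ≤ m)
    (hs : (m : ℝ)⁻¹ ≤ s) :
    r ^ s * v ^ 2 ≤ M ^ (s - (m : ℝ)⁻¹) * (1 + r * v ^ (2 * m)) := by
  have hm0 : (m : ℝ) ≠ 0 := by positivity
  have e : (r * v ^ (2 * m)) ^ (m : ℝ)⁻¹ = r ^ (m : ℝ)⁻¹ * v ^ 2 := by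
    rw [pow_mul, Real.mul_rpow hr.le (by positivity), ← Real.rpow_natCast (v ^ 2) m,
      ← Real.rpow_mul (sq_nonneg v), mul_inv_cancel₀ hm0, Real.rpow_one]
  have h1 : 0 ≤ r * v ^ (2 * m) := by
    rw [pow_mul]
    positivity
  have h2 := rpow_le_one_add (p := (m : ℝ)⁻¹) h1 (by positivity)
    (inv_le_one_of_one_le₀ (by exact_mod_cast hm))
  have h3 : r ^ (s - (m : ℝ)⁻¹) ≤ M ^ (s - (m : ℝ)⁻¹) :=
    Real.rpow_le_rpow hr.le hrM (by linarith)
  -- The moment is raised to the power `1/m ≤ 1`; the surplus power of `r` is nonnegative and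
  -- bounded through `M`.
  calc r ^ s * v ^ 2 = r ^ (s - (m : ℝ)⁻¹) * (r * v ^ (2 * m)) ^ (m : ℝ)⁻¹ := by
        rw [e, ← mul_assoc, ← Real.rpow_add hr]
        congr 2
        ring
    _ ≤ _ := by
        have : 0 ≤ M := hr.le.trans hrM
        gcongr

namespace Sol

variable {α γ a T ρm ρp : ℝ} {ρbar : ℝ → ℝ} {ρ u ρt ρx ut ux uxx : ℝ → ℝ → ℝ}

/-- Uniform bounds for all even moments of the velocity. -/
lemma moment_bound (hα' : α ≤ 1) (ha : 0 < a) (hγ : 1 < γ) {T₀ M K : ℝ} (ρ u : ℝ → ℝ → ℝ)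
    (h0 : ∀ k : ℕ, Integrable fun x => ρ 0 x * u 0 x ^ (k + 2)) (hM0 : 0 ≤ M)
    (hM : ∀ T ≤ T₀, ∀ ρt ρx ut ux uxx, Sol α γ a T ρbar ρ u ρt ρx ut ux uxx →
      ∀ t ∈ Icc 0 T, ∀ x, ρ t x ≤ M)
    (hK : ∀ T ≤ T₀, ∀ ρt ρx ut ux uxx, Sol α γ a T ρbar ρ u ρt ρx ut ux uxx →
      ∀ᵐ t ∂volume.restrict (Ioo 0 T), ∫ x, ρ t x * u t x ^ 2 ≤ K) (m : ℕ) :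
    ∃ K' : ℝ, ∀ T ≤ T₀, ∀ ρt ρx ut ux uxx, Sol α γ a T ρbar ρ u ρt ρx ut ux uxx →
      ∀ᵐ t ∂volume.restrict (Ioo 0 T), ∫ x, ρ t x * u t x ^ (2 * (m + 1)) ≤ K' := by
  induction m with
  | zero => exact ⟨K, by simpa using hK⟩
  | succ m ih =>
    obtain ⟨K', hK'⟩ := ih
    refine ⟨(∫ x, ρ 0 x * u 0 x ^ (2 * (m + 1) + 2)) + ((2 * (m + 1) : ℕ) + 2) *
      ((2 * (m + 1) : ℕ) + 1) * (a ^ 2 / 2 * M ^ (2 * γ - α - 1) * (T₀ * |K'|)),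
      fun T hT ρt ρx ut ux uxx h => ?_⟩
    filter_upwards [h.moment_step hα' ha hγ (hM T hT _ _ _ _ _ h) (even_two_mul (m + 1)) (by omega)
      (h0 _) (hK' T hT _ _ _ _ _ h)] with t ht
    rw [show 2 * (m + 1 + 1) = 2 * (m + 1) + 2 by ring]
    refine ht.trans ?_
    gcongr

set_option maxHeartbeats 1000000 in
/-- The supremum of `ρ ^ (1/2 + ε) u` is controlled by the dissipation. -/
lemma exists_sup_bound (hα' : α ≤ 1) {ε : ℝ} (hε : 0 < ε) (M K : ℝ) {m : ℕ} (hm1 : 1 ≤ m)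
    (hm : (m : ℝ)⁻¹ ≤ 2 * (1 + ε - α)) :
    ∃ C : ℝ, 0 ≤ C ∧ ∀ (T : ℝ) (ρ u ρt ρx ut ux uxx : ℝ → ℝ → ℝ),
      Sol α γ a T ρbar ρ u ρt ρx ut ux uxx → (∀ t ∈ Icc 0 T, ∀ x, ρ t x ≤ M) →
      (∀ᵐ t ∂volume.restrict (Ioo 0 T), ∫ x, ρ t x * u t x ^ 2 ≤ K) →
      (∀ᵐ t ∂volume.restrict (Ioo 0 T), ∫ x, ρ t x * (ρ t x ^ (α - 2) * ρx t x) ^ 2 ≤ K) →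
      (∀ᵐ t ∂volume.restrict (Ioo 0 T), ∫ x, ρ t x * u t x ^ (2 * m) ≤ K) →
      ∀ᵐ t ∂volume.restrict (Ioo 0 T), ∀ x,
        (ρ t x ^ (1 / 2 + ε) * u t x) ^ 2 ≤ C * (1 + ∫ y, ρ t y ^ α * ux t y ^ 2) := by
  set β := 1 / 2 + ε with hβ
  set M' := |M| ^ (2 * (1 + ε - α) - (m : ℝ)⁻¹) with hM'
  have hM'0 : 0 ≤ M' := by positivity
  set N := (1 + |M| ^ (2 * ε) * |K|) + β * (M' + (|K| + M' * |K|)) with hN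
  have hN0 : 0 ≤ N := by positivity
  set X := |M| ^ (2 * β - α) with hX
  have hX0 : 0 ≤ X := by positivity
  -- From `|ρ^β u| ≤ N + √(X D)`, with `D` the dissipation at time `t`.
  refine ⟨2 * N ^ 2 + 2 * X, by positivity, fun T ρ u ρt ρx ut ux uxx h hM hE hB hm' => ?_⟩
  obtain ⟨j, rfl⟩ : ∃ j, m = j + 1 := ⟨m - 1, by omega⟩
  have hdis := h.integrable_dissipation 0
  simp only [pow_zero, one_mul] at hdis
  filter_upwards [hE, hB, hm', ((h.exists_reg_rpow β).mul h.u_reg).prim_x,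
    integrable_slice (f := fun t x => ρ t x * u t x ^ (0 + 2)) (h.integrable_pow_mul 0),
    integrable_slice (f := fun t x => ρ t x * u t x ^ (2 * j + 2)) (h.integrable_pow_mul (2 * j)),
    memLp_slice (h.rhox_L2.memL2L2.bdd_mul (h.exists_reg_rpow (α - 2))),
    memLp_slice (h.ux_L2.memL2L2.bdd_mul (h.exists_reg_rpow β)),
    integrable_slice (f := fun t x => ρ t x ^ α * ux t x ^ 2) hdis,
    ae_restrict_mem measurableSet_Ioo] with t h1 h2 h3 hp i1 i2 l1 l2 i3 ht x
  have ht' := Ioo_subset_Icc_self ht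
  have hpos := h.rho_pos ht'
  have hMM : ∀ y, ρ t y ≤ |M| := fun y => (hM t ht' y).trans (le_abs_self M)
  simp only [zero_add] at i1
  rw [show 2 * j + 2 = 2 * (j + 1) by ring] at i2
  have iA : Integrable fun y => ρ t y * (ρ t y ^ (α - 2) * ρx t y) ^ 2 :=
    (h.integrable_rho_mul_sq ht' l1).congr (.of_forall fun y => by ring)
  have hA : ∀ y, 0 ≤ ρ t y * (ρ t y ^ (α - 2) * ρx t y) ^ 2 := fun y =>
    mul_nonneg (hpos y).le (sq_nonneg _)
  have hU : ∀ y, 0 ≤ ρ t y * u t y ^ (2 * (j + 1)) := fun y => by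
    rw [pow_mul]
    have := hpos y
    positivity
  -- The square of `ρ^β u` is `ρ^(2ε)` times the kinetic energy density.
  have b1 : ∫ y in x..(x + 1), |ρ t y ^ β * u t y| ≤ 1 + |M| ^ (2 * ε) * |K| := by
    refine (intervalIntegral_le_of_le (c := 1) x (hp.continuous.abs.intervalIntegrable _ _)
      (i1.const_mul (|M| ^ (2 * ε))) (fun y => ?_) fun y => ?_).trans ?_
    · have := hpos y
      positivity
    · refine (abs_le_one_add_sq _).trans (add_le_add_right ?_ _)
      have e : (ρ t y ^ β * u t y) ^ 2 = ρ t y ^ (2 * ε) * (ρ t y * u t y ^ 2) := by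
        have e1 : (ρ t y ^ β) ^ 2 = ρ t y ^ (2 * ε) * ρ t y := by
          rw [← Real.rpow_natCast, ← Real.rpow_mul (hpos y).le, ← Real.rpow_add_one (hpos y).ne']
          congr 1
          push_cast
          rw [hβ]
          ring
        rw [mul_pow, e1]
        ring
      rw [e]
      have := (hpos y).le
      gcongr
      exact hMM y
    · rw [integral_const_mul]
      gcongr
      exact h1.trans (le_abs_self K)
  have hfi := (hp x trivial (x + 1) trivial).1
  have l2i := MemLp.intervalIntegrable l2 x (x + 1)
  have hp1i : IntervalIntegrable (fun y => β * ρ t y ^ (β - 1) * ρx t y * u t y) volume x (x + 1) := by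
    refine (hfi.sub l2i).congr fun y _ => ?_
    ring
  have b2 : ∫ y in x..(x + 1), |β * ρ t y ^ (β - 1) * ρx t y * u t y| ≤
      β * (M' + (|K| + M' * |K|)) := by
    refine (intervalIntegral_le_of_le (c := β * M') x hp1i.abs
      ((iA.add (i2.const_mul M')).const_mul β) (fun y => ?_) fun y => ?_).trans ?_
    · have := hA y
      have := hU y
      simp only [Pi.add_apply]
      positivity
    -- The exponents satisfy `β - 1 = 1/2 + (α - 2) + (1 + ε - α)`: one factor is the square root of
    -- the entropy density, the other is controlled by the moment of order `2m`.
    · have e : β * ρ t y ^ (β - 1) * ρx t y * u t y = β * ((ρ t y ^ (1 / 2 : ℝ) *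
          (ρ t y ^ (α - 2) * ρx t y)) * (ρ t y ^ (1 + ε - α) * u t y)) := by
        have e1 : ρ t y ^ (β - 1) = ρ t y ^ (1 / 2 : ℝ) * ρ t y ^ (α - 2) * ρ t y ^ (1 + ε - α) := by
          rw [← Real.rpow_add (hpos y), ← Real.rpow_add (hpos y)]
          congr 1
          rw [hβ]
          ring
        rw [e1]
        ring
      have eA : (ρ t y ^ (1 / 2 : ℝ) * (ρ t y ^ (α - 2) * ρx t y)) ^ 2 =
          ρ t y * (ρ t y ^ (α - 2) * ρx t y) ^ 2 := by
        rw [mul_pow, ← Real.rpow_natCast (ρ t y ^ (1 / 2 : ℝ)), ← Real.rpow_mul (hpos y).le]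
        norm_num
      have eB : (ρ t y ^ (1 + ε - α) * u t y) ^ 2 = ρ t y ^ (2 * (1 + ε - α)) * u t y ^ 2 := by
        rw [mul_pow, ← Real.rpow_natCast (ρ t y ^ (1 + ε - α)), ← Real.rpow_mul (hpos y).le]
        congr 2
        push_cast
        ring
      have hB' := rpow_mul_sq_le_moment (v := u t y) (hpos y) (hMM y) hm1 hm
      rw [e, abs_mul, abs_of_pos (by positivity : 0 < β), Pi.add_apply, ← mul_add]
      gcongr
      rw [abs_mul]
      set A := ρ t y ^ (1 / 2 : ℝ) * (ρ t y ^ (α - 2) * ρx t y)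
      set B := ρ t y ^ (1 + ε - α) * u t y
      rw [← eA]
      have h4 : |A| * |B| ≤ A ^ 2 + B ^ 2 := by
        nlinarith [sq_nonneg (|A| - |B|), sq_abs A, sq_abs B, abs_nonneg A, abs_nonneg B]
      linarith
    · have e := integral_add iA (i2.const_mul M')
      rw [integral_const_mul] at e
      rw [integral_const_mul, mul_add β M']
      simp only [Pi.add_apply]
      rw [e]
      gcongr
      · exact h2.trans (le_abs_self K)
      · exact h3.trans (le_abs_self K)
  -- Here `2β - α = 1 + 2ε - α > 0`, so `ρ^(2β) u_x²` is a bounded multiple of the dissipation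
  -- density.
  have b3 : ∫ y in x..(x + 1), |ρ t y ^ β * ux t y| ≤ √(X * ∫ y, ρ t y ^ α * ux t y ^ 2) := by
    refine intervalIntegral_abs_le_sqrt l2 ?_ x
    rw [← integral_const_mul]
    refine integral_mono l2.integrable_sq (i3.const_mul X) fun y => ?_
    have e : (ρ t y ^ β * ux t y) ^ 2 = ρ t y ^ (2 * β - α) * (ρ t y ^ α * ux t y ^ 2) := by
      rw [mul_pow, ← mul_assoc, ← Real.rpow_add (hpos y), ← Real.rpow_natCast (ρ t y ^ β),
        ← Real.rpow_mul (hpos y).le]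
      congr 2
      push_cast
      ring
    simp only [e]
    have := hpos y
    have h4 : ρ t y ^ (2 * β - α) ≤ X :=
      Real.rpow_le_rpow (hpos y).le (hMM y) (by rw [hβ]; linarith)
    gcongr
  have b4 : ∫ y in x..(x + 1), |β * ρ t y ^ (β - 1) * ρx t y * u t y + ρ t y ^ β * ux t y| ≤
      (∫ y in x..(x + 1), |β * ρ t y ^ (β - 1) * ρx t y * u t y|) +
        ∫ y in x..(x + 1), |ρ t y ^ β * ux t y| := by
    rw [← intervalIntegral.integral_add hp1i.abs l2i.abs]
    exact intervalIntegral.integral_mono_on (by linarith) hfi.abs (hp1i.abs.add l2i.abs)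
      fun y _ => abs_add_le _ _
  set D := ∫ y, ρ t y ^ α * ux t y ^ 2
  have hD : 0 ≤ D := integral_nonneg fun y => by
    have := hpos y
    positivity
  have hfin : |ρ t x ^ β * u t x| ≤ N + √(X * D) := by
    have := hp.abs_le x
    linarith
  have hsq : (√(X * D)) ^ 2 = X * D := Real.sq_sqrt (by positivity)
  have h5 : (ρ t x ^ β * u t x) ^ 2 ≤ (N + √(X * D)) ^ 2 := by
    rw [← sq_abs]
    gcongr
  have h6 : 0 ≤ N ^ 2 * D := by positivity
  nlinarith [sq_nonneg (N - √(X * D))]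

end Sol

/-! ### Continuity in time with values in `L^∞` -/

/-- A function with `f_t ∈ L²L²` and `f_x ∈ L^∞L²` is Hölder continuous in time, uniformly in
space. -/
lemma Reg.sq_sub_le_sqrt {T : ℝ} {f ft fx : ℝ → ℝ → ℝ} (hT : 0 < T) (hf : Reg T f ft fx)
    (hft : MemL2L2 T ft) (hfx : LinfL2 T fx) :
    ∃ C : ℝ, 0 ≤ C ∧ ∀ s ∈ Icc 0 T, ∀ t ∈ Icc 0 T, ∀ x, (f t x - f s x) ^ 2 ≤ C * √|t - s| := by
  obtain ⟨K, hK⟩ := hfx.bound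
  -- Hölder continuity in `x`, first for almost every time and then for all times by continuity.
  have hspace : ∀ t ∈ Icc 0 T, ∀ x y, x ≤ y → (f t y - f t x) ^ 2 ≤ (y - x) * |K| := by
    intro t ht x y hxy
    have hcx : ∀ x, ContinuousOn (fun t => f t x) (Icc 0 T) := fun x =>
      hf.cont.comp (f := fun t : ℝ => (t, x)) (by fun_prop) fun t ht => ⟨ht, trivial⟩
    refine le_of_ae_le hT (f := fun t => (f t y - f t x) ^ 2) (((hcx y).sub (hcx x)).pow 2) ?_ t ht
    filter_upwards [hK, hf.prim_x] with t ⟨h1, h2⟩ h3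
    refine (h3.sq_sub_le trivial trivial hxy h1.integrable_sq.integrableOn).trans ?_
    have : 0 ≤ y - x := by linarith
    gcongr
    exact (setIntegral_le_integral h1.integrable_sq (.of_forall fun _ => sq_nonneg _)).trans
      (h2.trans (le_abs_self K))
  have hsq : Integrable (fun z : ℝ × ℝ => ft z.1 z.2 ^ 2)
      ((volume.restrict (Ioo 0 T)).prod (volume : Measure ℝ)) := by
    rw [← restrict_strip]
    exact hft.integrable_sq
  set J : ℝ → ℝ := fun y => ∫ τ in Ioo 0 T, ft τ y ^ 2 with hJ
  have hJi : Integrable J := hsq.integral_prod_right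
  have hJ0 : ∀ y, 0 ≤ J y := fun y => integral_nonneg fun _ => sq_nonneg _
  have hI0 : 0 ≤ ∫ y, J y := integral_nonneg hJ0
  have htime : ∀ s ∈ Icc 0 T, ∀ t ∈ Icc 0 T, s ≤ t →
      ∀ᵐ y, (f t y - f s y) ^ 2 ≤ (t - s) * J y := by
    intro s hs t ht hst
    filter_upwards [hf.prim_t, hsq.prod_left_ae] with y h1 h2
    have h3 : IntegrableOn (fun τ => ft τ y ^ 2) (Ioc s t) := by
      have : IntegrableOn (fun τ => ft τ y ^ 2) (Icc 0 T) := by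
        rw [integrableOn_Icc_iff_integrableOn_Ioo]
        exact h2
      exact this.mono_set (Ioc_subset_Icc_self.trans (Icc_subset_Icc hs.1 ht.2))
    refine (h1.sq_sub_le hs ht hst h3).trans ?_
    have : 0 ≤ t - s := by linarith
    gcongr
    rw [integral_Ioc_eq_integral_Ioo]
    exact setIntegral_mono_set h2 (.of_forall fun _ => sq_nonneg _)
      (LE.le.eventuallyLE (Ioo_subset_Ioo hs.1 ht.2))
  have key : ∀ s ∈ Icc 0 T, ∀ t ∈ Icc 0 T, s < t → ∀ x,
      (f t x - f s x) ^ 2 ≤ (6 * |K| + 3 * ∫ y, J y) * √(t - s) := by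
    intro s hs t ht hst x
    -- The time increment at `x` is compared with those at points of `[x, x + η]` and averaged. The
    -- spatial error is of order `η` and the temporal one of order `(t - s) / η`; this choice
    -- balances them.
    set η := √(t - s) with hη
    have hts : 0 < t - s := by linarith
    have hη0 : 0 < η := Real.sqrt_pos.2 hts
    have hη2 : η ^ 2 = t - s := Real.sq_sqrt hts.le
    have hmaj : IntegrableOn (fun y => 6 * (|K| * η) + 3 * ((t - s) * J y)) (Ioc x (x + η)) :=
      (integrableOn_const (by simp)).add ((hJi.const_mul _).const_mul _).integrableOn
    have h1 : ∫ y in Ioc x (x + η), (f t x - f s x) ^ 2 ≤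
        ∫ y in Ioc x (x + η), (6 * (|K| * η) + 3 * ((t - s) * J y)) := by
      refine setIntegral_mono_ae_restrict (integrableOn_const (by simp)) hmaj ?_
      filter_upwards [ae_restrict_of_ae (htime s hs t ht hst.le),
        ae_restrict_mem measurableSet_Ioc] with y h2 hy
      have h3 := hspace t ht x y hy.1.le
      have h4 := hspace s hs x y hy.1.le
      have h5 : (y - x) * |K| ≤ |K| * η := by
        rw [mul_comm]
        gcongr
        linarith [hy.2]
      have h6 : (f t x - f s x) ^ 2 ≤ 3 * (f t y - f t x) ^ 2 + 3 * (f t y - f s y) ^ 2 +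
          3 * (f s y - f s x) ^ 2 := by
        have e : f t x - f s x = -(f t y - f t x) + (f t y - f s y) + (f s y - f s x) := by ring
        rw [e]
        nlinarith [sq_nonneg (-(f t y - f t x) - (f t y - f s y)),
          sq_nonneg (-(f t y - f t x) - (f s y - f s x)),
          sq_nonneg ((f t y - f s y) - (f s y - f s x))]
      linarith
    rw [integral_add (integrable_const _) ((hJi.const_mul _).const_mul _).integrableOn,
      setIntegral_const, setIntegral_const] at h1
    simp only [Real.volume_real_Ioc_of_le (by linarith : x ≤ x + η), add_sub_cancel_left,
      smul_eq_mul, integral_const_mul] at h1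
    have h7 : ∫ y in Ioc x (x + η), J y ≤ ∫ y, J y :=
      setIntegral_le_integral hJi (.of_forall hJ0)
    have h8 : (t - s) * ∫ y in Ioc x (x + η), J y ≤ (t - s) * ∫ y, J y := by gcongr
    refine le_of_mul_le_mul_left ?_ hη0
    rw [← hη2] at h1 h8
    nlinarith
  refine ⟨6 * |K| + 3 * ∫ y, J y, by positivity, fun s hs t ht x => ?_⟩
  rcases lt_trichotomy s t with h | h | h
  · rw [abs_of_pos (sub_pos.2 h)]
    exact key s hs t ht h x
  · subst h
    simp
  · rw [abs_sub_comm, abs_of_pos (sub_pos.2 h)]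
    have := key t ht s hs h x
    calc _ = (f s x - f t x) ^ 2 := by ring
      _ ≤ _ := this

/-! ### Square integrable maps into `L^∞` -/

lemma norm_toLp_top_le {f : ℝ → ℝ} (hf : MemLp f ∞ volume) {M : ℝ} (hM0 : 0 ≤ M)
    (hM : ∀ x, |f x| ≤ M) : ‖hf.toLp f‖ ≤ M := by
  rw [Lp.norm_toLp, eLpNorm_exponent_top]
  exact ENNReal.toReal_le_of_le_ofReal hM0 (eLpNormEssSup_le_of_ae_bound (.of_forall hM))

/-- A criterion for `f ∈ L²([0, T₀]; L^∞(ℝ))`. -/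
lemma memL2Linfty_of_continuous {T₀ : ℝ} (f : ℝ → ℝ → ℝ)
    (hf : ∀ t ∈ Ioo 0 T₀, MemLp (f t) ∞ volume)
    (hcont : ∀ T ∈ Ioo 0 T₀, ∃ C : ℝ, 0 ≤ C ∧ ∀ s ∈ Icc 0 T, ∀ t ∈ Icc 0 T, ∀ x,
      (f t x - f s x) ^ 2 ≤ C * √|t - s|)
    {B : ℝ} (hB : ∀ T ∈ Ioo 0 T₀, ∃ m : ℝ → ℝ, IntegrableOn m (Ioo 0 T) ∧
      (∀ᵐ t ∂volume.restrict (Ioo 0 T), ∀ x, f t x ^ 2 ≤ m t) ∧ ∫ t in Ioo 0 T, m t ≤ B) :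
    MemL2Linfty T₀ f := by
  classical
  set F : ℝ → Lp ℝ ∞ (volume : Measure ℝ) := fun t =>
    if h : t ∈ Ioo 0 T₀ then (hf t h).toLp (f t) else 0 with hF
  have hFt : ∀ t (h : t ∈ Ioo 0 T₀), F t = (hf t h).toLp (f t) := fun t h => dif_pos h
  -- As `L^∞` is not separable, strong measurability of `F` is obtained from its norm continuity on
  -- the open interval.
  have hFc : ContinuousOn F (Ioo 0 T₀) := by
    intro t ht
    obtain ⟨T, hT1, hT2⟩ := exists_between ht.2
    obtain ⟨C, hC0, hC⟩ := hcont T ⟨ht.1.trans hT1, hT2⟩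
    refine ContinuousAt.continuousWithinAt ?_
    rw [ContinuousAt, tendsto_iff_dist_tendsto_zero]
    have hlim : Tendsto (fun s => √(C * √|s - t|)) (𝓝 t) (𝓝 0) := by
      have : Continuous fun s => √(C * √|s - t|) := by fun_prop
      simpa using this.tendsto t
    refine tendsto_of_tendsto_of_tendsto_of_le_of_le' tendsto_const_nhds hlim
      (.of_forall fun _ => dist_nonneg) ?_
    filter_upwards [Ioo_mem_nhds ht.1 hT1] with s hs
    have hs' : s ∈ Ioo 0 T₀ := ⟨hs.1, hs.2.trans hT2⟩
    rw [hFt s hs', hFt t ht, dist_eq_norm, ← MemLp.toLp_sub]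
    refine norm_toLp_top_le _ (Real.sqrt_nonneg _) fun x => ?_
    exact Real.abs_le_sqrt (hC t ⟨ht.1.le, hT1.le⟩ s ⟨hs.1.le, hs.2.le⟩ x)
  have hlint : ∀ T ∈ Ioo 0 T₀, ∫⁻ t in Ioo 0 T, ‖F t‖ₑ ^ 2 ≤ ENNReal.ofReal B := by
    intro T hT
    obtain ⟨m, hm, hfm, hmB⟩ := hB T hT
    have hm0 : ∀ᵐ t ∂volume.restrict (Ioo 0 T), 0 ≤ m t := by
      filter_upwards [hfm] with t ht using (sq_nonneg _).trans (ht 0)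
    calc ∫⁻ t in Ioo 0 T, ‖F t‖ₑ ^ 2 ≤ ∫⁻ t in Ioo 0 T, ENNReal.ofReal (m t) := by
          refine lintegral_mono_ae ?_
          filter_upwards [hfm, hm0, ae_restrict_mem measurableSet_Ioo] with t h1 h2 ht
          rw [hFt t ⟨ht.1, ht.2.trans hT.2⟩, ← ofReal_norm,
            ← ENNReal.ofReal_pow (norm_nonneg _)]
          refine ENNReal.ofReal_le_ofReal ?_
          rw [← Real.sq_sqrt h2]
          gcongr
          exact norm_toLp_top_le _ (Real.sqrt_nonneg _) fun x => Real.abs_le_sqrt (h1 x)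
      _ = ENNReal.ofReal (∫ t in Ioo 0 T, m t) :=
          (ofReal_integral_eq_lintegral_ofReal hm hm0).symm
      _ ≤ _ := ENNReal.ofReal_le_ofReal hmB
  have hμ : (volume : Measure ℝ).restrict (Icc 0 T₀) = volume.restrict (Ioo 0 T₀) :=
    Measure.restrict_congr_set Ioo_ae_eq_Icc.symm
  refine ⟨F, ?_, ?_⟩
  · rw [hμ]
    refine ⟨hFc.aestronglyMeasurable measurableSet_Ioo, ?_⟩
    have h1 : ∫⁻ t in Ioo 0 T₀, ‖F t‖ₑ ^ 2 ≤ ENNReal.ofReal B := by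
      rcases le_or_gt T₀ 0 with h | h
      · simp [Ioo_eq_empty_of_le h]
      obtain ⟨d, hdm, hd, hdt⟩ := exists_seq_strictMono_tendsto' h
      -- Exhaustion from inside by intervals on which the bound `B` is available; monotone
      -- convergence carries it to `T₀`.
      have e : Ioo 0 T₀ = ⋃ n, Ioo 0 (d n) := by
        ext t
        simp only [mem_iUnion, mem_Ioo]
        constructor
        · rintro ⟨h1, h2⟩
          obtain ⟨n, hn⟩ := ((hdt.eventually (lt_mem_nhds h2))).exists
          exact ⟨n, h1, hn⟩
        · rintro ⟨n, h1, h2⟩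
          exact ⟨h1, h2.trans (hd n).2⟩
      rw [e, setLIntegral_iUnion_of_directed]
      · exact iSup_le fun n => hlint _ (hd n)
      · exact Monotone.directed_le fun i j hij => Ioo_subset_Ioo_right (hdm.monotone hij)
    rw [← eLpNorm_two_sq] at h1
    exact (ENNReal.pow_lt_top_iff (n := 2)).1 (lt_of_le_of_lt h1 ENNReal.ofReal_lt_top) |>.resolve_right (by norm_num)
  · rw [hμ]
    filter_upwards [ae_restrict_mem measurableSet_Ioo] with t ht
    rw [hFt t ht]
    exact (hf t ht).coeFn_toLp

/-! ### Conclusion -/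

lemma MemH1.prim_of_continuous {f : ℝ → ℝ} (h : MemH1 f) (hc : Continuous f) :
    ∃ g, Prim univ f g ∧ MemLp g 2 volume := by
  obtain ⟨_, g, hg, hgL⟩ := h
  obtain ⟨w, hw, hp⟩ := hg.exists_prim
  rw [← eq_of_ae_eq_of_continuous hc hp.continuous hw] at hp
  exact ⟨g, hp, hgL⟩

lemma initial_bounds {α γ a T₀ ρm ρp : ℝ} {ρbar ρ0 u0 : ℝ → ℝ} {ρ u : ℝ → ℝ → ℝ} (hγ : 1 < γ)
    (ha : 0 < a) (hT₀ : 0 < T₀) (hbar : IsReferenceDensity ρm ρp ρbar)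
    (hinit : IsInitialData ρbar ρ0 u0) (hsol : IsStrongSolution α γ a T₀ ρbar ρ0 u0 ρ u) :
    ∃ (q₀ : ℝ → ℝ) (C₀ : ℝ), (∀ x, 0 < ρ 0 x ∧ ρ 0 x ≤ C₀) ∧ MemLp (u 0) 2 volume ∧
      MemLp q₀ 2 volume ∧ Prim univ (fun x => viscousPotential α (ρ 0 x)) q₀ ∧
      (∀ k : ℕ, Integrable fun x => ρ 0 x * u 0 x ^ (k + 2)) ∧
      Integrable fun x => relEnergy a γ (ρ 0 x) (ρbar x) := by
  have h0 : (0 : ℝ) ∈ Icc 0 (T₀ / 2) := ⟨le_rfl, by linarith⟩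
  have hsub : Icc 0 (T₀ / 2) ×ˢ (univ : Set ℝ) ⊆ Ico 0 T₀ ×ˢ univ :=
    prod_mono (fun t ht => ⟨ht.1, lt_of_le_of_lt ht.2 (by linarith)⟩) le_rfl
  have hρc : Continuous (ρ 0) := slice_continuous (hsol.density_cont.mono hsub) h0
  have huc : Continuous (u 0) := slice_continuous (hsol.velocity_cont.mono hsub) h0
  have eρ : ρ 0 = ρ0 := funext hsol.density_init
  have eu : u 0 = u0 := funext hsol.velocity_init
  rw [eρ] at hρc ⊢
  rw [eu] at huc ⊢
  obtain ⟨c, C, hc, hb⟩ := hinit.bounds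
  have hbarc : Continuous ρbar := hbar.smooth.continuous
  obtain ⟨g, hg, hgL⟩ := hinit.velocity.prim_of_continuous huc
  obtain ⟨r, hr, hrL⟩ := hinit.density.prim_of_continuous (hρc.sub hbarc)
  have hbp : Prim univ ρbar (deriv ρbar) := Prim.of_hasDerivAt
    (fun x _ => (hbar.smooth.differentiable (by norm_num) x).hasDerivAt)
    (continuous_deriv_reference hbar).continuousOn
  have hρp : Prim univ ρ0 (fun x => r x + deriv ρbar x) := by
    have := hr.add hbp
    simpa only [sub_add_cancel] using this
  have hρL : MemLp (fun x => r x + deriv ρbar x) 2 volume := hrL.add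
    ((continuous_deriv_reference hbar).memLp_of_hasCompactSupport
      (hasCompactSupport_deriv_reference hbar))
  have hpos : ∀ x, 0 < ρ0 x := fun x => lt_of_lt_of_le hc (hb x).1
  have hq := hρp.comp (G := viscousPotential α) (G' := fun y => y ^ (α - 2)) (J := Icc c C)
    (fun y hy => viscousPotential_hasDerivAt α (lt_of_lt_of_le hc hy.1)) (rpow_continuousOn hc)
    (fun x _ => hb x)
  obtain ⟨N, hN⟩ := isCompact_Icc.exists_bound_of_continuousOn
    (rpow_continuousOn (p := α - 2) (C := C) hc)
  have huL := hinit.velocity.1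
  refine ⟨_, C, fun x => ⟨hpos x, (hb x).2⟩, huL, ?_, hq, fun k => ?_, ?_⟩
  · refine MemLp.of_le_mul (c := N) hρL (AEStronglyMeasurable.mul ?_ hρL.1) (.of_forall fun x => ?_)
    · exact (hρc.rpow_const fun x => Or.inl (hpos x).ne').aestronglyMeasurable
    · rw [norm_mul]
      gcongr
      exact hN _ (hb x)
  -- The embedding of `H¹` in `L^∞` makes every surplus power of `u₀` bounded.
  · set B := 2 * (∫ y, u0 y ^ 2) + 2 * ∫ y, g y ^ 2
    have hB : ∀ x, |u0 x| ≤ √B := fun x => Real.abs_le_sqrt (hg.sq_le huL hgL x)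
    have hcont : Continuous fun x => ρ0 x * u0 x ^ k := hρc.mul (huc.pow k)
    refine (Integrable.bdd_mul (c := C * √B ^ k) huL.integrable_sq hcont.aestronglyMeasurable
      (.of_forall fun x => ?_)).congr (.of_forall fun x => ?_)
    · rw [norm_mul, norm_pow, Real.norm_eq_abs, Real.norm_eq_abs, abs_of_pos (hpos x)]
      have h1 := (hpos x).le.trans (hb x).2
      have h2 := (hb x).2
      have h3 := hB x
      gcongr
    · ring
  · refine Sol.integrable_relEnergy_slice (c := min c (min ρm ρp)) (C := max C (max ρm ρp)) ha hγ
      (lt_min hc (lt_min hbar.left_pos hbar.right_pos)) hρc hbarc (fun x => ?_) (fun x => ?_)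
      hinit.density.1
    · exact ⟨(min_le_left _ _).trans (hb x).1, (hb x).2.trans (le_max_left _ _)⟩
    · exact ⟨(min_le_right _ _).trans (reference_bounds hbar x).1,
        (reference_bounds hbar x).2.trans (le_max_right _ _)⟩

namespace Sol

variable {α γ a T ρm ρp : ℝ} {ρbar : ℝ → ℝ} {ρ u ρt ρx ut ux uxx : ℝ → ℝ → ℝ}

/-- Qualitative input for measurability only: the constant depends on the regularity on `[0, T]` and
may blow up as `T` approaches the final time. -/
lemma weighted_velocity_holder (h : Sol α γ a T ρbar ρ u ρt ρx ut ux uxx) (β : ℝ) :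
    ∃ C : ℝ, 0 ≤ C ∧ ∀ s ∈ Icc 0 T, ∀ t ∈ Icc 0 T, ∀ x,
      (ρ t x ^ β * u t x - ρ s x ^ β * u s x) ^ 2 ≤ C * √|t - s| := by
  have hβ := h.exists_reg_rpow β
  have hβ' := ((h.exists_reg_rpow (β - 1)).const_mul β).mul h.u_reg
  refine Reg.sq_sub_le_sqrt h.T_pos (hβ.mul h.u_reg) ?_ ?_
  · refine (memLp_congr_ae (.of_forall fun z => ?_)).1
      ((h.rhot_L2.bdd_mul hβ').add (h.ut_L2.bdd_mul hβ))
    simp only [Pi.add_apply]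
    ring
  · refine ((h.rhox_L2.bdd_mul hβ').add (h.ux_L2.bdd_mul hβ)).congr (.of_forall fun z => ?_)
    ring

end Sol

/-- The uniform a priori bound on the dissipation and on the supremum of `ρ ^ (1/2 + ε) u`. -/
lemma exists_uniform_bound {α γ a ε T₀ ρm ρp : ℝ} {ρbar ρ0 u0 : ℝ → ℝ} {ρ u : ℝ → ℝ → ℝ}
    (hα : 1 / 2 < α) (hα' : α ≤ 1) (hγ : 1 < γ) (ha : 0 < a) (hε : 0 < ε) (hT₀ : 0 < T₀)
    (hbar : IsReferenceDensity ρm ρp ρbar) (hinit : IsInitialData ρbar ρ0 u0)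
    (hsol : IsStrongSolution α γ a T₀ ρbar ρ0 u0 ρ u) :
    ∃ C K : ℝ, 0 ≤ C ∧ ∀ T ≤ T₀, ∀ ρt ρx ut ux uxx, Sol α γ a T ρbar ρ u ρt ρx ut ux uxx →
      ∀ᵐ t ∂volume.restrict (Ioo 0 T), (∫ z in strip t, ρ z.1 z.2 ^ α * ux z.1 z.2 ^ 2 ≤ K) ∧
        ∀ x, (ρ t x ^ (1 / 2 + ε) * u t x) ^ 2 ≤ C * (1 + ∫ y, ρ t y ^ α * ux t y ^ 2) := by
  obtain ⟨q₀, C₀, hC₀, hu0, hq0, hp0, hmom0, hE0⟩ := initial_bounds hγ ha hT₀ hbar hinit hsol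
  obtain ⟨K₁, _, hK₁⟩ := Sol.energy_bound (α := α) hbar ha hγ T₀ ρ u (hmom0 0) hE0
  obtain ⟨K₂, _, hK₂⟩ := Sol.entropy_bound hbar ha hγ T₀ ρ u hC₀ hu0 hq0 hp0 (hmom0 0) hE0
  obtain ⟨M, hM0, hM⟩ := Sol.exists_density_bound hα hα' hbar ha hγ (max K₁ K₂)
  have hM' : ∀ T ≤ T₀, ∀ ρt ρx ut ux uxx, Sol α γ a T ρbar ρ u ρt ρx ut ux uxx →
      ∀ t ∈ Icc 0 T, ∀ x, ρ t x ≤ M := fun T hT ρt ρx ut ux uxx h =>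
    hM T ρ u ρt ρx ut ux uxx h
      (by filter_upwards [hK₁ T hT _ _ _ _ _ h] with t ht using ht.2.1.trans (le_max_left _ _))
      (by filter_upwards [hK₂ T hT _ _ _ _ _ h] with t ht using ht.trans (le_max_right _ _))
  -- The moment of order `2 (m + 1)` suffices: `1 / (m + 1) ≤ 2ε ≤ 2 (1 + ε - α)` because `α ≤ 1`.
  obtain ⟨m, hm⟩ := exists_nat_gt (2 * ε)⁻¹
  obtain ⟨K₃, hK₃⟩ := Sol.moment_bound hα' ha hγ ρ u hmom0 hM0.le hM'
    (fun T hT ρt ρx ut ux uxx h => by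
      filter_upwards [hK₁ T hT _ _ _ _ _ h] with t ht using ht.1) m
  have hms : ((m + 1 : ℕ) : ℝ)⁻¹ ≤ 2 * (1 + ε - α) := by
    have h1 : ((m + 1 : ℕ) : ℝ)⁻¹ ≤ 2 * ε := by
      rw [inv_le_comm₀ (by positivity) (by positivity)]
      push_cast
      linarith
    linarith
  obtain ⟨C, hC0, hC⟩ := Sol.exists_sup_bound (γ := γ) (a := a) (ρbar := ρbar) hα' hε M
    (max K₁ (max K₂ K₃)) (m := m + 1) (by omega) hms
  refine ⟨C, K₁, hC0, fun T hT ρt ρx ut ux uxx h => ?_⟩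
  have hE := hK₁ T hT _ _ _ _ _ h
  filter_upwards [hE, hC T ρ u ρt ρx ut ux uxx h (hM' T hT _ _ _ _ _ h)
    (by filter_upwards [hE] with t ht using ht.1.trans (le_max_left _ _))
    (by filter_upwards [hK₂ T hT _ _ _ _ _ h] with t ht using
      ht.trans ((le_max_left _ _).trans (le_max_right _ _)))
    (by filter_upwards [hK₃ T hT _ _ _ _ _ h] with t ht using
      ht.trans ((le_max_right _ _).trans (le_max_right _ _)))] with t h1 h2
  exact ⟨h1.2.2.1, h2⟩

end CNS

end

theorem proposition3p3
    (α γ a ε T₀ : ℝ) (hα : 1 / 2 < α) (hα' : α ≤ 1) (hγ : 1 < γ) (ha : 0 < a)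
    (hε : 0 < ε) (hε' : ε < 1 / 4) (hT₀ : 0 < T₀)
    (ρm ρp : ℝ) (ρbar : ℝ → ℝ) (hρbar : CNS.IsReferenceDensity ρm ρp ρbar)
    (ρ0 u0 : ℝ → ℝ) (hinit : CNS.IsInitialData ρbar ρ0 u0)
    (ρ u : ℝ → ℝ → ℝ) (hsol : CNS.IsStrongSolution α γ a T₀ ρbar ρ0 u0 ρ u) :
    CNS.MemL2Linfty T₀ (fun t x => ρ t x ^ (1 / 2 + ε) * u t x) := by
  open CNS in
  obtain ⟨C, K, hC0, hCK⟩ := exists_uniform_bound hα hα' hγ ha hε hT₀ hρbar hinit hsol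
  -- `B` bounds the time integral of `C (1 + D)`, where `D` is the dissipation at a given time and
  -- `K` bounds its total.
  refine memL2Linfty_of_continuous (B := C * (T₀ + K)) _ (fun t ht => ?_) (fun T hT => ?_)
    fun T hT => ?_
  · obtain ⟨ρt, ρx, ut, ux, uxx, h⟩ := exists_sol hρbar hsol ht
    have ht' : t ∈ Icc 0 t := ⟨ht.1.le, le_rfl⟩
    have hr := (h.exists_reg_rpow (1 / 2 + ε)).mul h.u_reg
    obtain ⟨M, hM⟩ := hr.bdd
    have hc : Continuous fun x => ρ t x ^ (1 / 2 + ε) * u t x :=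
      slice_continuous (f := fun t x => ρ t x ^ (1 / 2 + ε) * u t x) hr.cont ht'
    exact memLp_top_of_bound hc.aestronglyMeasurable M
      (.of_forall fun x => hM t ht' x)
  · obtain ⟨ρt, ρx, ut, ux, uxx, h⟩ := exists_sol hρbar hsol hT
    exact h.weighted_velocity_holder (1 / 2 + ε)
  -- The dissipation bound holds only for almost every time, so it is read off at some `t` in `(T,
  -- T')` and transferred to `T` by monotonicity.
  · obtain ⟨T', hT1, hT2⟩ := exists_between hT.2
    obtain ⟨ρt, ρx, ut, ux, uxx, h⟩ := exists_sol hρbar hsol ⟨hT.1.trans hT1, hT2⟩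
    have hae := hCK T' hT2.le ρt ρx ut ux uxx h
    have hdis := h.integrable_dissipation 0
    simp only [pow_zero, one_mul] at hdis
    have hdT := hdis.mono_set (strip_mono hT1.le)
    have hD := integrableOn_integral_slice (f := fun t x => ρ t x ^ α * ux t x ^ 2) hdT
    have h1 : IntegrableOn (fun _ : ℝ => (1 : ℝ)) (Ioo 0 T) := integrableOn_const (by simp)
    refine ⟨fun t => C * (1 + ∫ y, ρ t y ^ α * ux t y ^ 2), (h1.add hD).const_mul C, ?_, ?_⟩
    · filter_upwards [ae_restrict_of_ae_restrict_of_subset (Ioo_subset_Ioo_right hT1.le) hae]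
        with t ht using ht.2
    · have hK : ∫ z in strip T, ρ z.1 z.2 ^ α * ux z.1 z.2 ^ 2 ≤ K := by
        have hne : (ae ((volume : Measure ℝ).restrict (Ioo T T'))).NeBot := by
          rw [ae_neBot, Ne, Measure.restrict_eq_zero, Real.volume_Ioo]
          simpa using hT1
        obtain ⟨t, ht, htT⟩ := ((ae_restrict_of_ae_restrict_of_subset
          (Ioo_subset_Ioo_left hT.1.le) hae).and (ae_restrict_mem measurableSet_Ioo)).exists
        refine (setIntegral_mono_set (hdis.mono_set (strip_mono htT.2.le)) ?_
          (LE.le.eventuallyLE (strip_mono htT.1.le))).trans ht.1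
        filter_upwards [ae_restrict_mem (measurableSet_strip t)] with z hz
        have := h.rho_pos (Ioo_subset_Icc_self (strip_mono htT.2.le hz).1) z.2
        simp only [Pi.zero_apply]
        positivity
      rw [integral_const_mul, integral_add h1 hD,
        ← integral_strip_eq (f := fun t x => ρ t x ^ α * ux t x ^ 2) hdT, setIntegral_const]
      simp only [Real.volume_real_Ioo_of_le hT.1.le, sub_zero, smul_eq_mul, mul_one]
      have := hT.2.le
      gcongr
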